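/- For a set $N\subseteq\mathbb N$ of system sizes and, for each $n\in N$, a set $E_n\subseteq\{(i,j)\mid 1\le i<j\le n\}$ of edges leaving no vertex of $\{1,\dots,n\}$ isolated, the Ising model $\mathcal M=(N,E)$ has the Hamiltonian $H_{\mathcal M}(s_1\ldots s_n)=\sum_{(i,j)\in E_n}h(s_i,s_j)$ for $n\in N$, $s_i\in\{0,1\}$, where $h(a,b)=-1$ if $a=b$ and $h(a,b)=+1$ otherwise. With the unary encoding $u(z)=+^{z}$ for $z\ge 0$ and $u(z)=-^{|z|}$ for $z<0$, its language and its edge language are $$\mathsf L_{\mathcal M}=\{s_1\ldots s_n\bullet u(H_{\mathcal M}(s_1\ldots s_n))\mid n\in N,\ s_i\in\{0,1\}\},\qquad \mathsf E_{\mathcal M}=\{0^{i-1}10^{j-i-1}10^{n-j}\mid n\in N,\ (i,j)\in E_n\}.$$ $\mathcal M$ is *linear* if there is $k\in\mathbb N$ with $|E_n|\le kn$ for all $n\in N$, and *limited* if there is $b\in\mathbb N$ such that for all $n\in N$ and $(i,j)\in E_n$, $j-i>b$ implies $i\le b$ or $n-j\le b$. $\mathsf L_{\mathcal M}$ is *constructive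 context free* if it is decided by a (nondeterministic) pushdown automaton $P$ such that for every $n\in N$ there is a unique partition $E_n=I_1\sqcup\dots\sqcup I_r$ for which, on all inputs $s_1\ldots s_n\bullet\sigma^k$ ($\sigma\in\{+,-\}$, $k\ge 0$), $P$ works as follows: for $m=1,\dots,r$ in turn it stores the spins touched by $I_m$ in its state and then adds $\sum_{(i,j)\in I_m}h(s_i,s_j)$, in unary, to its stack; after this the stack contains $u(H_{\mathcal M}(s_1\ldots s_n))$, and $P$ compares it with $\sigma^k$ and accepts if and only if the two are equal. $\mathsf L_{\mathcal M}$ is *constructive context sensitive* if it is decided by a (nondeterministic, multi-tape) linear bounded automaton that, on all inputs $s_1\ldots s_n\bullet\sigma^k$ with $n\in N$, accumulates $H_{\mathcal M}(s_1\ldots s_n)$ in binary on a designated energy tape, by adding the contributions $h(s_i,s_j)$ of the edges one after the other in an order that depends on $n$ only, then compares the result with the input energy $\sigma^k$ and accepts if and only if the two coincide. The 2d Ising model $\mathcal M_{\mathrm{2d}}$ has $N_{\mathrm{2d}}=\{n^2\mid n\ge 2\}$ and $$(E_{\mathrm{2d}})_{n^2}=\{(i,i+1)\mid 1\le i\le n^2-1,\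 n\nmid i\}\cup\{(i,i+n)\mid 1\le i\le n^2-n\}.$$ **Statement.** The edge language $\mathsf E_{\mathrm{2d}}$ is context sensitive (generated by a grammar all of whose rules are of the form $aBc\to adc$ with $B$ a non-terminal and $d\neq\epsilon$), and the language $\mathsf L_{\mathrm{2d}}$ is constructive context sensitive. The model $\mathcal M_{\mathrm{2d}}$ is linear but not limited. The language $\mathsf L_{\mathrm{2d}}$ is not constructive context free, and it is not even context free. -/

import Mathlib

/-! Ising models and their languages -/

namespace Ising

/-- An Ising model: a set of system sizes and, for every such size `n`, a set of edges `(i, j)` with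
`1 ≤ i < j ≤ n` that leaves no vertex of `{1, …, n}` isolated.
The values of `edges` outside `sizes` are never used. -/
structure Model where
  sizes : Set ℕ
  edges : ℕ → Finset (ℕ × ℕ)
  edges_mem : ∀ n ∈ sizes, ∀ e ∈ edges n, 1 ≤ e.1 ∧ e.1 < e.2 ∧ e.2 ≤ n
  not_isolated : ∀ n ∈ sizes, ∀ i, 1 ≤ i → i ≤ n → ∃ e ∈ edges n, e.1 = i ∨ e.2 = i

/-- The state of the `i`-th spin (counted from `1`) of a configuration `s₁ … sₙ`. -/
def spinAt (s : List Bool) (i : ℕ) : Bool := s.getD (i - 1) false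

/-- The coupling `h`: `-1` for equal spins and `+1` for different ones. -/
def coupling (a b : Bool) : ℤ := if a = b then -1 else 1

/-- The energy of the configuration `s` along the edges in `I`. -/
def energyOn (I : Finset (ℕ × ℕ)) (s : List Bool) : ℤ :=
  ∑ e ∈ I, coupling (spinAt s e.1) (spinAt s e.2)

/-- The Hamiltonian; a configuration of `n` spins is a list of length `n`. -/
def Model.hamiltonian (M : Model) (s : List Bool) : ℤ := energyOn (M.edges s.length) s

/-- The alphabet `{0, 1, •, +, -}`. -/
inductive Letter where
  | spin (b : Bool)
  | bullet
  | plus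
  | minus
  deriving DecidableEq

/-- The unary encoding of an integer by two given symbols for `+` and `-`. -/
def unaryWith {α : Type} (p m : α) (z : ℤ) : List α :=
  if 0 ≤ z then List.replicate z.toNat p else List.replicate (-z).toNat m

/-- The unary encoding `u`. -/
def unary (z : ℤ) : List Letter := unaryWith Letter.plus Letter.minus z

/-- The symbol `+` or `-`. -/
def signLetter (neg : Bool) : Letter := if neg then Letter.minus else Letter.plus

/-- The string `s₁ … sₙ • e`. -/
def inputWord (s : List Bool) (e : List Letter) : List Letter :=
  s.map Letter.spin ++ Letter.bullet :: e

/-- The language of an Ising model. -/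
def Model.language (M : Model) : Language Letter :=
  {w | ∃ s : List Bool, s.length ∈ M.sizes ∧ w = inputWord s (unary (M.hamiltonian s))}

/-- The edge language of an Ising model, over the alphabet `{0, 1}` (`false` is `0`):
all `0^(i-1) 1 0^(j-i-1) 1 0^(n-j)` with `(i, j)` an edge of the system of size `n`. -/
def Model.edgeLanguage (M : Model) : Language Bool :=
  {w | ∃ n ∈ M.sizes, ∃ e ∈ M.edges n,
    w = List.replicate (e.1 - 1) false ++ true ::
      (List.replicate (e.2 - e.1 - 1) false ++ true :: List.replicate (n - e.2) false)}

/-- Limited: a long edge starts near the beginning or ends near the end. -/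
def Model.IsLimited (M : Model) : Prop :=
  ∃ b : ℕ, ∀ n ∈ M.sizes, ∀ e ∈ M.edges n, b < e.2 - e.1 → e.1 ≤ b ∨ n - e.2 ≤ b

/-- Linear: the number of edges is at most linear in the system size. -/
def Model.IsLinear (M : Model) : Prop :=
  ∃ k : ℕ, ∀ n ∈ M.sizes, (M.edges n).card ≤ k * n

/-! The two-dimensional model -/

/-- Horizontal edges of the `m × m` square lattice, numbered row by row. -/
def horizontal (m : ℕ) : Finset (ℕ × ℕ) :=
  ((Finset.Icc 1 (m ^ 2 - 1)).filter (fun i => ¬ m ∣ i)).image (fun i => (i, i + 1))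

/-- Vertical edges of the `m × m` square lattice, numbered row by row. -/
def vertical (m : ℕ) : Finset (ℕ × ℕ) :=
  (Finset.Icc 1 (m ^ 2 - m)).image (fun i => (i, i + m))

/-- The 2d Ising model: the system sizes are the squares `m ^ 2` with `m ≥ 2`, and the graph of size
`m ^ 2` (so that `m` is its square root) is the `m × m` square lattice. -/
def model2d : Model where
  sizes := {N | ∃ m : ℕ, 2 ≤ m ∧ N = m ^ 2}
  edges N := horizontal (Nat.sqrt N) ∪ vertical (Nat.sqrt N)
  edges_mem := by
    rintro _ ⟨m, hm, rfl⟩ e he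
    have hs : Nat.sqrt (m ^ 2) = m := Nat.sqrt_eq' m
    have h1 : m ≤ m ^ 2 := by nlinarith
    simp only [hs, horizontal, vertical, Finset.mem_union, Finset.mem_image, Finset.mem_filter,
      Finset.mem_Icc] at he
    rcases he with ⟨i, hi, rfl⟩ | ⟨i, hi, rfl⟩ <;> dsimp only <;> omega
  not_isolated := by
    rintro _ ⟨m, hm, rfl⟩ i h1 h2
    have hs : Nat.sqrt (m ^ 2) = m := Nat.sqrt_eq' m
    have h3 : 2 * m ≤ m ^ 2 := by nlinarith
    simp only [hs, horizontal, vertical, Finset.mem_union, Finset.mem_image, Finset.mem_filter,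
      Finset.mem_Icc]
    by_cases h : i ≤ m ^ 2 - m
    · exact ⟨(i, i + m), Or.inr ⟨i, ⟨h1, h⟩, rfl⟩, Or.inl rfl⟩
    · exact ⟨(i - m, i), Or.inr ⟨i - m, by omega, by ext <;> simp; omega⟩, Or.inr rfl⟩

/-! Context sensitive grammars -/

/-- A rule `a B c → a d c` with `d` non-empty. -/
structure CSRule (T N : Type) where
  left : List (Symbol T N)
  target : N
  right : List (Symbol T N)
  output : List (Symbol T N)
  output_ne_nil : output ≠ []

/-- A context sensitive grammar. -/
structure CSGrammar (T : Type) where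
  NT : Type
  finite_NT : Finite NT
  start : NT
  rules : Set (CSRule T NT)
  finite_rules : rules.Finite

/-- One application of a rule of the grammar to a substring. -/
def CSGrammar.Produces {T : Type} (G : CSGrammar T) (u v : List (Symbol T G.NT)) : Prop :=
  ∃ r ∈ G.rules, ∃ x y : List (Symbol T G.NT),
    u = x ++ r.left ++ [Symbol.nonterminal r.target] ++ r.right ++ y ∧
    v = x ++ r.left ++ r.output ++ r.right ++ y

/-- The language generated by a context sensitive grammar. -/
def CSGrammar.language {T : Type} (G : CSGrammar T) : Language T :=
  {w | Relation.ReflTransGen G.Produces [Symbol.nonterminal G.start] (w.map Symbol.terminal)}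

/-- A language is context sensitive if a context sensitive grammar generates it. -/
def IsContextSensitive {T : Type} (L : Language T) : Prop :=
  ∃ G : CSGrammar T, G.language = L

/-! Computations -/

/-- The list `r` is a computation that starts in `c₀`. -/
def IsRun {C : Type} (step : C → C → Prop) (c₀ : C) (r : List C) : Prop :=
  r.head? = some c₀ ∧ r.IsChain step

/-- `pre ++ [c]` is a computation from `c₀`, and `c` is the first configuration in it whose
property `D` holds. -/
def ReachesFirst {C : Type} (step : C → C → Prop) (D : C → Prop) (c₀ : C)
    (pre : List C) (c : C) : Prop :=
  IsRun step c₀ (pre ++ [c]) ∧ D c ∧ ∀ x ∈ pre, ¬ D x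

/-! Pushdown automata -/

/-- A (nondeterministic) pushdown automaton; `none` as a letter stands for the empty string. -/
structure PDA (α : Type) where
  State : Type
  Stack : Type
  finite_State : Finite State
  finite_Stack : Finite Stack
  δ : Set ((State × Option α × Stack) × (State × List Stack))
  finite_δ : δ.Finite
  start : State
  bottom : Stack
  accept : Set State

/-- A configuration: state, remaining input, stack with its top first. -/
structure PDA.Config {α : Type} (P : PDA α) where
  state : P.State
  input : List α
  stack : List P.Stack

/-- One computation step; it consumes the string `a.toList` of at most one letter, pops one stack
symbol, and pushes a string. -/
def PDA.Step {α : Type} (P : PDA α) (c c' : P.Config) : Prop :=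
  ∃ (a : Option α) (Z : P.Stack) (rest : List P.Stack) (γ : List P.Stack),
    ((c.state, a, Z), (c'.state, γ)) ∈ P.δ ∧
    c.input = a.toList ++ c'.input ∧ c.stack = Z :: rest ∧ c'.stack = γ ++ rest

/-- The start configuration on input `w`. -/
def PDA.init {α : Type} (P : PDA α) (w : List α) : P.Config := ⟨P.start, w, [P.bottom]⟩

/-- An accepting configuration: the whole input is processed and the state is final. -/
def PDA.Final {α : Type} (P : PDA α) (c : P.Config) : Prop := c.input = [] ∧ c.state ∈ P.accept

/-- Some computation from `c` accepts. -/
def PDA.AcceptsFrom {α : Type} (P : PDA α) (c : P.Config) : Prop :=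
  ∃ c', Relation.ReflTransGen P.Step c c' ∧ P.Final c'

/-- The language decided by a pushdown automaton. -/
def PDA.language {α : Type} (P : PDA α) : Language α := {w | P.AcceptsFrom (P.init w)}

/-- The bookkeeping of a constructive pushdown automaton: the two stack symbols of the unary
encoding, the states `load` in which a step of the iteration over the edges begins, and the states
`compare` in which the comparison with the input energy begins. -/
structure PDA.Marking {α : Type} (P : PDA α) where
  plus : P.Stack
  minus : P.Stack
  plus_ne_minus : plus ≠ minus
  load : P.State → Bool
  compare : P.State → Bool

/-- The stack that holds the unary encoding of `z` above the bottom symbol. -/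
def PDA.Marking.stackOf {α : Type} {P : PDA α} (K : P.Marking) (z : ℤ) : List P.Stack :=
  unaryWith K.plus K.minus z ++ [P.bottom]

/-- The vertices that the edges in `I` touch. -/
def vertices (I : Finset (ℕ × ℕ)) : Finset ℕ := I.image Prod.fst ∪ I.image Prod.snd

/-- `I₁, …, I_r` is a partition of `E` (into non-empty sets). -/
def IsEdgePartition (E : Finset (ℕ × ℕ)) (I : List (Finset (ℕ × ℕ))) : Prop :=
  (∀ J ∈ I, J.Nonempty) ∧ I.Pairwise Disjoint ∧ ∀ e, e ∈ E ↔ ∃ J ∈ I, e ∈ J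

/-- On all well-formed inputs `s₁ … sₙ • σ^k`, the automaton first accumulates the energy on its
stack, block after block of the partition `I` of the edges: when the `m`-th step of the iteration
begins, the stack holds the sum of the contributions of the previous blocks, and the state determines
(through `stored m`) the spins that the `m`-th block touches. After the last block the stack holds the
Hamiltonian and none of `σ^k` has been consumed; then the automaton compares the two and
accepts iff they are equal. Computation paths that get stuck before the comparison (wrong
nondeterministic guesses) are not restricted. -/
def PDA.Marking.Operates {P : PDA Letter} (K : P.Marking) (M : Model) (n : ℕ)
    (I : List (Finset (ℕ × ℕ))) : Prop :=
  ∃ stored : ℕ → P.State → ℕ → Bool,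
    ∀ s : List Bool, s.length = n → ∀ (neg : Bool) (k : ℕ),
      let e := List.replicate k (signLetter neg)
      let c₀ := P.init (inputWord s e)
      let D : P.Config → Prop := fun c => K.compare c.state = true
      (∃ pre c, ReachesFirst P.Step D c₀ pre c) ∧
      (∀ r c, IsRun P.Step c₀ (r ++ [c]) → P.Final c → ∃ x ∈ r ++ [c], D x) ∧
      ∀ pre c, ReachesFirst P.Step D c₀ pre c →
        (let marks := pre.filter (fun x => K.load x.state)
         marks.length = I.length ∧
         ∀ m x J, marks[m]? = some x → I[m]? = some J →
           x.stack = K.stackOf (((I.take m).map (fun J' => energyOn J' s)).sum) ∧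
           ∀ i ∈ vertices J, stored m x.state i = spinAt s i) ∧
        c.stack = K.stackOf (M.hamiltonian s) ∧
        (c.input = e ∨ c.input = Letter.bullet :: e) ∧
        (P.AcceptsFrom c ↔ unary (M.hamiltonian s) = e)

/-- A pushdown automaton that decides the language of `M` and is constructive: for every system size
the edges have a unique partition over which the automaton accumulates the energy. -/
def PDA.IsConstructive (P : PDA Letter) (M : Model) : Prop :=
  P.language = M.language ∧
  ∃ K : P.Marking, ∀ n ∈ M.sizes,
    ∃! I : List (Finset (ℕ × ℕ)), IsEdgePartition (M.edges n) I ∧ K.Operates M n I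

/-- The language of `M` is constructive context free. -/
def Model.IsConstructiveContextFree (M : Model) : Prop :=
  ∃ P : PDA Letter, P.IsConstructive M

/-! Linear bounded automata -/

/-- A head movement. -/
inductive Move where
  | left
  | stay
  | right

/-- The new position of a head. -/
def Move.apply : Move → ℕ → ℕ
  | .left, h => h - 1
  | .stay, h => h
  | .right, h => h + 1

/-- A (nondeterministic) linear bounded automaton with finitely many tapes; tape `0` is the input
tape. On every tape only the cells between the two endmarkers can be used, as many as the input has
letters, and the endmarkers are neither overwritten nor passed. -/
structure LBA (α : Type) where
  State : Type
  Sym : Type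
  finite_State : Finite State
  finite_Sym : Finite Sym
  work : ℕ
  letter : α → Sym
  letter_injective : Function.Injective letter
  blank : Sym
  leftEnd : Sym
  rightEnd : Sym
  letter_ne : ∀ a, letter a ≠ blank ∧ letter a ≠ leftEnd ∧ letter a ≠ rightEnd
  blank_ne : blank ≠ leftEnd ∧ blank ≠ rightEnd
  ends_ne : leftEnd ≠ rightEnd
  δ : Set ((State × (Fin (work + 1) → Sym)) ×
    (State × (Fin (work + 1) → Sym) × (Fin (work + 1) → Move)))
  left_end : ∀ q a q' b d, ((q, a), (q', b, d)) ∈ δ → ∀ t, a t = leftEnd →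
    b t = leftEnd ∧ d t ≠ Move.left
  right_end : ∀ q a q' b d, ((q, a), (q', b, d)) ∈ δ → ∀ t, a t = rightEnd →
    b t = rightEnd ∧ d t ≠ Move.right
  start : State
  accept : Set State

/-- A configuration: state, head positions, tape contents. -/
structure LBA.Config {α : Type} (A : LBA α) where
  state : A.State
  head : Fin (A.work + 1) → ℕ
  tape : Fin (A.work + 1) → ℕ → A.Sym

/-- One computation step. -/
def LBA.Step {α : Type} (A : LBA α) (c c' : A.Config) : Prop :=
  ∃ (b : Fin (A.work + 1) → A.Sym) (d : Fin (A.work + 1) → Move),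
    ((c.state, fun t => c.tape t (c.head t)), (c'.state, b, d)) ∈ A.δ ∧
    c'.head = (fun t => (d t).apply (c.head t)) ∧
    c'.tape = fun t => Function.update (c.tape t) (c.head t) (b t)

/-- The start configuration on input `w`: the endmarkers are in the cells `0` and `|w| + 1`, the input
is in the cells `1, …, |w|` of tape `0`, the other tapes are blank there, and all heads are on cell
`1`. Cells behind the right endmarker cannot be reached. -/
def LBA.init {α : Type} (A : LBA α) (w : List α) : A.Config where
  state := A.start
  head := fun _ => 1
  tape := fun t p =>
    if p = 0 then A.leftEnd
    else if w.length < p then A.rightEnd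
    else if t = 0 then ((w[p - 1]?).map A.letter).getD A.blank
    else A.blank

/-- An accepting configuration: the automaton halts in a final state. -/
def LBA.Final {α : Type} (A : LBA α) (c : A.Config) : Prop :=
  c.state ∈ A.accept ∧ ∀ c', ¬ A.Step c c'

/-- Some computation from `c` accepts. -/
def LBA.AcceptsFrom {α : Type} (A : LBA α) (c : A.Config) : Prop :=
  ∃ c', Relation.ReflTransGen A.Step c c' ∧ A.Final c'

/-- The language decided by a linear bounded automaton. -/
def LBA.language {α : Type} (A : LBA α) : Language α := {w | A.AcceptsFrom (A.init w)}

/-- The bookkeeping of a constructive linear bounded automaton: the energy tape, the symbols on it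
for the binary digits and for the two signs, the states `add` in which the addition of the next local
energy contribution begins, and the states `compare` in which the comparison with the input energy
begins. -/
structure LBA.Marking {α : Type} (A : LBA α) where
  energyTape : Fin (A.work + 1)
  energyTape_ne : energyTape ≠ 0
  digit : Bool → A.Sym
  digit_injective : Function.Injective digit
  digit_ne_blank : ∀ b, digit b ≠ A.blank
  sign : Bool → A.Sym
  sign_injective : Function.Injective sign
  add : A.State → Bool
  compare : A.State → Bool

/-- The energy tape (with `len` usable cells) holds the integer `z` in binary: a sign, then the binary
digits of the absolute value from the least significant one on, then blanks. -/
def LBA.Marking.Holds {α : Type} {A : LBA α} (K : A.Marking) (len : ℕ) (c : A.Config) (z : ℤ) :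
    Prop :=
  ∃ (neg : Bool) (bits : List Bool) (j : ℕ),
    (List.range len).map (fun p => c.tape K.energyTape (p + 1)) =
      K.sign neg :: (bits.map K.digit ++ List.replicate j A.blank) ∧
    z = (if neg then -1 else 1) * (Nat.ofDigits 2 (bits.map Bool.toNat) : ℤ)

/-- On all well-formed inputs `s₁ … sₙ • σ^k`, the automaton first accumulates the energy in binary on
its energy tape, by adding the contributions `h(s_i, s_j)` of the edges in the order given by the list
`es`: when the `m`-th addition begins, the energy tape holds the sum of the previous contributions.
At the end it holds the Hamiltonian, whatever `σ^k` is; then the automaton compares it to the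
input energy and accepts iff they coincide. Computation paths that never come to the comparison
do not accept and are otherwise not restricted. -/
def LBA.Marking.Operates {A : LBA Letter} (K : A.Marking) (M : Model) (n : ℕ)
    (es : List (ℕ × ℕ)) : Prop :=
  ∀ s : List Bool, s.length = n → ∀ (neg : Bool) (k : ℕ),
    let e := List.replicate k (signLetter neg)
    let w := inputWord s e
    let c₀ := A.init w
    let D : A.Config → Prop := fun c => K.compare c.state = true
    (∃ pre c, ReachesFirst A.Step D c₀ pre c) ∧
    (∀ r c, IsRun A.Step c₀ (r ++ [c]) → A.Final c → ∃ x ∈ r ++ [c], D x) ∧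
    ∀ pre c, ReachesFirst A.Step D c₀ pre c →
      (let marks := pre.filter (fun x => K.add x.state)
       marks.length = es.length ∧
       ∀ m x, marks[m]? = some x →
         K.Holds w.length x
           (((es.take m).map (fun d => coupling (spinAt s d.1) (spinAt s d.2))).sum)) ∧
      K.Holds w.length c (M.hamiltonian s) ∧
      (A.AcceptsFrom c ↔ unary (M.hamiltonian s) = e)

/-- A linear bounded automaton that decides the language of `M` and is constructive: for every system
size it adds up the contributions of all edges, in an order that depends on the size only. -/
def LBA.IsConstructive (A : LBA Letter) (M : Model) : Prop :=
  A.language = M.language ∧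
  ∃ K : A.Marking, ∀ n ∈ M.sizes,
    ∃ es : List (ℕ × ℕ), es.Nodup ∧ (∀ d, d ∈ es ↔ d ∈ M.edges n) ∧ K.Operates M n es

/-- The language of `M` is constructive context sensitive. -/
def Model.IsConstructiveContextSensitive (M : Model) : Prop :=
  ∃ A : LBA Letter, A.IsConstructive M

end Ising

namespace Ising

/-! Linearity -/

/-! Edge language. With the vertices of the `m × m` lattice numbered row by row, the word of an edge
is the row-by-row reading of the 0-1 matrix that marks its two ends. This matrix is the outer
product of a column vector and a row vector, one with a single 1 and the other with two adjacent
ones. A grammar generates two such vectors of equal length side by side and then lets every column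
symbol travel to the right through all row symbols, dropping in each row a cell with the product of
the two bits. Its rules have the forms `A B → C D` and `A → d`, which context sensitive rules
simulate (`isContextSensitive_of_kuroda`). No other words arise, because the set of words that a
string stands for (`Denotes`) never grows along a derivation (`Denotes.of_step`).

Constructive context sensitivity. A deterministic automaton with four tapes does the work. It
recognizes squares through `(m + 1) ^ 2 = m ^ 2 + m + (m + 1)`, with a head that zigzags over `m`
marks (`run_count`, and `isSquare_of_zag` for the converse). On a reversed copy of the spins a
second head stays on the vertex below the current one, and the marks count the columns, so at each
vertex the edges down and to the right are at hand. The energy is kept as a sign and binary digits;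
its absolute value is at most the number of additions, which is far below `2 ^ (|w| - 1)`, so the
digits fit. The comparison removes the letters of the input energy one by one and tests for zero.
Determinism reduces statements about all computations to one explicit path (`ReachesFirst.unique`,
`Path.mem_of_isRun`).

Context freeness. The gaps between squares grow. For pumping constant `p`, take a constant
configuration on the lattice with side `p + 2`: pumping adds at most `p` spins, too few to reach the
next square, so it adds none. All spins are equal, hence configuration and energy stay the same,
although the word has become longer. Since languages of pushdown automata are context free
(`PDA.grammar_language`), the constructive notion fails too.

Each vertex begins at most one horizontal and one vertical edge, which gives linearity; vertical
edges in the middle of large lattices refute limitedness. -/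

theorem sqrt_sq (m : ℕ) : Nat.sqrt (m ^ 2) = m := Nat.sqrt_eq' m

theorem model2d_isLinear : model2d.IsLinear := by
  refine ⟨2, ?_⟩
  rintro _ ⟨m, hm, rfl⟩
  have h1 : (horizontal m).card ≤ m ^ 2 :=
    Finset.card_image_le.trans ((Finset.card_filter_le _ _).trans (by simp))
  have h2 : (vertical m).card ≤ m ^ 2 := Finset.card_image_le.trans (by simp)
  have h3 : (model2d.edges (m ^ 2)).card ≤ (horizontal m).card + (vertical m).card := by
    simp only [model2d, sqrt_sq]
    exact Finset.card_union_le _ _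
  omega

theorem not_model2d_isLimited : ¬ model2d.IsLimited := by
  rintro ⟨b, hb⟩
  -- A vertical edge of length `b + 2` from vertex `b + 1`: it is too long, starts too late, and
  -- leaves `(b + 1) ^ 2 > b` vertices behind its end.
  have h := hb ((b + 2) ^ 2) ⟨b + 2, by omega, rfl⟩ (b + 1, b + 1 + (b + 2)) (by
    simp only [model2d, sqrt_sq, vertical, Finset.mem_union, Finset.mem_image, Finset.mem_Icc]
    refine Or.inr ⟨b + 1, ⟨by omega, ?_⟩, rfl⟩
    apply Nat.le_sub_of_add_le
    nlinarith)
  have h1 : b + 1 + (b + 2) + (b + 1) ≤ (b + 2) ^ 2 := by nlinarith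
  dsimp only at h
  omega

end Ising

/-! The pumping lemma for context-free languages -/

namespace ContextFreeGrammar

variable {T : Type*} {g : ContextFreeGrammar T}

/-- `Yields g n α w`: the string `α` derives the word `w` by parse trees with `n` inner nodes. -/
inductive Yields (g : ContextFreeGrammar T) : ℕ → List (Symbol T g.NT) → List T → Prop
  | nil : Yields g 0 [] []
  | terminal {n α w} (t : T) : Yields g n α w → Yields g n (Symbol.terminal t :: α) (t :: w)
  | rule {m n v α w} (r : ContextFreeRule T g.NT) (hr : r ∈ g.rules) :
      Yields g m r.output v → Yields g n α w →
      Yields g (m + n + 1) (Symbol.nonterminal r.input :: α) (v ++ w)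

theorem Yields.append {m n : ℕ} {α β : List (Symbol T g.NT)} {v w : List T}
    (h₁ : g.Yields m α v) (h₂ : g.Yields n β w) : g.Yields (m + n) (α ++ β) (v ++ w) := by
  induction h₁ with
  | nil => simpa using h₂
  | terminal t _ ih => exact .terminal t ih
  | @rule a b _ _ _ r hr h _ _ ih =>
    have := Yields.rule r hr h ih
    rw [show a + (b + n) + 1 = a + b + 1 + n by omega] at this
    simpa using this

theorem Yields.split {n : ℕ} {α : List (Symbol T g.NT)} :
    ∀ {β w}, g.Yields n (α ++ β) w →
      ∃ a b v u, g.Yields a α v ∧ g.Yields b β u ∧ n = a + b ∧ w = v ++ u := by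
  induction α generalizing n with
  | nil => exact fun h => ⟨0, n, [], _, .nil, h, by simp, rfl⟩
  | cons s α ih =>
    intro β w h
    cases h with
    | terminal t h =>
      obtain ⟨a, b, v, u, h1, h2, rfl, rfl⟩ := ih h
      exact ⟨a, b, t :: v, u, .terminal t h1, h2, rfl, rfl⟩
    | rule r hr h h' =>
      obtain ⟨a, b, v, u, h1, h2, rfl, rfl⟩ := ih h'
      exact ⟨_, b, _, u, .rule r hr h h1, h2, by omega, by simp⟩

theorem Yields.of_terminals (w : List T) : g.Yields 0 (w.map Symbol.terminal) w := by
  induction w with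
  | nil => exact .nil
  | cons t w ih => exact .terminal t ih

theorem Yields.derives {n : ℕ} {α : List (Symbol T g.NT)} {w : List T} (h : g.Yields n α w) :
    g.Derives α (w.map Symbol.terminal) := by
  induction h with
  | nil => rfl
  | terminal t _ ih => exact ih.append_left [Symbol.terminal t]
  | @rule _ _ v α w r hr _ _ ih1 ih2 =>
    have h1 : g.Produces (Symbol.nonterminal r.input :: α) (r.output ++ α) := ⟨r, hr, .head α⟩
    rw [List.map_append]
    exact h1.single.trans ((ih1.append_right α).trans (ih2.append_left _))

/-- The derivation is read from its end: undoing a step cuts the forest around the output of the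
rule and hangs the middle piece below a new node. -/
theorem exists_yields_of_derives {α : List (Symbol T g.NT)} {w : List T}
    (h : g.Derives α (w.map Symbol.terminal)) : ∃ n, g.Yields n α w := by
  induction h using Relation.ReflTransGen.head_induction_on with
  | refl => exact ⟨0, .of_terminals w⟩
  | head hp _ ih =>
    obtain ⟨r, hr, hp⟩ := hp
    obtain ⟨p, q, rfl, rfl⟩ := hp.exists_parts
    obtain ⟨n, hn⟩ := ih
    rw [List.append_assoc] at hn
    obtain ⟨a, _, u, _, h1, h2, rfl, rfl⟩ := hn.split
    obtain ⟨b, c, v, x, h3, h4, rfl, rfl⟩ := h2.split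
    rw [List.append_assoc]
    exact ⟨_, h1.append (.rule r hr h3 h4)⟩

/-! ### Parse trees with a hole, and repetitions on paths -/

/-- Parse trees of `α` with `n` inner nodes above a hole for a parse tree of the nonterminal `C`,
which yield `u` and `z` on the two sides of the hole. -/
def Hole (g : ContextFreeGrammar T) (n : ℕ) (α : List (Symbol T g.NT)) (C : g.NT) (u z : List T) :
    Prop :=
  ∀ k x, g.Yields k [Symbol.nonterminal C] x → g.Yields (k + n) α (u ++ x ++ z)

theorem Hole.refl (C : g.NT) : g.Hole 0 [Symbol.nonterminal C] C [] [] :=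
  fun k x h => by simpa using h

theorem Hole.trans {m n : ℕ} {α : List (Symbol T g.NT)} {C D : g.NT} {u v y z : List T}
    (h₁ : g.Hole m α C u z) (h₂ : g.Hole n [Symbol.nonterminal C] D v y) :
    g.Hole (n + m) α D (u ++ v) (y ++ z) := by
  intro k x h
  simpa [add_assoc] using h₁ _ _ (h₂ k x h)

theorem Hole.append_right {m n : ℕ} {α β : List (Symbol T g.NT)} {C : g.NT} {u z w : List T}
    (h₁ : g.Hole m α C u z) (h₂ : g.Yields n β w) : g.Hole (m + n) (α ++ β) C u (z ++ w) := by
  intro k x h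
  simpa [add_assoc] using (h₁ _ _ h).append h₂

theorem Hole.append_left {m n : ℕ} {α β : List (Symbol T g.NT)} {C : g.NT} {u z w : List T}
    (h₁ : g.Yields m α w) (h₂ : g.Hole n β C u z) : g.Hole (m + n) (α ++ β) C (w ++ u) z := by
  intro k x h
  have := h₁.append (h₂ _ _ h)
  rw [show m + (k + n) = k + (m + n) by omega] at this
  simpa using this

theorem Hole.rule {n : ℕ} {r : ContextFreeRule T g.NT} (hr : r ∈ g.rules) {C : g.NT}
    {u z : List T} (h : g.Hole n r.output C u z) :
    g.Hole (n + 1) [Symbol.nonterminal r.input] C u z := by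
  intro k x hx
  simpa [add_assoc] using Yields.rule r hr (h k x hx) .nil

theorem Yields.single_rule {n : ℕ} {r : ContextFreeRule T g.NT} (hr : r ∈ g.rules) {w : List T}
    (h : g.Yields n r.output w) : g.Yields (n + 1) [Symbol.nonterminal r.input] w := by
  simpa using Yields.rule r hr h .nil

/-- A forest with a long yield has a subtree with a yield that is long, but not too long. -/
theorem Yields.exists_big_subtree {B M : ℕ} (hM : 1 ≤ M)
    (hB : ∀ r ∈ g.rules, r.output.length ≤ B) {n : ℕ} {α : List (Symbol T g.NT)} {w : List T}
    (h : g.Yields n α w) :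
    w.length ≤ M * α.length ∨ ∃ c k C u x z, n = k + c ∧ w = u ++ x ++ z ∧ g.Hole c α C u z ∧
      g.Yields k [Symbol.nonterminal C] x ∧ M < x.length ∧ x.length ≤ M * B := by
  induction h with
  | nil => simp
  | @terminal n α w t h ih =>
    obtain ih | ⟨c, k, C, u, x, z, rfl, rfl, h1, h2, h3⟩ := ih
    · left
      simp only [List.length_cons]
      nlinarith
    · refine .inr ⟨c, k, C, t :: u, x, z, rfl, rfl, ?_, h2, h3⟩
      simpa using Hole.append_left (Yields.terminal t .nil) h1
  | @rule m n v α w r hr hv hw ih1 ih2 =>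
    by_cases hvM : v.length ≤ M
    · obtain ih2 | ⟨c, k, C, u, x, z, rfl, rfl, h1, h2, h3⟩ := ih2
      · left
        simp only [List.length_append, List.length_cons]
        nlinarith
      · refine .inr ⟨(m + 1) + c, k, C, v ++ u, x, z, by omega, by simp, ?_, h2, h3⟩
        exact Hole.append_left (hv.single_rule hr) h1
    · right
      obtain ih1 | ⟨c, k, C, u, x, z, rfl, rfl, h1, h2, h3⟩ := ih1
      -- The tree at this node is the wanted one: its yield exceeds `M`, and the bound for the
      -- forest of its at most `B` children gives `M * B`.
      · refine ⟨0 + n, m + 1, r.input, [], v, w, by omega, by simp, ?_, hv.single_rule hr,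
          by omega, ih1.trans (Nat.mul_le_mul_left _ (hB r hr))⟩
        exact (Hole.refl r.input).append_right hw
      · refine ⟨(c + 1) + n, k, C, u, x, z ++ w, by omega, by simp, ?_, h2, h3⟩
        exact (h1.rule hr).append_right hw

/-- In a forest with a long yield, some nonterminal repeats on a path, or occurs in a given finite
set `F` of nonterminals. -/
theorem Yields.exists_repetition {B : ℕ} (hB1 : 1 ≤ B) {N : Finset g.NT}
    (hB : ∀ r ∈ g.rules, r.output.length ≤ B) (hN : ∀ r ∈ g.rules, r.input ∈ N)
    {n : ℕ} {α : List (Symbol T g.NT)} {w : List T} (h : g.Yields n α w) :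
    ∀ (j : ℕ) (F : Finset g.NT), (∀ F' ⊆ N, Disjoint F' F → F'.card ≤ j) →
    w.length ≤ B ^ j * α.length ∨
    (∃ C ∈ F, ∃ c k u x z, n = k + c ∧ w = u ++ x ++ z ∧ g.Hole c α C u z ∧
      g.Yields k [Symbol.nonterminal C] x) ∨
    ∃ C c d k u v x y z, n = k + d + c ∧ w = u ++ v ++ x ++ y ++ z ∧ g.Hole c α C u z ∧
      0 < d ∧ g.Hole d [Symbol.nonterminal C] C v y ∧ g.Yields k [Symbol.nonterminal C] x := by
  classical
  induction h with
  | nil => simp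
  | @terminal n α w t h ih =>
    intro j F hF
    have h0 := Yields.terminal (g := g) t .nil
    obtain ih | ⟨C, hC, c, k, u, x, z, rfl, rfl, h1, h2⟩ |
      ⟨C, c, d, k, u, v, x, y, z, rfl, rfl, h1, hd, h2, h3⟩ := ih j F hF
    · left
      have : 1 ≤ B ^ j := Nat.one_le_pow _ _ hB1
      simp only [List.length_cons]
      nlinarith
    · exact .inr <| .inl ⟨C, hC, c, k, t :: u, x, z, rfl, rfl,
        by simpa using Hole.append_left h0 h1, h2⟩
    · exact .inr <| .inr ⟨C, c, d, k, t :: u, v, x, y, z, rfl, by simp,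
        by simpa using Hole.append_left h0 h1, hd, h2, h3⟩
  | @rule m n v α w r hr hv hw ih1 ih2 =>
    intro j F hF
    by_cases hrF : r.input ∈ F
    · exact .inr <| .inl ⟨r.input, hrF, 0 + n, m + 1, [], v, w, by omega, by simp,
        (Hole.refl r.input).append_right hw, hv.single_rule hr⟩
    -- `j` bounds the number of nonterminals of `N` outside `F`. Going down into the tree puts its
    -- root into `F` and lowers `j` by one, so a branch without repetition has depth at most `j`,
    -- whence the bound `B ^ j`.
    obtain ⟨i, rfl⟩ : ∃ i, j = i + 1 := by
      have := hF {r.input} (by simpa using hN r hr) (by simpa using hrF)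
      exact ⟨j - 1, by simp at this; omega⟩
    have hF' : ∀ F' ⊆ N, Disjoint F' (insert r.input F) → F'.card ≤ i := by
      intro F' h1 h2
      obtain ⟨h3, h2⟩ := Finset.disjoint_insert_right.1 h2
      have h4 := hF (insert r.input F') (Finset.insert_subset (hN r hr) h1)
        (Finset.disjoint_insert_left.2 ⟨hrF, h2⟩)
      rw [Finset.card_insert_of_notMem h3] at h4
      omega
    obtain ih1 | ⟨C, hC, c, k, u, x, z, rfl, rfl, h1, h2⟩ |
      ⟨C, c, d, k, u, v, x, y, z, rfl, rfl, h1, hd, h2, h3⟩ := ih1 i _ hF'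
    · obtain ih2 | ⟨C, hC, c, k, u, x, z, rfl, rfl, h1, h2⟩ |
        ⟨C, c, d, k, u, v', x, y, z, rfl, rfl, h1, hd, h2, h3⟩ := ih2 _ F hF
      · left
        have : v.length ≤ B ^ (i + 1) := by
          rw [pow_succ]
          exact ih1.trans (Nat.mul_le_mul_left _ (hB r hr))
        simp only [List.length_append, List.length_cons]
        nlinarith
      · exact .inr <| .inl ⟨C, hC, (m + 1) + c, k, v ++ u, x, z, by omega, by simp,
          Hole.append_left (hv.single_rule hr) h1, h2⟩
      · exact .inr <| .inr ⟨C, (m + 1) + c, d, k, v ++ u, v', x, y, z, by omega, by simp,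
          Hole.append_left (hv.single_rule hr) h1, hd, h2, h3⟩
    · have h4 := h1.rule hr
      rcases Finset.mem_insert.1 hC with rfl | hC
      -- The root that was put into `F` has been found again below itself. The loop contains the
      -- root, so it has `c + 1 > 0` inner nodes.
      · exact .inr <| .inr ⟨r.input, 0 + n, c + 1, k, [], u, x, z, w, by omega, by simp,
          (Hole.refl _).append_right hw, by omega, h4, h2⟩
      · exact .inr <| .inl ⟨C, hC, (c + 1) + n, k, u, x, z ++ w, by omega, by simp,
          h4.append_right hw, h2⟩
    · exact .inr <| .inr ⟨C, (c + 1) + n, d, k, u, v, x, y, z ++ w, by omega, by simp,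
        (h1.rule hr).append_right hw, hd, h2, h3⟩

end ContextFreeGrammar

/-- The pumping lemma for context-free languages (one additional copy of the pumped parts). -/
theorem Language.IsContextFree.pumping {T : Type*} {L : Language T} (hL : L.IsContextFree) :
    ∃ p : ℕ, ∀ w ∈ L, p < w.length → ∃ u v x y z : List T,
      w = u ++ v ++ x ++ y ++ z ∧ 0 < (v ++ y).length ∧ (v ++ y).length ≤ p ∧
      u ++ (v ++ v) ++ x ++ (y ++ y) ++ z ∈ L := by
  classical
  obtain ⟨g, rfl⟩ := hL
  obtain ⟨B, hB1, hB⟩ : ∃ B, 1 ≤ B ∧ ∀ r ∈ g.rules, r.output.length ≤ B :=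
    ⟨g.rules.sup (fun r => r.output.length) + 1, by omega, fun r hr =>
      (Finset.le_sup (f := fun r : ContextFreeRule T g.NT => r.output.length) hr).trans (by omega)⟩
  set N := g.rules.image ContextFreeRule.input with hNdef
  have hN : ∀ r ∈ g.rules, r.input ∈ N := fun r hr => Finset.mem_image_of_mem _ hr
  -- A tree whose yield is longer than this has a repetition on some path.
  set M := B ^ N.card with hMdef
  have hM : 1 ≤ M := Nat.one_le_pow _ _ hB1
  refine ⟨M * B, fun w hw hlen => ?_⟩
  have hex := g.exists_yields_of_derives hw
  -- The parse tree is chosen with the fewest inner nodes; this will exclude empty pumped parts.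
  have hmin := fun k => Nat.find_min' hex (m := k)
  have hyield := Nat.find_spec hex
  set n := Nat.find hex
  obtain h | ⟨c, k, C, u, x, z, hn, rfl, h1, h2, h3, h4⟩ := hyield.exists_big_subtree hM hB
  · simp only [List.length_singleton, mul_one] at h
    nlinarith
  obtain h | ⟨C, hC, -⟩ | ⟨D, c', d, k', u', v, x', y, z', rfl, rfl, h5, hd, h6, h7⟩ :=
    h2.exists_repetition hB1 hB hN N.card ∅ (fun F' h _ => Finset.card_le_card h)
  · simp only [List.length_singleton, mul_one] at h
    omega
  · simp at hC
  have h8 := h1.trans h5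
  refine ⟨u ++ u', v, x', y, z' ++ z, by simp, ?_, ?_, ?_⟩
  -- If both pumped parts were empty, cutting out the loop would leave a smaller parse tree of the
  -- same word.
  · by_contra h0
    obtain ⟨rfl, rfl⟩ : v = [] ∧ y = [] := by simpa using h0
    have := hmin _ (by simpa using h8 _ _ h7)
    omega
  · simp only [List.length_append] at h4 ⊢
    omega
  · have h9 := (((h8.trans h6).trans h6) _ _ h7).derives
    simpa using h9

/-! ### Predicates closed under the rules of a grammar -/

namespace ContextFreeGrammar

variable {T : Type*} {g : ContextFreeGrammar T}

/-- The word `w` is a concatenation of words that belong to the symbols in a string, where `μ` says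
which words belong to a nonterminal. -/
def Matches (μ : g.NT → List T → Prop) : List (Symbol T g.NT) → List T → Prop
  | [], w => w = []
  | Symbol.terminal t :: α, w => ∃ u, w = t :: u ∧ Matches μ α u
  | Symbol.nonterminal A :: α, w => ∃ v u, w = v ++ u ∧ μ A v ∧ Matches μ α u

/-- The tool for soundness: the generated languages form the least family of predicates closed under
the rules, so they lie inside every such family. -/
theorem Yields.matches {μ : g.NT → List T → Prop}
    (hμ : ∀ r ∈ g.rules, ∀ w, Matches μ r.output w → μ r.input w)
    {n : ℕ} {α : List (Symbol T g.NT)} {w : List T} (h : g.Yields n α w) : Matches μ α w := by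
  induction h with
  | nil => exact rfl
  | terminal t _ ih => exact ⟨_, rfl, ih⟩
  | rule r hr _ _ ih1 ih2 => exact ⟨_, _, rfl, hμ r hr _ ih1, ih2⟩

/-- The nonterminal `A` derives the word `w`. -/
def Gen (g : ContextFreeGrammar T) (A : g.NT) (w : List T) : Prop :=
  ∃ n, g.Yields n [Symbol.nonterminal A] w

theorem gen_iff {A : g.NT} {w : List T} :
    g.Gen A w ↔ g.Derives [Symbol.nonterminal A] (w.map Symbol.terminal) :=
  ⟨fun ⟨_, h⟩ => h.derives, g.exists_yields_of_derives⟩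

theorem Gen.of_rule {A : g.NT} {α : List (Symbol T g.NT)} (hr : ⟨A, α⟩ ∈ g.rules)
    {n : ℕ} {w : List T} (h : g.Yields n α w) : g.Gen A w :=
  ⟨n + 1, Yields.single_rule hr h⟩

end ContextFreeGrammar

/-! The languages of pushdown automata are context free -/

namespace Ising.PDA

variable {α : Type} (P : PDA α)

/-- The nonterminals of the grammar of a pushdown automaton: `run p γ q` stands for the words on
which the automaton gets from `p` to `q` and removes `γ` from the stack, and `acc p γ` stands for
the words that are accepted from `p` with the stack `γ`. -/
inductive Var
  | run (p : P.State) (γ : List P.Stack) (q : P.State)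
  | acc (p : P.State) (γ : List P.Stack)

/-- The final segments of the bottom stack and of the strings that are pushed. -/
def segments : Set (List P.Stack) :=
  {γ | γ <:+ [P.bottom] ∨ ∃ x ∈ P.δ, γ <:+ x.2.2}

theorem finite_suffixes {β : Type*} (l : List β) : {γ | γ <:+ l}.Finite := by
  simpa using List.finite_toSet l.tails

/-- The nonterminals carry whole stack strings, of which there are infinitely many; only these
finitely many segments occur when pushed strings are taken apart from the top. -/
theorem finite_segments : P.segments.Finite := by
  have : P.segments = {γ | γ <:+ [P.bottom]} ∪ ⋃ x ∈ P.δ, {γ | γ <:+ x.2.2} := by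
    ext; simp [segments]
  rw [this]
  exact (finite_suffixes _).union (P.finite_δ.biUnion fun x _ => finite_suffixes _)

variable {P} in
theorem tail_mem_segments {Z : P.Stack} {γ : List P.Stack} (h : Z :: γ ∈ P.segments) :
    γ ∈ P.segments :=
  h.imp (List.suffix_cons Z γ).trans (fun ⟨x, hx, h⟩ => ⟨x, hx, (List.suffix_cons Z γ).trans h⟩)

variable {P} in
theorem pushed_mem_segments {x : (P.State × Option α × P.Stack) × (P.State × List P.Stack)}
    (h : x ∈ P.δ) : x.2.2 ∈ P.segments := .inr ⟨x, h, List.suffix_rfl⟩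

open Symbol in
/-- The rules of the grammar of a pushdown automaton. -/
inductive GrammarRule : ContextFreeRule α P.Var → Prop
  | run_nil (p) : GrammarRule ⟨.run p [] p, []⟩
  | run_cons (p q r Z γ) : Z :: γ ∈ P.segments →
      GrammarRule ⟨.run p (Z :: γ) q, [nonterminal (.run p [Z] r), nonterminal (.run r γ q)]⟩
  | run_step (p q) (a : Option α) (Z γ p') : ((p, a, Z), (p', γ)) ∈ P.δ →
      GrammarRule ⟨.run p [Z] q, a.toList.map terminal ++ [nonterminal (.run p' γ q)]⟩
  | acc_nil (p γ) : p ∈ P.accept → γ ∈ P.segments → GrammarRule ⟨.acc p γ, []⟩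
  | acc_cons (p r Z γ) : Z :: γ ∈ P.segments →
      GrammarRule ⟨.acc p (Z :: γ), [nonterminal (.run p [Z] r), nonterminal (.acc r γ)]⟩
  | acc_step (p) (a : Option α) (Z γ p' γ') : ((p, a, Z), (p', γ')) ∈ P.δ → Z :: γ ∈ P.segments →
      GrammarRule ⟨.acc p (Z :: γ), a.toList.map terminal ++ [nonterminal (.acc p' γ')]⟩

-- Each kind of rule is the image of a finite product of states, stack symbols, transitions and
-- segments. A segment `Z :: γ` is indexed by `Z` and by `γ`, a tail of a segment.
open Symbol in
theorem finite_grammarRule : {r | P.GrammarRule r}.Finite := by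
  have := P.finite_State
  have := P.finite_Stack
  have hS := P.finite_segments
  have hu : ∀ β : Type, [Finite β] → (Set.univ : Set β).Finite := fun β _ => Set.finite_univ
  refine Set.Finite.subset (((((((hu P.State).image
      fun p => (⟨.run p [] p, []⟩ : ContextFreeRule α P.Var)).union
    (((hu (P.State × P.State × P.State × P.Stack)).prod (hS.image List.tail)).image fun x =>
      ⟨.run x.1.1 (x.1.2.2.2 :: x.2) x.1.2.1, [nonterminal (.run x.1.1 [x.1.2.2.2] x.1.2.2.1),
        nonterminal (.run x.1.2.2.1 x.2 x.1.2.1)]⟩)).union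
    (((hu P.State).prod P.finite_δ).image fun x => ⟨.run x.2.1.1 [x.2.1.2.2] x.1,
      x.2.1.2.1.toList.map terminal ++ [nonterminal (.run x.2.2.1 x.2.2.2 x.1)]⟩)).union
    (((hu P.State).prod hS).image fun x => ⟨.acc x.1 x.2, []⟩)).union
    (((hu (P.State × P.State × P.Stack)).prod (hS.image List.tail)).image fun x =>
      ⟨.acc x.1.1 (x.1.2.2 :: x.2), [nonterminal (.run x.1.1 [x.1.2.2] x.1.2.1),
        nonterminal (.acc x.1.2.1 x.2)]⟩)).union
    ((hS.prod P.finite_δ).image fun x => ⟨.acc x.2.1.1 x.1,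
      x.2.1.2.1.toList.map terminal ++ [nonterminal (.acc x.2.2.1 x.2.2.2)]⟩)) ?_
  rintro _ (⟨p⟩ | ⟨p, q, r, Z, γ, h⟩ | ⟨p, q, a, Z, γ, p', h⟩ | ⟨p, γ, hp, h⟩ | ⟨p, r, Z, γ, h⟩ |
    ⟨p, a, Z, γ, p', γ', hδ, h⟩)
  · exact .inl <| .inl <| .inl <| .inl <| .inl ⟨p, trivial, rfl⟩
  · exact .inl <| .inl <| .inl <| .inl <| .inr
      ⟨((p, q, r, Z), γ), ⟨trivial, ⟨_, h, rfl⟩⟩, rfl⟩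
  · exact .inl <| .inl <| .inl <| .inr ⟨(q, ((p, a, Z), (p', γ))), ⟨trivial, h⟩, rfl⟩
  · exact .inl <| .inl <| .inr ⟨(p, γ), ⟨trivial, h⟩, rfl⟩
  · exact .inl <| .inr ⟨((p, r, Z), γ), ⟨trivial, ⟨_, h, rfl⟩⟩, rfl⟩
  · exact .inr ⟨(Z :: γ, ((p, a, Z), (p', γ'))), ⟨h, hδ⟩, rfl⟩

/-- A context-free grammar for the language of a pushdown automaton. -/
noncomputable def grammar : ContextFreeGrammar α where
  NT := P.Var
  initial := .acc P.start [P.bottom]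
  rules := P.finite_grammarRule.toFinset

variable {P}

theorem mem_grammar_rules {r : ContextFreeRule α P.Var} :
    r ∈ P.grammar.rules ↔ P.GrammarRule r := P.finite_grammarRule.mem_toFinset

/-! ### Derived words are accepted -/

/-- The meaning of the nonterminals. -/
def Meaning : P.Var → List α → Prop
  | .run p γ q, w => ∀ x σ, Relation.ReflTransGen P.Step ⟨p, w ++ x, γ ++ σ⟩ ⟨q, x, σ⟩
  | .acc p γ, w => ∀ σ, P.AcceptsFrom ⟨p, w, γ ++ σ⟩

theorem AcceptsFrom.head {c c' : P.Config} (h : Relation.ReflTransGen P.Step c c')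
    (h' : P.AcceptsFrom c') : P.AcceptsFrom c := by
  obtain ⟨d, h1, h2⟩ := h'
  exact ⟨d, h.trans h1, h2⟩

theorem step_of_mem {p p' : P.State} {a : Option α} {Z : P.Stack} {γ : List P.Stack}
    (h : ((p, a, Z), (p', γ)) ∈ P.δ) (w : List α) (σ : List P.Stack) :
    P.Step ⟨p, a.toList ++ w, Z :: σ⟩ ⟨p', w, γ ++ σ⟩ :=
  ⟨a, Z, σ, γ, h, rfl, rfl, rfl⟩

theorem matches_toList_append {μ : P.Var → List α → Prop} {a : Option α} {A : P.Var} {w : List α}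
    (h : ContextFreeGrammar.Matches (g := P.grammar) μ
      (a.toList.map Symbol.terminal ++ [Symbol.nonterminal A]) w) :
    ∃ u, w = a.toList ++ u ∧ μ A u := by
  cases a with
  | none =>
    obtain ⟨v, u, rfl, h, rfl⟩ := h
    exact ⟨v, by simp, h⟩
  | some a =>
    obtain ⟨_, rfl, v, u, rfl, h, rfl⟩ := h
    exact ⟨v, by simp, h⟩

/-- Since `Meaning` quantifies over the input `x` still to come and the stack `σ` underneath,
computations compose simply by concatenation. -/
theorem meaning_of_rule (r : ContextFreeRule α P.Var) (hr : P.GrammarRule r) (w : List α)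
    (h : ContextFreeGrammar.Matches (g := P.grammar) Meaning r.output w) : Meaning r.input w := by
  cases hr with
  | run_nil p =>
    obtain rfl : w = [] := h
    exact fun x σ => .refl
  | run_cons p q r Z γ _ =>
    obtain ⟨v, _, rfl, h1, u, _, rfl, h2, rfl⟩ := h
    intro x σ
    have := (h1 (u ++ x) (γ ++ σ)).trans (h2 x σ)
    simpa using this
  | run_step p q a Z γ p' hδ =>
    obtain ⟨u, rfl, hu⟩ := matches_toList_append h
    intro x σ
    rw [List.append_assoc]
    exact .head (step_of_mem hδ _ _) (hu x σ)
  | acc_nil p γ hp _ =>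
    obtain rfl : w = [] := h
    exact fun σ => ⟨_, .refl, rfl, hp⟩
  | acc_cons p r Z γ _ =>
    obtain ⟨v, _, rfl, h1, u, _, rfl, h2, rfl⟩ := h
    intro σ
    rw [List.append_nil]
    exact .head (h1 u (γ ++ σ)) (h2 σ)
  | acc_step p a Z γ p' γ' hδ _ =>
    obtain ⟨u, rfl, hu⟩ := matches_toList_append h
    exact fun σ => .head (.single (step_of_mem hδ _ _)) (hu _)

/-! ### Accepted words are derived -/

/-- A word on which the automaton gets from `p` to `q` and removes `γ`, symbol by symbol. -/
def GenRun : P.State → List P.Stack → P.State → List α → Prop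
  | p, [], q, w => p = q ∧ w = []
  | p, Z :: γ, q, w => ∃ r v u, w = v ++ u ∧ P.grammar.Gen (.run p [Z] r) v ∧ GenRun r γ q u

/-- A word that is accepted from `p` with the stack `γ`, which is removed symbol by symbol. -/
def GenAcc : P.State → List P.Stack → List α → Prop
  | p, [], w => p ∈ P.accept ∧ w = []
  | p, Z :: γ, w => (p ∈ P.accept ∧ w = []) ∨
      (∃ a p' γ' u, ((p, a, Z), (p', γ')) ∈ P.δ ∧ w = a.toList ++ u ∧
        P.grammar.Gen (.acc p' γ') u) ∨
      ∃ r v u, w = v ++ u ∧ P.grammar.Gen (.run p [Z] r) v ∧ GenAcc r γ u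

theorem GenRun.gen {γ : List P.Stack} (hγ : γ ∈ P.segments) {p q : P.State} {w : List α}
    (h : GenRun p γ q w) : P.grammar.Gen (.run p γ q) w := by
  induction γ generalizing p w with
  | nil =>
    obtain ⟨rfl, rfl⟩ := h
    exact .of_rule (mem_grammar_rules.2 (.run_nil p)) .nil
  | cons Z γ ih =>
    obtain ⟨r, v, u, rfl, ⟨m, h1⟩, h2⟩ := h
    obtain ⟨n, h2⟩ := ih (tail_mem_segments hγ) h2
    exact .of_rule (mem_grammar_rules.2 (.run_cons p q r Z γ hγ)) (h1.append h2)

theorem GenAcc.gen {γ : List P.Stack} (hγ : γ ∈ P.segments) {p : P.State} {w : List α}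
    (h : GenAcc p γ w) : P.grammar.Gen (.acc p γ) w := by
  induction γ generalizing p w with
  | nil =>
    obtain ⟨hp, rfl⟩ := h
    exact .of_rule (mem_grammar_rules.2 (.acc_nil p _ hp hγ)) .nil
  | cons Z γ ih =>
    obtain ⟨hp, rfl⟩ | ⟨a, p', γ', u, hδ, rfl, n, h⟩ | ⟨r, v, u, rfl, ⟨m, h1⟩, h2⟩ := h
    · exact .of_rule (mem_grammar_rules.2 (.acc_nil p _ hp hγ)) .nil
    · exact .of_rule (mem_grammar_rules.2 (.acc_step p a Z γ p' γ' hδ hγ))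
        ((ContextFreeGrammar.Yields.of_terminals _).append h)
    · obtain ⟨n, h2⟩ := ih (tail_mem_segments hγ) h2
      exact .of_rule (mem_grammar_rules.2 (.acc_cons p r Z γ hγ)) (h1.append h2)

/-- Acceptance is by final state, so part of the stack may survive: either `σ` is never exposed, or
a prefix of the word removes exactly `γ` and the rest is accepted with `σ`. -/
theorem GenAcc.split {γ σ : List P.Stack} {p : P.State} {w : List α} (h : GenAcc p (γ ++ σ) w) :
    GenAcc p γ w ∨ ∃ r v u, w = v ++ u ∧ GenRun p γ r v ∧ GenAcc r σ u := by
  induction γ generalizing p w with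
  | nil => exact .inr ⟨p, [], w, rfl, ⟨rfl, rfl⟩, h⟩
  | cons Z γ ih =>
    obtain h | h | ⟨r, v, u, rfl, h1, h2⟩ := h
    · exact .inl (.inl h)
    · exact .inl (.inr (.inl h))
    · obtain h2 | ⟨q, v', u, rfl, h2, h3⟩ := ih h2
      · exact .inl (.inr (.inr ⟨r, v, u, rfl, h1, h2⟩))
      · exact .inr ⟨q, v ++ v', u, by simp, ⟨r, v, v', rfl, h1, h2⟩, h3⟩

/-- Induction from the end of the computation: a step is put in front by regrouping the stack into
the pushed string and what lay below the popped symbol. -/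
theorem genAcc_of_acceptsFrom {c : P.Config} (h : P.AcceptsFrom c) :
    GenAcc c.state c.stack c.input := by
  obtain ⟨c', h, hf, hs⟩ := h
  induction h using Relation.ReflTransGen.head_induction_on with
  | refl =>
    cases hc : c'.stack with
    | nil => exact ⟨hs, hf⟩
    | cons Z γ => exact .inl ⟨hs, hf⟩
  | @head c d hstep _ ih =>
    obtain ⟨a, Z, σ, γ, hδ, h1, h2, h3⟩ := hstep
    rw [h3] at ih
    rw [h1, h2]
    have hγ : γ ∈ P.segments := pushed_mem_segments hδ
    -- Either the pushed string outlives the computation, and the stack below is irrelevant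
    -- (`acc_step`), or it gets removed, and then the step together with this removal erases `Z`
    -- (`run_step`).
    obtain ih | ⟨r, v, u, hvu, h4, h5⟩ := ih.split
    · exact .inr (.inl ⟨a, _, γ, _, hδ, rfl, ih.gen hγ⟩)
    · obtain ⟨n, hn⟩ := h4.gen hγ
      rw [hvu, ← List.append_assoc]
      exact .inr (.inr ⟨r, _, u, rfl, .of_rule (mem_grammar_rules.2 (.run_step _ r a Z γ _ hδ))
        ((ContextFreeGrammar.Yields.of_terminals _).append hn), h5⟩)

variable (P) in
theorem grammar_language : P.grammar.language = P.language := by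
  ext w
  rw [ContextFreeGrammar.mem_language_iff, ← ContextFreeGrammar.gen_iff]
  constructor
  · rintro ⟨n, h⟩
    obtain ⟨v, _, rfl, hv, rfl⟩ := h.matches (μ := Meaning)
      fun r hr => meaning_of_rule r (mem_grammar_rules.1 hr)
    rw [List.append_nil]
    exact hv []
  · intro h
    exact (genAcc_of_acceptsFrom h).gen (.inl List.suffix_rfl)

variable (P) in
theorem language_isContextFree : P.language.IsContextFree := ⟨P.grammar, P.grammar_language⟩

end Ising.PDA

namespace Ising

theorem Model.IsConstructiveContextFree.isContextFree {M : Model}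
    (h : M.IsConstructiveContextFree) : M.language.IsContextFree := by
  obtain ⟨P, hP, -⟩ := h
  exact hP ▸ P.language_isContextFree

/-! The language of the two-dimensional model is not context free -/

/-- The spin at a letter, if there is one. -/
def Letter.spin? : Letter → Option Bool
  | .spin b => some b
  | _ => none

/-- The projection to the spins respects concatenation, so it can be applied to the pumped
factorization without knowing where the factors lie relative to the bullet. -/
theorem filterMap_inputWord (s : List Bool) (z : ℤ) :
    (inputWord s (unary z)).filterMap Letter.spin? = s := by
  have h1 : (unary z).filterMap Letter.spin? = [] := by
    unfold unary unaryWith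
    split_ifs <;> simp [Letter.spin?]
  have h2 : (Letter.spin? ∘ Letter.spin) = some := rfl
  rw [inputWord, List.filterMap_append, List.filterMap_map, h2, List.filterMap_some,
    List.filterMap_cons_none rfl, h1, List.append_nil]

theorem not_model2d_language_isContextFree : ¬ model2d.language.IsContextFree := by
  intro h
  obtain ⟨p, hp⟩ := h.pumping
  -- Then the next square after `m ^ 2` is `2 * m + 1 > p` away.
  set m := p + 2 with hm
  set s := List.replicate (m ^ 2) false with hs
  have hw : inputWord s (unary (model2d.hamiltonian s)) ∈ model2d.language :=
    ⟨s, ⟨m, by omega, by simp [hs]⟩, rfl⟩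
  obtain ⟨u, v, x, y, z, huz, h0, h1, s', ⟨k, -, hk⟩, h2⟩ := hp _ hw (by
    simp [inputWord, hs]
    nlinarith)
  have h3 := congrArg (List.filterMap Letter.spin?) huz
  have h4 := congrArg (List.filterMap Letter.spin?) h2
  rw [filterMap_inputWord] at h3 h4
  have hv := List.length_filterMap_le Letter.spin? v
  have hy := List.length_filterMap_le Letter.spin? y
  -- Pumping only repeats letters that already occur.
  have h5 : ∀ b ∈ s', b = false := by
    intro b hb
    refine List.eq_of_mem_replicate (n := m ^ 2) ?_
    rw [← hs, h3]
    rw [← h4] at hb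
    simp only [List.filterMap_append, List.mem_append] at hb ⊢
    tauto
  have h6 : s.length = m ^ 2 := by simp [hs]
  have h7 : s'.length = s.length + (v.filterMap Letter.spin?).length +
      (y.filterMap Letter.spin?).length := by
    rw [← h4, h3]
    simp only [List.filterMap_append, List.length_append]
    omega
  have h8 : k ^ 2 ≤ m ^ 2 + p ∧ m ^ 2 ≤ k ^ 2 := by
    simp only [List.length_append] at h1
    omega
  have h9 : k = m := by
    apply le_antisymm
    · by_contra hc
      have : (m + 1) ^ 2 ≤ k ^ 2 := Nat.pow_le_pow_left (by omega) 2
      nlinarith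
    · exact (Nat.pow_le_pow_iff_left two_ne_zero).1 h8.2
  have h10 : s' = s := by
    rw [hs, ← h9, ← hk]
    exact List.eq_replicate_iff.2 ⟨rfl, h5⟩
  -- The configuration determines the word of the language, so the pumped word equals the original
  -- one, against their lengths.
  rw [h10, huz] at h2
  have := congrArg List.length h2
  simp only [List.length_append] at this h0
  omega

end Ising

/-! Kuroda normal form -/

namespace Ising

section Kuroda

variable {T N : Type}

/-- A rewriting step by a rule `A B → C D` in `R` or by a rule `A → d` in `U`. -/
inductive KurodaStep (R : Set (N × N × N × N)) (U : Set (N × List (Symbol T N))) :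
    List (Symbol T N) → List (Symbol T N) → Prop
  | binary {A B C D} (x y : List (Symbol T N)) : (A, B, C, D) ∈ R →
      KurodaStep R U (x ++ .nonterminal A :: .nonterminal B :: y)
        (x ++ .nonterminal C :: .nonterminal D :: y)
  | unary {A d} (x y : List (Symbol T N)) : (A, d) ∈ U →
      KurodaStep R U (x ++ .nonterminal A :: y) (x ++ d ++ y)

theorem KurodaStep.append {R : Set (N × N × N × N)} {U : Set (N × List (Symbol T N))}
    {u v : List (Symbol T N)}
    (h : Relation.ReflTransGen (KurodaStep R U) u v) (x y : List (Symbol T N)) :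
    Relation.ReflTransGen (KurodaStep R U) (x ++ u ++ y) (x ++ v ++ y) := by
  refine h.lift (fun u => x ++ u ++ y) fun u v h => ?_
  simp only [Function.onFun]
  cases h with
  | binary x' y' h => simpa using KurodaStep.binary (x ++ x') (y' ++ y) h
  | unary x' y' h => simpa using KurodaStep.unary (x ++ x') (y' ++ y) h

/-- The nonterminals of the context sensitive grammar: the second and third kind mark the two
places at which a rule `A B → C D` is being applied. -/
abbrev KurodaNT (N : Type) : Type := N ⊕ ((N × N × N × N) × Bool)

/-- The inclusion of the symbols. -/
def liftSymbol : Symbol T N → Symbol T (KurodaNT N)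
  | .terminal t => .terminal t
  | .nonterminal A => .nonterminal (.inl A)

open Symbol in
/-- The four rules that simulate `A B → C D`. -/
def markRules (r : N × N × N × N) : Set (CSRule T (KurodaNT N)) :=
  {⟨[], .inl r.1, [nonterminal (.inl r.2.1)], [nonterminal (.inr (r, false))], by simp⟩,
   ⟨[nonterminal (.inr (r, false))], .inl r.2.1, [], [nonterminal (.inr (r, true))], by simp⟩,
   ⟨[], .inr (r, false), [nonterminal (.inr (r, true))], [nonterminal (.inl r.2.2.1)], by simp⟩,
   ⟨[nonterminal (.inl r.2.2.1)], .inr (r, true), [], [nonterminal (.inl r.2.2.2)], by simp⟩}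

/-- The rules of a context sensitive grammar that simulates the rules `A B → C D` and `A → d`. -/
def kurodaRules (R : Set (N × N × N × N)) (U : Set (N × List (Symbol T N)))
    (hne : ∀ r ∈ U, r.2 ≠ []) : Set (CSRule T (KurodaNT N)) :=
  (⋃ r ∈ R, markRules r) ∪
    Set.range fun r : U => ⟨[], .inl r.1.1, [], r.1.2.map liftSymbol, by simpa using hne _ r.2⟩

/-- One application of a rule of a set of rules. -/
def CSStep {M : Type} (rules : Set (CSRule T M)) (u v : List (Symbol T M)) : Prop :=
  ∃ r ∈ rules, ∃ x y : List (Symbol T M),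
    u = x ++ r.left ++ [Symbol.nonterminal r.target] ++ r.right ++ y ∧
    v = x ++ r.left ++ r.output ++ r.right ++ y

/-- The context sensitive grammar of a system of rules `A B → C D` and `A → d`. -/
def kurodaGrammar [Finite N] (S : N) (R : Set (N × N × N × N)) (U : Set (N × List (Symbol T N)))
    (hU : U.Finite) (hne : ∀ r ∈ U, r.2 ≠ []) : CSGrammar T where
  NT := KurodaNT N
  finite_NT := inferInstance
  start := .inl S
  rules := kurodaRules R U hne
  finite_rules := by
    have := hU.to_subtype
    refine Set.Finite.union ((Set.toFinite R).biUnion fun r _ => ?_) (Set.finite_range _)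
    unfold markRules
    exact Set.toFinite _

open Classical in
/-- Undoes the marking. The first argument is the preceding mark, if it is one of the first kind:
a mark of the second kind stands for `B` after the corresponding mark of the first kind, and for
`D` otherwise. -/
noncomputable def unmark : Option (N × N × N × N) → List (Symbol T (KurodaNT N)) → List (Symbol T N)
  | _, [] => []
  | _, .terminal t :: w => .terminal t :: unmark none w
  | _, .nonterminal (.inl A) :: w => .nonterminal A :: unmark none w
  | _, .nonterminal (.inr (r, false)) :: w => .nonterminal r.1 :: unmark (some r) w
  | p, .nonterminal (.inr (r, true)) :: w =>
      .nonterminal (if p = some r then r.2.1 else r.2.2.2) :: unmark none w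

open Classical in
-- Unmarking works from left to right and remembers only the preceding mark; a prefix therefore
-- contributes a fixed output and a fixed memory, whatever follows.
theorem exists_unmark_append (x : List (Symbol T (KurodaNT N))) :
    ∀ p : Option (N × N × N × N), ∃ q l, ∀ y, unmark p (x ++ y) = l ++ unmark q y := by
  induction x with
  | nil => exact fun p => ⟨p, [], fun y => rfl⟩
  | cons s x ih =>
    intro p
    match s with
    | .terminal t =>
      obtain ⟨q, l, h⟩ := ih none
      exact ⟨q, .terminal t :: l, fun y => by simp [unmark, h]⟩
    | .nonterminal (.inl A) =>
      obtain ⟨q, l, h⟩ := ih none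
      exact ⟨q, .nonterminal A :: l, fun y => by simp [unmark, h]⟩
    | .nonterminal (.inr (r, false)) =>
      obtain ⟨q, l, h⟩ := ih (some r)
      exact ⟨q, .nonterminal r.1 :: l, fun y => by simp [unmark, h]⟩
    | .nonterminal (.inr (r, true)) =>
      obtain ⟨q, l, h⟩ := ih none
      refine ⟨q, .nonterminal (if p = some r then r.2.1 else r.2.2.2) :: l, fun y => ?_⟩
      simp only [List.cons_append, unmark, h]

/-- Unmarked symbols clear the memory. An empty `d` would let an earlier mark reach the symbols
behind it. -/
theorem unmark_lift_append {d : List (Symbol T N)} (hd : d ≠ []) (y : List (Symbol T (KurodaNT N))) :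
    ∀ p, unmark p (d.map liftSymbol ++ y) = d ++ unmark none y := by
  induction d with
  | nil => exact absurd rfl hd
  | cons s d ih =>
    intro p
    by_cases h : d = []
    · subst h
      cases s <;> simp [unmark, liftSymbol]
    · cases s <;> simp [unmark, liftSymbol, ih h]

theorem unmark_terminals (w : List T) : ∀ p : Option (N × N × N × N),
    unmark p (w.map .terminal) = w.map .terminal := by
  induction w with
  | nil => exact fun _ => rfl
  | cons t w ih => exact fun _ => by simp [unmark, ih]

variable {R : Set (N × N × N × N)} {U : Set (N × List (Symbol T N))} {hne : ∀ r ∈ U, r.2 ≠ []}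

/-- Of the four simulating rules only the third changes the unmarked string: replacing the first
mark turns `A` into `C` and, at the same moment, changes the meaning of the second mark from `B` to
`D`. Hence interrupted or interleaved simulations do no harm. -/
theorem unmark_produces {u v : List (Symbol T (KurodaNT N))}
    (h : CSStep (kurodaRules R U hne) u v) :
    Relation.ReflTransGen (KurodaStep R U) (unmark none u) (unmark none v) := by
  obtain ⟨r, hr, x, y, rfl, rfl⟩ := h
  obtain ⟨p, l, hl⟩ := exists_unmark_append x none
  obtain hr | ⟨⟨⟨A, d⟩, hd⟩, rfl⟩ := hr
  · simp only [Set.mem_iUnion] at hr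
    obtain ⟨⟨A, B, C, D⟩, hR, rfl | rfl | rfl | rfl⟩ := hr <;>
      simp only [List.append_assoc, hl, List.cons_append, List.nil_append, unmark, if_true,
        reduceCtorEq, if_false]
    · exact .refl
    · exact .refl
    · exact .single (.binary _ _ hR)
    · exact .refl
  · simp only [List.append_assoc, hl, List.cons_append, List.nil_append,
      unmark_lift_append (hne _ hd), unmark]
    rw [← List.append_assoc]
    exact .single (.unary _ _ hd)

/-- The simulating rules in order: mark `A`, mark `B`, replace the first mark, replace the second
one. -/
theorem produces_of_kurodaStep {u v : List (Symbol T N)} (h : KurodaStep R U u v) :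
    Relation.ReflTransGen (CSStep (kurodaRules R U hne)) (u.map liftSymbol)
      (v.map liftSymbol) := by
  cases h with
  | @binary A B C D x y hR =>
    have hm : ∀ r ∈ markRules (T := T) (A, B, C, D), r ∈ kurodaRules R U hne :=
      fun r hr => .inl (Set.mem_biUnion hR hr)
    simp only [List.map_append, List.map_cons, liftSymbol]
    refine .head ⟨_, hm _ (.inl rfl), x.map liftSymbol, y.map liftSymbol, by simp, rfl⟩ ?_
    refine .head ⟨_, hm _ (.inr (.inl rfl)), x.map liftSymbol, y.map liftSymbol, by simp, rfl⟩ ?_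
    refine .head ⟨_, hm _ (.inr (.inr (.inl rfl))), x.map liftSymbol, y.map liftSymbol,
      by simp, rfl⟩ ?_
    refine .head ⟨_, hm _ (.inr (.inr (.inr rfl))), x.map liftSymbol, y.map liftSymbol,
      by simp, rfl⟩ ?_
    simp only [List.append_assoc, List.cons_append, List.nil_append]
    exact .refl
  | @unary A d x y hd =>
    refine .single ⟨_, .inr ⟨⟨_, hd⟩, rfl⟩, x.map liftSymbol, y.map liftSymbol, ?_, ?_⟩ <;>
      simp [liftSymbol]

/-- A language is context sensitive if it is generated by finitely many rules `A B → C D` and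
`A → d`, with `d` non-empty. -/
theorem isContextSensitive_of_kuroda [Finite N] (S : N) (R : Set (N × N × N × N))
    (U : Set (N × List (Symbol T N))) (hU : U.Finite) (hne : ∀ r ∈ U, r.2 ≠ []) :
    IsContextSensitive ({w | Relation.ReflTransGen (KurodaStep R U) [.nonterminal S]
      (w.map .terminal)} : Language T) := by
  refine ⟨kurodaGrammar S R U hU hne, ?_⟩
  ext w
  have hw : (w.map .terminal : List (Symbol T N)).map liftSymbol = w.map .terminal := by
    simp [liftSymbol, Function.comp_def]
  constructor
  · intro h
    have h' : Relation.ReflTransGen (CSStep (kurodaRules R U hne))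
      [.nonterminal (.inl S)] (w.map .terminal) := h
    have := h'.lift' (unmark none) fun _ _ => unmark_produces
    rwa [Function.onFun, unmark_terminals] at this
  · intro h
    have h' : Relation.ReflTransGen (KurodaStep R U) [.nonterminal S] (w.map .terminal) := h
    have := h'.lift' (List.map liftSymbol) fun _ _ => produces_of_kurodaStep (hne := hne)
    rwa [Function.onFun, hw] at this

end Kuroda

end Ising

/-! A grammar for the edges of the square lattice -/

namespace Ising.EdgeGrammar

/-- The rest of a vector of bits that has to be read: `two` stands for `0*110*`, `now` for `10*`,
`one` for `0*10*`, and `zero` for `0*`. -/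
inductive Pat
  | two | now | one | zero
  deriving DecidableEq

instance : Fintype Pat := ⟨{.two, .now, .one, .zero}, by rintro (_ | _ | _ | _) <;> simp⟩

/-- Reading a bit. -/
def Pat.next : Pat → Bool → Option Pat
  | two, false => some two
  | two, true => some now
  | now, false => none
  | now, true => some zero
  | one, false => some one
  | one, true => some zero
  | zero, false => some zero
  | zero, true => none

/-- The vector of bits fits the pattern. -/
def Pat.Fits : Pat → List Bool → Prop
  | p, [] => p = zero
  | p, b :: v => ∃ p', p.next b = some p' ∧ p'.Fits v

theorem Pat.fits_zero {v : List Bool} : zero.Fits v ↔ ∃ n, v = List.replicate n false := by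
  induction v with
  | nil => exact iff_of_true rfl ⟨0, rfl⟩
  | cons b v ih =>
    cases b with
    | true =>
      refine iff_of_false (by simp [Fits, next]) ?_
      rintro ⟨_ | n, h⟩ <;> simp [List.replicate_succ] at h
    | false =>
      simp only [Fits, next, Option.some.injEq, exists_eq_left', ih]
      constructor
      · rintro ⟨n, rfl⟩
        exact ⟨n + 1, rfl⟩
      · rintro ⟨_ | n, h⟩
        · simp at h
        · exact ⟨n, by simpa [List.replicate_succ] using h⟩

theorem Pat.fits_now {v : List Bool} : now.Fits v ↔ ∃ n, v = true :: List.replicate n false := by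
  match v with
  | [] => simp [Fits]
  | true :: v => simp [Fits, next, fits_zero]
  | false :: v => simp [Fits, next]

theorem Pat.fits_one {v : List Bool} :
    one.Fits v ↔ ∃ a b, v = List.replicate a false ++ true :: List.replicate b false := by
  induction v with
  | nil => simp [Fits]
  | cons b v ih =>
    cases b with
    | true =>
      simp only [Fits, next, Option.some.injEq, exists_eq_left', fits_zero]
      constructor
      · rintro ⟨n, rfl⟩
        exact ⟨0, n, rfl⟩
      · rintro ⟨_ | a, b, h⟩
        · exact ⟨b, by simpa using h⟩
        · simp [List.replicate_succ] at h
    | false =>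
      simp only [Fits, next, Option.some.injEq, exists_eq_left', ih]
      constructor
      · rintro ⟨a, b, rfl⟩
        exact ⟨a + 1, b, rfl⟩
      · rintro ⟨_ | a, b, h⟩
        · simp at h
        · exact ⟨a, b, by simpa [List.replicate_succ] using h⟩

theorem Pat.fits_two {v : List Bool} :
    two.Fits v ↔ ∃ a b, v = List.replicate a false ++ true :: true :: List.replicate b false := by
  induction v with
  | nil => simp [Fits]
  | cons b v ih =>
    cases b with
    | true =>
      simp only [Fits, next, Option.some.injEq, exists_eq_left', fits_now]
      constructor
      · rintro ⟨n, rfl⟩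
        exact ⟨0, n, rfl⟩
      · rintro ⟨_ | a, b, h⟩
        · exact ⟨b, by simpa using h⟩
        · simp [List.replicate_succ] at h
    | false =>
      simp only [Fits, next, Option.some.injEq, exists_eq_left', ih]
      constructor
      · rintro ⟨a, b, rfl⟩
        exact ⟨a + 1, b, rfl⟩
      · rintro ⟨_ | a, b, h⟩
        · simp at h
        · exact ⟨a, b, by simpa [List.replicate_succ] using h⟩

/-- The nonterminals. A symbol `col` stands for a column, and `row` and `last` for the first cell of
a row. A column moves to the right and leaves a `cell` in each row, and it becomes the last cell of
the last row; the leftmost column (`lead`) finally turns everything that it passes into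
terminals. A bit `t` tells if a column or a row contains an end of the edge, and a bit `b` is the
value of a cell. -/
inductive NT
  | start
  | grow (lead z : Bool) (p q : Pat)
  | col (lead t : Bool)
  | cross (lead b t : Bool)
  | row (t b : Bool)
  | last (t b : Bool)
  | cell (b : Bool)
  | done (b : Bool)
  | finish (b : Bool)
  deriving Fintype

open NT

/-- The rules with two symbols. -/
inductive Binary : NT × NT × NT × NT → Prop
  | col_row (t r b) : Binary (col false t, row r b, row r b, cross false (t && r) t)
  | lead_row (t r b) : Binary (col true t, row r b, done b, cross true (t && r) t)
  | col_cell (t b) : Binary (col false t, cell b, cell b, col false t)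
  | lead_cell (t b) : Binary (col true t, cell b, done b, col true t)
  | col_last (t r b) : Binary (col false t, last r b, last r b, cell (t && r))
  | lead_last (t r b) : Binary (col true t, last r b, done b, finish (t && r))
  | finish (b b') : Binary (finish b, cell b', done b, finish b')

/-- One of the two coordinates of the ends of the edge is the same, the other one is not. -/
def IsStart (p q : Pat) : Prop := (p = .two ∧ q = .one) ∨ (p = .one ∧ q = .two)

open Symbol (terminal nonterminal)

/-- The rules with one symbol. -/
inductive Unary : NT × List (Symbol Bool NT) → Prop
  | cross (b t) : Unary (cross false b t, [nonterminal (cell b), nonterminal (col false t)])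
  | lead_cross (b t) : Unary (cross true b t, [nonterminal (done b), nonterminal (col true t)])
  | done (b) : Unary (done b, [terminal b])
  | finish (b) : Unary (NT.finish b, [terminal b])
  | start (p q p' q' z r) : IsStart p q → p.next z = some p' → q.next r = some q' →
      Unary (start, [nonterminal (grow true z p' q'), nonterminal (last r (z && r))])
  | grow (l z p q p' q' t r) : p.next t = some p' → q.next r = some q' →
      Unary (grow l z p q,
        [nonterminal (col l t), nonterminal (grow false z p' q'), nonterminal (row r (z && r))])
  | grow_last (l z p q t r) : p.next t = some .zero → q.next r = some .zero →
      Unary (grow l z p q, [nonterminal (col l t), nonterminal (row r (z && r))])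

theorem Unary.length_le {x} (h : Unary x) : x.2.length ≤ 3 := by
  cases h <;> simp

theorem Unary.ne_nil {x} (h : Unary x) : x.2 ≠ [] := by
  cases h <;> simp

theorem finite_unary : {x | Unary x}.Finite :=
  (Set.finite_univ.prod (List.finite_length_le (Symbol Bool NT) 3)).subset
    fun _ h => ⟨trivial, h.length_le⟩

/-- A derivation step. -/
abbrev Step : List (Symbol Bool NT) → List (Symbol Bool NT) → Prop :=
  KurodaStep {x | Binary x} {x | Unary x}

/-! ### Soundness of the grammar -/

/-- The cells of the rows `R` (from last to first) where the columns are `v`. -/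
def cells (v R : List Bool) : List Bool := R.reverse.flatMap fun r => v.map (· && r)

/-- The words that a string stands for, where `v` is the list of the columns that come from the
left. No columns come from the left of a terminal or of the leftmost column. -/
def Denotes : List (Symbol Bool NT) → List Bool → List Bool → Prop
  | [], _, o => o = []
  | terminal b :: w, v, o => v = [] ∧ ∃ o', o = b :: o' ∧ Denotes w v o'
  | nonterminal (cell b) :: w, v, o => ∃ o', o = b :: o' ∧ Denotes w v o'
  | nonterminal (done b) :: w, v, o => v = [] ∧ ∃ o', o = b :: o' ∧ Denotes w v o'
  | nonterminal (NT.finish b) :: w, v, o => v = [] ∧ ∃ o', o = b :: o' ∧ Denotes w v o'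
  | nonterminal (col l t) :: w, v, o => (l → v = []) ∧ Denotes w (v ++ [t]) o
  | nonterminal (cross l b t) :: w, v, o =>
      (l → v = []) ∧ ∃ o', o = b :: o' ∧ Denotes w (v ++ [t]) o'
  | nonterminal (row r b) :: w, v, o => ∃ o', o = b :: (v.map (· && r) ++ o') ∧ Denotes w v o'
  | nonterminal (last r b) :: w, v, o => ∃ o', o = b :: (v.map (· && r) ++ o') ∧ Denotes w [] o'
  | nonterminal (grow l z p q) :: w, v, o => (l → v = []) ∧ ∃ C R o', C.length = R.length ∧
      C ≠ [] ∧ p.Fits C ∧ q.Fits R ∧ o = cells (z :: (v ++ C)) R ++ o' ∧ Denotes w (v ++ C) o'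
  | nonterminal start :: w, v, o => v = [] ∧ ∃ z C r R o' p q, C.length = R.length ∧ C ≠ [] ∧
      IsStart p q ∧ p.Fits (z :: C) ∧ q.Fits (r :: R) ∧ o = cells (z :: C) (r :: R) ++ o' ∧
      Denotes w [] o'

/-- A prefix acts on the suffix only through the columns it sends to the right, so inclusions
between suffixes carry over to arbitrary left contexts. -/
theorem Denotes.append_mono {u u' : List (Symbol Bool NT)}
    (h : ∀ v o, Denotes u v o → Denotes u' v o) (x : List (Symbol Bool NT)) :
    ∀ v o, Denotes (x ++ u) v o → Denotes (x ++ u') v o := by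
  induction x with
  | nil => exact h
  | cons s x ih =>
    intro v o
    match s with
    | terminal _ | nonterminal (done _) | nonterminal (NT.finish _) | nonterminal (cross _ _ _) =>
      exact fun ⟨h0, o', h1, h2⟩ => ⟨h0, o', h1, ih _ _ h2⟩
    | nonterminal (col _ _) => exact fun ⟨h0, h1⟩ => ⟨h0, ih _ _ h1⟩
    | nonterminal (cell _) | nonterminal (row _ _) | nonterminal (last _ _) =>
      exact fun ⟨o', h1, h2⟩ => ⟨o', h1, ih _ _ h2⟩
    | nonterminal (grow _ _ _ _) =>
      exact fun ⟨h0, C, R, o', h1, h2, h3, h4, h5, h6⟩ =>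
        ⟨h0, C, R, o', h1, h2, h3, h4, h5, ih _ _ h6⟩
    | nonterminal start =>
      exact fun ⟨h0, z, C, r, R, o', p, q, h1, h2, h3, h4, h5, h6, h7⟩ =>
        ⟨h0, z, C, r, R, o', p, q, h1, h2, h3, h4, h5, h6, ih _ _ h7⟩

theorem cells_cons (v : List Bool) (r : Bool) (R : List Bool) :
    cells v (r :: R) = cells v R ++ v.map (· && r) := by
  simp [cells, List.flatMap_append]

/-- The invariant is pulled back along a step. Only this inclusion is needed: from the terminal
word, which stands for itself, one goes back to the start symbol. -/
theorem Denotes.of_step {u u' : List (Symbol Bool NT)} (h : Step u u') :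
    ∀ v o, Denotes u' v o → Denotes u v o := by
  cases h with
  | @binary A B C D x y h =>
    refine Denotes.append_mono (fun v o => ?_) x
    cases h with
    | col_row t r b =>
      rintro ⟨_, rfl, -, o, rfl, h⟩
      exact ⟨by simp, o, by simp, h⟩
    | lead_row t r b =>
      rintro ⟨rfl, _, rfl, -, o, rfl, h⟩
      exact ⟨by simp, o, by simp, h⟩
    | col_cell t b =>
      rintro ⟨o, rfl, -, h⟩
      exact ⟨by simp, o, rfl, h⟩
    | lead_cell t b =>
      rintro ⟨rfl, o, rfl, -, h⟩
      exact ⟨by simp, o, rfl, h⟩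
    | col_last t r b =>
      rintro ⟨_, rfl, o, rfl, h⟩
      exact ⟨by simp, o, by simp, h⟩
    | lead_last t r b =>
      rintro ⟨rfl, _, rfl, -, o, rfl, h⟩
      exact ⟨by simp, o, by simp, h⟩
    | finish b b' =>
      rintro ⟨rfl, _, rfl, -, o, rfl, h⟩
      exact ⟨rfl, _, rfl, o, rfl, h⟩
  | @unary A d x y h =>
    rw [List.append_assoc]
    refine Denotes.append_mono (fun v o => ?_) x
    cases h with
    | cross b t =>
      rintro ⟨o, rfl, -, h⟩
      exact ⟨by simp, o, rfl, h⟩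
    | lead_cross b t =>
      rintro ⟨rfl, o, rfl, -, h⟩
      exact ⟨by simp, o, rfl, h⟩
    | done b | finish b => exact id
    | start p q p' q' z r hpq hp hq =>
      rintro ⟨h0, C, R, _, h1, h2, h3, h4, rfl, o, rfl, h⟩
      obtain rfl := h0 rfl
      exact ⟨rfl, z, C, r, R, o, p, q, h1, h2, hpq, ⟨_, hp, h3⟩, ⟨_, hq, h4⟩,
        by simp [cells_cons], h⟩
    | grow l z p q p' q' t r hp hq =>
      rintro ⟨h0, -, C, R, _, h1, h2, h3, h4, rfl, o, rfl, h⟩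
      exact ⟨h0, t :: C, r :: R, o, by simp [h1], by simp, ⟨_, hp, h3⟩, ⟨_, hq, h4⟩,
        by simp [cells_cons], by simpa using h⟩
    | grow_last l z p q t r hp hq =>
      rintro ⟨h0, o, rfl, h⟩
      exact ⟨h0, [t], [r], o, rfl, by simp, ⟨_, hp, rfl⟩, ⟨_, hq, rfl⟩, by simp [cells], h⟩

theorem Denotes.terminals (w : List Bool) : Denotes (w.map terminal) [] w := by
  induction w with
  | nil => rfl
  | cons b w ih => exact ⟨rfl, w, rfl, ih⟩

/-- What the words of the language look like. -/
def IsEdgeWord (w : List Bool) : Prop :=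
  ∃ C R p q, C.length = R.length ∧ 2 ≤ C.length ∧ IsStart p q ∧ p.Fits C ∧ q.Fits R ∧ w = cells C R

theorem isEdgeWord_of_derives {w : List Bool}
    (h : Relation.ReflTransGen Step [nonterminal start] (w.map terminal)) : IsEdgeWord w := by
  have h1 : ∀ u, Relation.ReflTransGen Step u (w.map terminal) → Denotes u [] w := by
    intro u hu
    induction hu using Relation.ReflTransGen.head_induction_on with
    | refl => exact .terminals w
    | head h _ ih => exact .of_step h _ _ ih
  obtain ⟨-, z, C, r, R, o, p, q, h6, h2, h3, h4, h5, rfl, rfl⟩ := h1 _ h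
  have := List.length_pos_iff.2 h2
  exact ⟨z :: C, r :: R, p, q, by simp [h6], by simp; omega, h3, h4, h5, by simp⟩

/-! ### Completeness of the grammar -/

/-- Several derivation steps. -/
abbrev Steps : List (Symbol Bool NT) → List (Symbol Bool NT) → Prop := Relation.ReflTransGen Step

theorem Steps.append_left {u v : List (Symbol Bool NT)} (h : Steps u v) (x) :
    Steps (x ++ u) (x ++ v) := by
  simpa using KurodaStep.append h x []

theorem Steps.append_right {u v : List (Symbol Bool NT)} (h : Steps u v) (y) :
    Steps (u ++ y) (v ++ y) := by
  simpa using KurodaStep.append h [] y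

theorem Steps.cons {u v : List (Symbol Bool NT)} (h : Steps u v) (s) :
    Steps (s :: u) (s :: v) := h.append_left [s]

theorem Steps.binary {A B C D : NT} (h : Binary (A, B, C, D)) (y : List (Symbol Bool NT)) :
    Steps (nonterminal A :: nonterminal B :: y) (nonterminal C :: nonterminal D :: y) :=
  .single (.binary [] y h)

theorem Steps.unary {A : NT} {d : List (Symbol Bool NT)} (h : Unary (A, d)) (y) :
    Steps (nonterminal A :: y) (d ++ y) :=
  .single (.unary [] y h)

/-- Symbols for the columns. -/
def cols (l : Bool) : List Bool → List (Symbol Bool NT)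
  | [] => []
  | t :: C => nonterminal (col l t) :: C.map fun t => nonterminal (col false t)

/-- As for `aⁿbⁿ`, columns come out on the left and rows on the right, which reverses the rows. The
first column `z` has no symbol of its own: its cells are stored in the row symbols. Only the first
column produced here inherits `l`. -/
theorem steps_grow (z : Bool) (C : List Bool) (hC : C ≠ []) :
    ∀ (l : Bool) (R : List Bool) (p q : Pat), C.length = R.length → p.Fits C → q.Fits R →
    Steps [nonterminal (grow l z p q)]
      (cols l C ++ R.reverse.map fun r => nonterminal (row r (z && r))) := by
  induction C with
  | nil => exact absurd rfl hC
  | cons t C ih =>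
    intro l R p q hlen hp hq
    match R, hlen with
    | r :: R, hlen =>
    obtain ⟨p', hp', hp⟩ := hp
    obtain ⟨q', hq', hq⟩ := hq
    by_cases h : C = []
    · subst h
      obtain rfl : R = [] := List.length_eq_zero_iff.1 (by simpa using hlen.symm)
      obtain rfl : p' = .zero := hp
      obtain rfl : q' = .zero := hq
      exact .unary (.grow_last l z p q t r hp' hq') []
    · refine (Steps.unary (.grow l z p q p' q' t r hp' hq') []).trans ?_
      have := ih h false R p' q' (by simpa using hlen) hp hq
      have := KurodaStep.append this [nonterminal (col l t)] [nonterminal (row r (z && r))]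
      refine this.trans ?_
      have h1 : cols false C = C.map fun t => nonterminal (col false t) := by cases C <;> rfl
      rw [h1]
      simp only [cols, List.reverse_cons, List.map_append, List.append_assoc, List.cons_append,
        List.nil_append, List.map_cons, List.map_nil]
      rfl

/-- Symbols for cells. -/
def cellSymbols (v : List Bool) : List (Symbol Bool NT) := v.map fun b => nonterminal (cell b)

theorem steps_col_cells (t : Bool) (v : List Bool) (y : List (Symbol Bool NT)) :
    Steps (nonterminal (col false t) :: (cellSymbols v ++ y))
      (cellSymbols v ++ nonterminal (col false t) :: y) := by
  induction v with
  | nil => rfl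
  | cons b v ih => exact (Steps.binary (.col_cell t b) _).trans (ih.cons _)

theorem steps_lead_cells (t : Bool) (v : List Bool) (y : List (Symbol Bool NT)) :
    Steps (nonterminal (col true t) :: (cellSymbols v ++ y))
      (v.map terminal ++ nonterminal (col true t) :: y) := by
  induction v with
  | nil => rfl
  | cons b v ih =>
    exact (Steps.binary (.lead_cell t b) _).trans ((Steps.unary (.done b) _).trans (ih.cons _))

theorem steps_finish (v : List Bool) : ∀ b : Bool,
    Steps (nonterminal (NT.finish b) :: cellSymbols v) (terminal b :: v.map terminal) := by
  induction v with
  | nil => exact fun b => .unary (.finish b) []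
  | cons b' v ih =>
    exact fun b => (Steps.binary (.finish b b') _).trans
      ((Steps.unary (.done b) _).trans ((ih b').cons _))

/-- Symbols for rows with some cells. -/
def rowSymbols (z : Bool) (v R : List Bool) : List (Symbol Bool NT) :=
  R.flatMap fun r => nonterminal (row r (z && r)) :: cellSymbols (v.map (· && r))

/-- The new cell lands directly behind the row symbol, in front of the cells of the columns that
passed earlier; this is why `t` is prepended to `v`. -/
theorem steps_col_rows (z t : Bool) (v R : List Bool) (y : List (Symbol Bool NT)) :
    Steps (nonterminal (col false t) :: (rowSymbols z v R ++ y))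
      (rowSymbols z (t :: v) R ++ nonterminal (col false t) :: y) := by
  induction R with
  | nil => rfl
  | cons r R ih =>
    simp only [rowSymbols, List.flatMap_cons, List.append_assoc, List.cons_append] at ih ⊢
    refine (Steps.binary (.col_row t r _) _).trans (Steps.cons ?_ _)
    refine (Steps.unary (.cross _ _) _).trans (Steps.cons ?_ _)
    exact (steps_col_cells t _ _).trans (ih.append_left _)

/-- Behind the leftmost column nothing will change any more, so it may leave terminals. -/
theorem steps_lead_rows (z t : Bool) (v R : List Bool) (y : List (Symbol Bool NT)) :
    Steps (nonterminal (col true t) :: (rowSymbols z v R ++ y))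
      ((R.flatMap fun r => (z :: t :: v).map (· && r)).map terminal ++
        nonterminal (col true t) :: y) := by
  induction R with
  | nil => rfl
  | cons r R ih =>
    simp only [rowSymbols, List.flatMap_cons, List.append_assoc, List.cons_append, List.map_cons,
      List.map_append] at ih ⊢
    refine (Steps.binary (.lead_row t r _) _).trans ?_
    refine (Steps.unary (.done _) _).trans (Steps.cons ?_ _)
    refine (Steps.unary (.lead_cross _ _) _).trans ?_
    refine (Steps.unary (.done _) _).trans (Steps.cons ?_ _)
    exact (steps_lead_cells t _ _).trans (ih.append_left _)

/-- The columns move one at a time, the rightmost first, so that none has to overtake another. In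
the last row each one ends as a cell. -/
theorem steps_cols (z r : Bool) (R C : List Bool) :
    Steps ((C.map fun t => nonterminal (col false t)) ++
        (rowSymbols z [] R ++ [nonterminal (last r (z && r))]))
      (rowSymbols z C R ++ nonterminal (last r (z && r)) :: cellSymbols (C.map (· && r))) := by
  induction C with
  | nil => rfl
  | cons t C ih =>
    refine (ih.cons _).trans ((steps_col_rows z t C R _).trans (Steps.append_left ?_ _))
    exact .binary (.col_last t r _) _

theorem derives_of_isEdgeWord {w : List Bool} (h : IsEdgeWord w) :
    Steps [nonterminal start] (w.map terminal) := by
  obtain ⟨C, R, p, q, hlen, hC, hpq, hp, hq, rfl⟩ := h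
  match C, R, hlen, hC with
  | z :: t :: C, r :: R, hlen, hC =>
  obtain ⟨p', hp', hp⟩ := hp
  obtain ⟨q', hq', hq⟩ := hq
  refine (Steps.unary (.start p q p' q' z r hpq hp' hq') []).trans ?_
  refine ((steps_grow z (t :: C) (by simp) true R p' q' (by simpa using hlen) hp hq).append_right
    [nonterminal (last r (z && r))]).trans ?_
  have h1 : (R.reverse.map fun r => nonterminal (row r (z && r))) = rowSymbols z [] R.reverse := by
    simp [rowSymbols, cellSymbols, List.map_eq_flatMap]
  rw [h1, List.append_assoc]
  refine ((steps_cols z r R.reverse C).cons (nonterminal (col true t))).trans ?_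
  refine (steps_lead_rows z t C _ _).trans ?_
  rw [cells_cons, List.map_append]
  refine Steps.append_left ?_ _
  refine (Steps.binary (.lead_last t r _) _).trans ?_
  refine (Steps.unary (.done _) _).trans (Steps.cons ?_ _)
  exact steps_finish _ _

/-! The edge language -/

theorem cells_replicate (v : List Bool) (n : ℕ) (R : List Bool) :
    cells v (R ++ List.replicate n false) = List.replicate (n * v.length) false ++ cells v R := by
  have h : v.map (fun _ => false) = List.replicate v.length false := by simp
  induction n with
  | zero => simp
  | succ n ih =>
    simp only [cells, List.reverse_append, List.reverse_replicate, List.flatMap_append] at ih ⊢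
    rw [List.replicate_succ, List.flatMap_cons, List.append_assoc, ih]
    simp only [Bool.and_false, h]
    rw [← List.append_assoc, List.replicate_append_replicate]
    congr 2
    ring

theorem cells_true (v R : List Bool) : cells v (true :: R) = cells v R ++ v := by
  simp [cells_cons]

theorem cells_replicate_left (v : List Bool) (n : ℕ) (R : List Bool) :
    cells v (List.replicate n false ++ R) = cells v R ++ List.replicate (n * v.length) false := by
  have h : v.map (fun _ => false) = List.replicate v.length false := by simp
  induction n with
  | zero => simp
  | succ n ih =>
    rw [List.replicate_succ, List.cons_append, cells_cons, ih, List.append_assoc]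
    simp only [Bool.and_false, h]
    rw [List.replicate_append_replicate]
    congr 2
    ring

/-- The rows are listed from last to first, so the `d` zero rows at the end of the list come first
in the word. -/
theorem cells_vector (v : List Bool) (c d : ℕ) :
    cells v (List.replicate c false ++ true :: List.replicate d false) =
      List.replicate (d * v.length) false ++ v ++ List.replicate (c * v.length) false := by
  have := cells_replicate v d []
  rw [List.nil_append] at this
  rw [cells_replicate_left, cells_true, this]
  simp [cells]

theorem cells_vector_two (v : List Bool) (c d : ℕ) :
    cells v (List.replicate c false ++ true :: true :: List.replicate d false) =
      List.replicate (d * v.length) false ++ v ++ v ++ List.replicate (c * v.length) false := by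
  have := cells_replicate v d []
  rw [List.nil_append] at this
  rw [cells_replicate_left, cells_true, cells_true, this]
  simp [cells]

/-- The word of an edge. -/
def edgeWord (n i j : ℕ) : List Bool :=
  List.replicate (i - 1) false ++ true ::
    (List.replicate (j - i - 1) false ++ true :: List.replicate (n - j) false)

/-- Two adjacent columns in one row: `d` rows and `a` columns precede the left end. -/
theorem cells_horizontal {a b c d m : ℕ} (h1 : a + b + 2 = m) (h2 : c + d + 1 = m) :
    cells (List.replicate a false ++ true :: true :: List.replicate b false)
      (List.replicate c false ++ true :: List.replicate d false) =
      edgeWord (m ^ 2) (d * m + a + 1) (d * m + a + 1 + 1) := by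
  have h3 : (List.replicate a false ++ true :: true :: List.replicate b false).length = m := by
    simp; omega
  have h4 : m ^ 2 = c * m + d * m + m := by
    calc m ^ 2 = (c + d + 1) * m := by rw [h2, sq]
      _ = _ := by ring
  have h5 : m ^ 2 - (d * m + a + 1 + 1) = b + c * m := by omega
  have h6 : d * m + a + 1 + 1 - (d * m + a + 1) - 1 = 0 := by omega
  rw [cells_vector, h3, edgeWord, h5, h6, Nat.add_sub_cancel]
  simp [List.replicate_add, -List.replicate_append_replicate]

/-- One column in two adjacent rows: the vector is read twice in succession, which puts the ones at
distance `m`, with `b + a = m - 1` zeros between them. -/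
theorem cells_vertical {a b c d m : ℕ} (h1 : a + b + 1 = m) (h2 : c + d + 2 = m) :
    cells (List.replicate a false ++ true :: List.replicate b false)
      (List.replicate c false ++ true :: true :: List.replicate d false) =
      edgeWord (m ^ 2) (d * m + a + 1) (d * m + a + 1 + m) := by
  have h3 : (List.replicate a false ++ true :: List.replicate b false).length = m := by
    simp; omega
  have h4 : m ^ 2 = c * m + d * m + 2 * m := by
    calc m ^ 2 = (c + d + 2) * m := by rw [h2, sq]
      _ = _ := by ring
  have h5 : m ^ 2 - (d * m + a + 1 + m) = b + c * m := by omega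
  have h6 : d * m + a + 1 + m - (d * m + a + 1) - 1 = b + a := by omega
  rw [cells_vector_two, h3, edgeWord, h5, h6, Nat.add_sub_cancel]
  simp [List.replicate_add, -List.replicate_append_replicate]

theorem isEdgeWord_iff (w : List Bool) : IsEdgeWord w ↔ w ∈ model2d.edgeLanguage := by
  constructor
  · rintro ⟨C, R, p, q, h1, h2, ⟨rfl, rfl⟩ | ⟨rfl, rfl⟩, hp, hq, rfl⟩
    · obtain ⟨a, b, rfl⟩ := Pat.fits_two.1 hp
      obtain ⟨c, d, rfl⟩ := Pat.fits_one.1 hq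
      simp only [List.length_append, List.length_cons, List.length_replicate] at h1 h2
      obtain ⟨m, hm⟩ : ∃ m, m = a + b + 2 := ⟨_, rfl⟩
      refine ⟨m ^ 2, ⟨m, by omega, rfl⟩, (d * m + a + 1, d * m + a + 1 + 1), ?_,
        cells_horizontal (by omega) (by omega)⟩
      have h4 : (d + 1) * m ≤ m * m := Nat.mul_le_mul_right m (by omega)
      simp only [model2d, sqrt_sq, horizontal, Finset.mem_union, Finset.mem_image,
        Finset.mem_filter, Finset.mem_Icc]
      refine .inl ⟨d * m + a + 1, ⟨⟨by omega, ?_⟩, ?_⟩, rfl⟩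
      · rw [sq]
        rw [add_mul] at h4
        omega
      -- The column number `a + 1` lies strictly between `0` and `m`.
      · rw [add_assoc, Nat.dvd_add_right (Dvd.intro_left _ rfl)]
        exact Nat.not_dvd_of_pos_of_lt (by omega) (by omega)
    · obtain ⟨a, b, rfl⟩ := Pat.fits_one.1 hp
      obtain ⟨c, d, rfl⟩ := Pat.fits_two.1 hq
      simp only [List.length_append, List.length_cons, List.length_replicate] at h1 h2
      obtain ⟨m, hm⟩ : ∃ m, m = a + b + 1 := ⟨_, rfl⟩
      refine ⟨m ^ 2, ⟨m, by omega, rfl⟩, (d * m + a + 1, d * m + a + 1 + m), ?_,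
        cells_vertical (by omega) (by omega)⟩
      have h4 : (d + 2) * m ≤ m * m := Nat.mul_le_mul_right m (by omega)
      simp only [model2d, sqrt_sq, vertical, Finset.mem_union, Finset.mem_image, Finset.mem_Icc]
      refine .inr ⟨d * m + a + 1, ⟨by omega, ?_⟩, rfl⟩
      rw [sq]
      rw [add_mul] at h4
      omega
  · rintro ⟨_, ⟨m, hm, rfl⟩, e, he, rfl⟩
    simp only [model2d, sqrt_sq, horizontal, vertical, Finset.mem_union, Finset.mem_image,
      Finset.mem_filter, Finset.mem_Icc] at he
    obtain ⟨i, ⟨⟨hi, him⟩, hdvd⟩, rfl⟩ | ⟨i, ⟨hi, him⟩, rfl⟩ := he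
    -- As `m ∤ i`, the left end lies in column `i % m` (counted from 1) after `i / m` complete rows.
    · have h1 : 0 < i % m := Nat.pos_of_ne_zero fun h => hdvd (Nat.dvd_of_mod_eq_zero h)
      have h2 : i % m < m := Nat.mod_lt _ (by omega)
      have h3 : i / m < m := by
        rw [Nat.div_lt_iff_lt_mul (by omega), ← sq]
        omega
      have h4 := Nat.div_add_mod' i m
      have h5 := cells_horizontal (a := i % m - 1) (b := m - 1 - i % m) (c := m - 1 - i / m)
        (d := i / m) (m := m) (by omega) (by omega)
      rw [show i / m * m + (i % m - 1) + 1 = i by omega] at h5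
      exact ⟨_, _, _, _, by simp; omega, by simp; omega, .inl ⟨rfl, rfl⟩, Pat.fits_two.2 ⟨_, _, rfl⟩,
        Pat.fits_one.2 ⟨_, _, rfl⟩, h5.symm⟩
    -- Here `i` may be a multiple of `m`, so the coordinates are those of `i - 1`, counted from 0.
    · have h2 : (i - 1) % m < m := Nat.mod_lt _ (by omega)
      have h3 : (i - 1) / m < m - 1 := by
        rw [Nat.div_lt_iff_lt_mul (by omega), Nat.sub_mul, one_mul, ← sq]
        omega
      have h4 := Nat.div_add_mod' (i - 1) m
      have h5 := cells_vertical (a := (i - 1) % m) (b := m - 1 - (i - 1) % m)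
        (c := m - 2 - (i - 1) / m) (d := (i - 1) / m) (m := m) (by omega) (by omega)
      rw [show (i - 1) / m * m + (i - 1) % m + 1 = i by omega] at h5
      exact ⟨_, _, _, _, by simp; omega, by simp; omega, .inr ⟨rfl, rfl⟩, Pat.fits_one.2 ⟨_, _, rfl⟩,
        Pat.fits_two.2 ⟨_, _, rfl⟩, h5.symm⟩

end Ising.EdgeGrammar

namespace Ising

theorem model2d_edgeLanguage_isContextSensitive : IsContextSensitive model2d.edgeLanguage := by
  have h := isContextSensitive_of_kuroda (T := Bool) EdgeGrammar.NT.start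
    {x | EdgeGrammar.Binary x} {x | EdgeGrammar.Unary x} EdgeGrammar.finite_unary
    fun _ h => h.ne_nil
  refine (congrArg IsContextSensitive ?_).mp h
  ext w
  rw [← EdgeGrammar.isEdgeWord_iff]
  exact ⟨EdgeGrammar.isEdgeWord_of_derives, EdgeGrammar.derives_of_isEdgeWord⟩

end Ising

/-! Deterministic computations -/

namespace Ising

section Deterministic

variable {C : Type} {step : C → C → Prop} {mark halt : C → Bool}

/-- A computation from the first to the second configuration; `halt` does not hold before the last
configuration, and the list consists of the configurations before the last one in which `mark`
holds. -/
inductive Path (step : C → C → Prop) (mark halt : C → Bool) : C → List C → C → Prop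
  | refl (c) : Path step mark halt c [] c
  | head {c c' tr d} : halt c = false → step c c' → Path step mark halt c' tr d →
      Path step mark halt c (if mark c then c :: tr else tr) d

theorem Path.trans {c d e : C} {tr tr' : List C} (h : Path step mark halt c tr d)
    (h' : Path step mark halt d tr' e) : Path step mark halt c (tr ++ tr') e := by
  induction h with
  | refl c => exact h'
  | @head c c' tr d h1 h2 _ ih =>
    have := Path.head h1 h2 (ih h')
    split_ifs at this ⊢ <;> exact this

theorem Path.single {c d : C} (h1 : halt c = false) (h2 : mark c = false) (h : step c d) :
    Path step mark halt c [] d := by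
  simpa [h2] using Path.head (mark := mark) h1 h (.refl d)

theorem Path.single_mark {c d : C} (h1 : halt c = false) (h2 : mark c = true) (h : step c d) :
    Path step mark halt c [c] d := by
  simpa [h2] using Path.head (mark := mark) h1 h (.refl d)

theorem Path.reflTransGen {c d : C} {tr : List C} (h : Path step mark halt c tr d) :
    Relation.ReflTransGen step c d := by
  induction h with
  | refl c => exact .refl
  | head _ h _ ih => exact .head h ih

/-- A path never visits a halting configuration before its end, so its end is the first one, and its
trace is the list of marked configurations before that. -/
theorem Path.exists_reachesFirst {c d : C} {tr : List C} (h : Path step mark halt c tr d)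
    (hd : halt d = true) :
    ∃ pre, ReachesFirst step (fun c => halt c = true) c pre d ∧ pre.filter mark = tr := by
  induction h with
  | refl c => exact ⟨[], ⟨⟨rfl, .singleton _⟩, hd, by simp⟩, rfl⟩
  | @head c c' tr d h1 h2 _ ih =>
    obtain ⟨pre, ⟨⟨h3, h4⟩, _, h5⟩, h6⟩ := ih hd
    refine ⟨c :: pre, ⟨⟨rfl, ?_⟩, hd, ?_⟩, ?_⟩
    · rw [List.cons_append, List.isChain_cons]
      refine ⟨fun y hy => ?_, h4⟩
      obtain rfl : y = c' := by
        rw [h3] at hy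
        simpa using hy.symm
      exact h2
    · simpa [h1] using h5
    · rw [List.filter_cons, h6]

theorem IsRun.tail {c d : C} {r : List C} (h : IsRun step c (c :: d :: r)) :
    step c d ∧ IsRun step d (d :: r) := by
  obtain ⟨-, h⟩ := h
  rw [List.isChain_cons_cons] at h
  exact ⟨h.1, rfl, h.2⟩

/-- In a deterministic system, the first configuration with a given property is unique. -/
theorem ReachesFirst.unique {D : C → Prop} (hdet : ∀ a b c, step a b → step a c → b = c) :
    ∀ {pre pre' : List C} {c₀ c c' : C}, ReachesFirst step D c₀ pre c →
      ReachesFirst step D c₀ pre' c' → pre = pre' ∧ c = c' := by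
  intro pre
  induction pre with
  | nil =>
    rintro (_ | ⟨x, pre'⟩) c₀ c c' ⟨⟨h1, -⟩, h2, -⟩ ⟨⟨h3, -⟩, h4, h5⟩
    · simp only [List.nil_append, List.head?_cons, Option.some.injEq] at h1 h3
      exact ⟨rfl, h1.trans h3.symm⟩
    · simp only [List.nil_append, List.cons_append, List.head?_cons, Option.some.injEq] at h1 h3
      subst h1 h3
      exact absurd h2 (h5 _ (by simp))
  | cons x pre ih =>
    rintro (_ | ⟨x', pre'⟩) c₀ c c' ⟨⟨h1, h1'⟩, h2, h6⟩ ⟨⟨h3, h3'⟩, h4, h5⟩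
    · simp only [List.nil_append, List.cons_append, List.head?_cons, Option.some.injEq] at h1 h3
      subst h1 h3
      exact absurd h4 (h6 _ (by simp))
    · simp only [List.cons_append, List.head?_cons, Option.some.injEq] at h1 h3
      subst h1 h3
      rw [List.cons_append, List.isChain_cons] at h1' h3'
      have hne : ∀ (l : List C) (a : C), ∃ b, (l ++ [a]).head? = some b := by
        rintro (_ | ⟨b, l⟩) a <;> simp
      obtain ⟨d, hd⟩ := hne pre c
      obtain ⟨d', hd'⟩ := hne pre' c'
      obtain rfl := hdet _ _ _ (h1'.1 d (by simp [hd])) (h3'.1 d' (by simp [hd']))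
      obtain ⟨rfl, rfl⟩ := ih (pre' := pre') ⟨⟨hd, h1'.2⟩, h2, fun x hx => h6 x (by simp [hx])⟩
        ⟨⟨hd', h3'.2⟩, h4, fun x hx => h5 x (by simp [hx])⟩
      exact ⟨rfl, rfl⟩

/-- In a deterministic system, a computation that cannot be continued runs along a given one. -/
theorem Path.mem_of_isRun (hdet : ∀ a b c, step a b → step a c → b = c) {c₀ d : C} {tr : List C}
    (h : Path step mark halt c₀ tr d) : ∀ {r : List C} {c : C}, IsRun step c₀ (r ++ [c]) →
      (∀ c', ¬ step c c') → d ∈ r ++ [c] := by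
  induction h with
  | refl c₀ =>
    intro r c h _
    exact List.mem_of_head? h.1
  | @head c₀ c₁ tr d h1 h2 _ ih =>
    rintro (_ | ⟨x, r⟩) c h hc
    · obtain rfl : c = c₀ := by simpa using h.1
      exact absurd h2 (hc _)
    · obtain rfl : x = c₀ := by simpa using h.1
      obtain ⟨y, l, hl⟩ : ∃ y l, r ++ [c] = y :: l := by cases r <;> simp
      rw [List.cons_append, hl] at h
      obtain ⟨h3, h4⟩ := h.tail
      obtain rfl := hdet _ _ _ h2 h3
      rw [← hl] at h4
      exact List.mem_cons_of_mem _ (ih h4 hc)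

end Deterministic

/-- In a deterministic automaton, acceptance does not depend on the point of a computation. -/
theorem LBA.acceptsFrom_congr {α : Type} {A : LBA α}
    (hdet : ∀ a b c, A.Step a b → A.Step a c → b = c) {c d : A.Config}
    (h : Relation.ReflTransGen A.Step c d) : A.AcceptsFrom c ↔ A.AcceptsFrom d := by
  induction h using Relation.ReflTransGen.head_induction_on with
  | refl => rfl
  | @head a b hab _ ih =>
    rw [← ih]
    constructor
    · rintro ⟨e, h1, h2⟩
      obtain rfl | ⟨b', h3, h4⟩ := h1.cases_head
      · exact absurd hab (h2.2 _)
      · exact ⟨e, hdet _ _ _ hab h3 ▸ h4, h2⟩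
    · rintro ⟨e, h1, h2⟩
      exact ⟨e, .head hab h1, h2⟩

instance : Fintype Letter :=
  ⟨{.spin false, .spin true, .bullet, .plus, .minus}, by rintro ((_ | _) | _ | _ | _) <;> simp⟩

/-! ### States and transitions of the automaton for the square lattice -/

namespace SquareLBA

/-- The symbols on the tapes. -/
inductive Cell
  | leftEnd | rightEnd | blank | mark
  | letter (a : Letter)
  | digit (b : Bool)
  | sign (b : Bool)
  deriving Fintype

/-- The places from which an addition is called. -/
inductive Ret
  | vertical | horizontal
  | read (b : Bool)
  deriving Fintype

/-- The states. -/
inductive State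
  | pre0 | pre1 | pre2 | pre3 | zagLeft | zagRight | copy | shift
  | top | mid | reset | compare | zero | accept
  | next (a : Bool)
  | add (r : Ret) (neg : Bool)
  | inc (r : Ret)
  | dec (r : Ret)
  | undo (r : Ret)
  | rewind (r : Ret)
  | read (o : Option Bool)
  deriving Fintype

/-- The state in which the work goes on after an addition. -/
def Ret.state : Ret → State
  | vertical => .mid
  | horizontal => .top
  | read b => .read (some b)

open Cell State Move

/-- The symbol of a spin. -/
abbrev sp (b : Bool) : Cell := letter (.spin b)

/-- The transitions, for the four heads: the input, a reversed copy of the spins, the energy and a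
counter for the columns of the lattice.

When there are `m` marks on the counter tape, `m ^ 2` spins have been read; the automaton reads
`2 * m + 1` further spins and adds a mark, until it comes to the bullet (`zagLeft`, `zagRight`).
When the spins have been copied (`copy`, `shift`), the input head visits all vertices; the second
head is on the vertex below the current one. -/
inductive Rule : State → Cell → Cell → Cell → Cell →
    State → Move → Cell × Move → Cell × Move → Cell × Move → Prop
  | pre0 (a y) : Rule pre0 (sp a) y blank blank pre1 right (y, stay) (sign false, stay) (mark, right)
  | pre1 (a y e) : Rule pre1 (sp a) y e blank pre2 right (y, stay) (e, stay) (mark, right)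
  | pre2 (a y e c) : Rule pre2 (sp a) y e c pre3 right (y, stay) (e, stay) (c, stay)
  | pre3 (a y e c) : Rule pre3 (sp a) y e c zagRight right (y, stay) (e, stay) (c, stay)
  | right_mark (a y e) :
      Rule zagRight (sp a) y e mark zagRight right (y, stay) (e, stay) (mark, right)
  | right_blank (a y e) :
      Rule zagRight (sp a) y e blank zagLeft stay (y, stay) (e, stay) (mark, left)
  | left_mark (a y e) : Rule zagLeft (sp a) y e mark zagLeft right (y, stay) (e, stay) (mark, left)
  | left_end (x y e) :
      Rule zagLeft x y e leftEnd zagRight stay (y, stay) (e, stay) (leftEnd, right)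
  | square (y e) : Rule zagRight (letter .bullet) y e blank copy left (y, stay) (e, stay) (blank, left)
  | copy (a e c) : Rule copy (sp a) blank e c copy left (sp a, right) (e, stay) (c, stay)
  | copy_end (e c) :
      Rule copy leftEnd blank e c shift right (blank, left) (e, stay) (c, stay)
  | shift (x b e) : Rule shift x (sp b) e mark shift stay (sp b, left) (e, stay) (mark, left)
  | shift_end (x y e) :
      Rule shift x y e leftEnd top stay (y, stay) (e, stay) (leftEnd, right)
  | vertical (a b e c) :
      Rule top (sp a) (sp b) e c (add .vertical (a == b)) stay (sp b, stay) (e, stay) (c, stay)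
  | no_vertical (a e) :
      Rule top (sp a) leftEnd e mark (next a) right (leftEnd, stay) (e, stay) (mark, right)
  | mid (a b e) : Rule mid (sp a) (sp b) e mark (next a) right (sp b, left) (e, stay) (mark, right)
  | horizontal (a b y e) :
      Rule (next a) (sp b) y e mark (add .horizontal (a == b)) stay (y, stay) (e, stay) (mark, stay)
  | row_end (a b y e) :
      Rule (next a) (sp b) y e blank reset stay (y, stay) (e, stay) (blank, left)
  | reset (x y e) : Rule reset x y e mark reset stay (y, stay) (e, stay) (mark, left)
  | reset_end (x y e) : Rule reset x y e leftEnd top stay (y, stay) (e, stay) (leftEnd, right)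
  | last (a y e) :
      Rule (next a) (letter .bullet) y e blank compare stay (y, stay) (e, stay) (blank, stay)
  | add_inc (r s x y c) :
      Rule (add r s) x y (sign s) c (inc r) stay (y, stay) (sign s, right) (c, stay)
  | add_dec (r s s' x y c) : s' = !s →
      Rule (add r s) x y (sign s') c (dec r) stay (y, stay) (sign s', right) (c, stay)
  | inc_true (r x y c) :
      Rule (inc r) x y (digit true) c (inc r) stay (y, stay) (digit false, right) (c, stay)
  | inc_false (r x y c) :
      Rule (inc r) x y (digit false) c (rewind r) stay (y, stay) (digit true, left) (c, stay)
  | inc_blank (r x y c) :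
      Rule (inc r) x y blank c (rewind r) stay (y, stay) (digit true, left) (c, stay)
  | dec_false (r x y c) :
      Rule (dec r) x y (digit false) c (dec r) stay (y, stay) (digit true, right) (c, stay)
  | dec_true (r x y c) :
      Rule (dec r) x y (digit true) c (rewind r) stay (y, stay) (digit false, left) (c, stay)
  | dec_blank (r x y c) :
      Rule (dec r) x y blank c (undo r) stay (y, stay) (blank, left) (c, stay)
  | dec_right (r x y c) :
      Rule (dec r) x y rightEnd c (undo r) stay (y, stay) (rightEnd, left) (c, stay)
  | undo (r x y c) :
      Rule (undo r) x y (digit true) c (undo r) stay (y, stay) (digit false, left) (c, stay)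
  | undo_end (r s x y c) :
      Rule (undo r) x y (sign s) c (inc r) stay (y, stay) (sign !s, right) (c, stay)
  | rewind (r b x y c) :
      Rule (rewind r) x y (digit b) c (rewind r) stay (y, stay) (digit b, left) (c, stay)
  | rewind_end (r s x y c) :
      Rule (rewind r) x y (sign s) c r.state stay (y, stay) (sign s, stay) (c, stay)
  | compare (y e c) :
      Rule compare (letter .bullet) y e c (read none) right (y, stay) (e, stay) (c, stay)
  | read (o neg l y e c) : o ≠ some (!neg) → l = signLetter neg →
      Rule (read o) (letter l) y e c (add (.read neg) (!neg))
        right (y, stay) (e, stay) (c, stay)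
  | read_end (o y s c) :
      Rule (read o) rightEnd y (sign s) c zero stay (y, stay) (sign s, right) (c, stay)
  | zero (x y c) :
      Rule zero x y (digit false) c zero stay (y, stay) (digit false, right) (c, stay)
  | zero_blank (x y c) : Rule zero x y blank c accept stay (y, stay) (blank, stay) (c, stay)
  | zero_right (x y c) :
      Rule zero x y rightEnd c accept stay (y, stay) (rightEnd, stay) (c, stay)

theorem signLetter_inj {a b : Bool} : signLetter a = signLetter b ↔ a = b := by
  cases a <;> cases b <;> simp [signLetter]

theorem Rule.deterministic {q x y e c q₁ mx ty te tc q₂ mx' ty' te' tc'}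
    (h₁ : Rule q x y e c q₁ mx ty te tc) (h₂ : Rule q x y e c q₂ mx' ty' te' tc') :
    q₁ = q₂ ∧ mx = mx' ∧ ty = ty' ∧ te = te' ∧ tc = tc' := by
  cases h₁ <;> cases h₂ <;> simp_all [signLetter_inj]

/-- The transition respects the endmarker on one tape. -/
def Respects (a b : Cell) (d : Move) : Prop :=
  (a = leftEnd → b = leftEnd ∧ d ≠ left) ∧ (a = rightEnd → b = rightEnd ∧ d ≠ right)

theorem Rule.respects {q x y e c q' mx y' my e' me c' mc}
    (h : Rule q x y e c q' mx (y', my) (e', me) (c', mc)) :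
    Respects x x mx ∧ Respects y y' my ∧ Respects e e' me ∧ Respects c c' mc := by
  cases h <;> simp [Respects]

end SquareLBA

end Ising

/-! ### The automaton, its tapes and its configurations -/

namespace Ising.SquareLBA

open Cell State Move

/-- The automaton. -/
def machine : LBA Letter where
  State := State
  Sym := Cell
  finite_State := inferInstance
  finite_Sym := inferInstance
  work := 3
  letter := .letter
  letter_injective _ _ h := by simpa using h
  blank := .blank
  leftEnd := .leftEnd
  rightEnd := .rightEnd
  letter_ne := by simp
  blank_ne := by simp
  ends_ne := by simp
  δ := {p | Rule p.1.1 (p.1.2 0) (p.1.2 1) (p.1.2 2) (p.1.2 3) p.2.1 (p.2.2.2 0)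
    (p.2.2.1 1, p.2.2.2 1) (p.2.2.1 2, p.2.2.2 2) (p.2.2.1 3, p.2.2.2 3) ∧ p.2.2.1 0 = p.1.2 0}
  left_end := by
    rintro q a q' b d ⟨h, h0⟩ t
    obtain ⟨h1, h2, h3, h4⟩ := h.respects
    match t with
    | 0 => exact fun h => ⟨h0.trans h, (h1.1 h).2⟩
    | 1 => exact h2.1
    | 2 => exact h3.1
    | 3 => exact h4.1
  right_end := by
    rintro q a q' b d ⟨h, h0⟩ t
    obtain ⟨h1, h2, h3, h4⟩ := h.respects
    match t with
    | 0 => exact fun h => ⟨h0.trans h, (h1.2 h).2⟩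
    | 1 => exact h2.2
    | 2 => exact h3.2
    | 3 => exact h4.2
  start := .pre0
  accept := {.accept}

theorem machine_deterministic (a b c : machine.Config) (h₁ : machine.Step a b)
    (h₂ : machine.Step a c) : b = c := by
  obtain ⟨b₁, d₁, ⟨h1, h1'⟩, h2, h3⟩ := h₁
  obtain ⟨b₂, d₂, ⟨h4, h4'⟩, h5, h6⟩ := h₂
  obtain ⟨g1, g2, g3, g4, g5⟩ := h1.deterministic h4
  have hb : b₁ = b₂ := by
    funext t
    match t with
    | 0 => exact h1'.trans h4'.symm
    | 1 => exact congrArg Prod.fst g3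
    | 2 => exact congrArg Prod.fst g4
    | 3 => exact congrArg Prod.fst g5
  have hd : d₁ = d₂ := by
    funext t
    match t with
    | 0 => exact g2
    | 1 => exact congrArg Prod.snd g3
    | 2 => exact congrArg Prod.snd g4
    | 3 => exact congrArg Prod.snd g5
  cases b
  cases c
  simp only at g1 h2 h3 h5 h6
  subst g1 hb hd h2 h3 h5 h6
  rfl

/-- A tape that begins with the given symbols. -/
def tape (L : ℕ) (l : List Cell) (p : ℕ) : Cell :=
  if p = 0 then leftEnd else if L < p then rightEnd else (l[p - 1]?).getD blank

section tape

variable {L : ℕ}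

theorem tape_right (l : List Cell) {p : ℕ} (h : L < p) : tape L l p = rightEnd := by
  rw [tape, if_neg (by omega), if_pos h]

theorem tape_of_getElem? {l : List Cell} {p : ℕ} {a : Cell} (h : l[p]? = some a) (hp : p < L) :
    tape L l (p + 1) = a := by
  rw [tape, if_neg (by omega), if_neg (by omega), Nat.add_sub_cancel, h, Option.getD_some]

theorem tape_blank {l : List Cell} {p : ℕ} (h : l.length < p) (hp : p ≤ L) :
    tape L l p = blank := by
  rw [tape, if_neg (by omega), if_neg (by omega), List.getElem?_eq_none (by omega),
    Option.getD_none]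

theorem tape_append (u : List Cell) (a : Cell) (v : List Cell) (hp : u.length < L) :
    tape L (u ++ a :: v) (u.length + 1) = a :=
  tape_of_getElem? (by simp) hp

theorem update_tape (u : List Cell) (a b : Cell) (v : List Cell) (hp : u.length < L) :
    Function.update (tape L (u ++ a :: v)) (u.length + 1) b = tape L (u ++ b :: v) := by
  funext p
  by_cases h : p = u.length + 1
  · subst h
    rw [Function.update_self, tape_append _ _ _ hp]
  · rw [Function.update_of_ne h]
    unfold tape
    split_ifs with h1 h2
    · rfl
    · rfl
    · congr 1
      rcases lt_or_ge (p - 1) u.length with h3 | h3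
      · rw [List.getElem?_append_left h3, List.getElem?_append_left h3]
      · obtain ⟨k, hk⟩ : ∃ k, p - 1 - u.length = k + 1 := ⟨p - 1 - u.length - 1, by omega⟩
        rw [List.getElem?_append_right h3, List.getElem?_append_right h3, hk,
          List.getElem?_cons_succ, List.getElem?_cons_succ]

/-- Unlisted cells are blank, so writing behind the end of the list extends it. -/
theorem update_tape_end (u : List Cell) (b : Cell) (hp : u.length < L) :
    Function.update (tape L u) (u.length + 1) b = tape L (u ++ [b]) := by
  have : tape L u = tape L (u ++ [blank]) := by
    funext p
    unfold tape
    split_ifs with h1 h2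
    · rfl
    · rfl
    · rcases lt_trichotomy (p - 1) u.length with h3 | h3 | h3
      · rw [List.getElem?_append_left h3]
      · rw [h3]; simp
      · rw [List.getElem?_eq_none h3.le, List.getElem?_eq_none (by simp; omega)]
  rw [this, update_tape u _ _ _ hp]

theorem map_tape (l : List Cell) (h : l.length ≤ L) :
    (List.range L).map (fun p => tape L l (p + 1)) = l ++ List.replicate (L - l.length) blank := by
  refine List.ext_getElem (by simp; omega) fun p h1 h2 => ?_
  simp only [List.length_map, List.length_range] at h1
  simp only [List.getElem_map, List.getElem_range]
  rw [tape, if_neg (by omega), if_neg (by omega), Nat.add_sub_cancel]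
  rcases lt_or_ge p l.length with h3 | h3
  · rw [List.getElem_append_left h3, List.getElem?_eq_getElem h3, Option.getD_some]
  · rw [List.getElem_append_right h3, List.getElem?_eq_none h3, Option.getD_none,
      List.getElem_replicate]

end tape

/-- The configuration with input `w`, the given state and head positions, and the given contents of
the work tapes. -/
def config (w : List Letter) (q : State) (x y e c : ℕ) (ly le lc : List Cell) : machine.Config where
  state := q
  head := ![x, y, e, c]
  tape := ![tape w.length (w.map .letter), tape w.length ly, tape w.length le, tape w.length lc]

theorem init_eq (w : List Letter) : machine.init w = config w pre0 1 1 1 1 [] [] [] := by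
  have h0 : ∀ p, (if p = 0 then leftEnd else if w.length < p then rightEnd else
      ((w[p - 1]?).map Cell.letter).getD blank) = tape w.length (w.map .letter) p := by
    simp [tape]
  have h1 : ∀ p, (if p = 0 then leftEnd else if w.length < p then rightEnd else blank) =
      tape w.length [] p := by
    simp [tape]
  unfold LBA.init config
  congr 1
  · funext t
    match t with
    | 0 | 1 | 2 | 3 => rfl
  · funext t p
    match t with
    | 0 => exact h0 p
    | 1 | 2 | 3 => exact h1 p

/-- The interface to the transition relation: one rule, four symbols read, four new positions, three
tapes written. The input tape never changes. -/
theorem step_config {w : List Letter} {q q' : State} {x y e c x' y' e' c' : ℕ}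
    {ly le lc ly' le' lc' : List Cell} {sx sy se sc by' be bc : Cell} {mx my me mc : Move}
    (h : Rule q sx sy se sc q' mx (by', my) (be, me) (bc, mc))
    (rx : tape w.length (w.map .letter) x = sx) (ry : tape w.length ly y = sy)
    (re : tape w.length le e = se) (rc : tape w.length lc c = sc)
    (hx : mx.apply x = x') (hy : my.apply y = y') (he : me.apply e = e') (hc : mc.apply c = c')
    (uy : Function.update (tape w.length ly) y by' = tape w.length ly')
    (ue : Function.update (tape w.length le) e be = tape w.length le')
    (uc : Function.update (tape w.length lc) c bc = tape w.length lc') :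
    machine.Step (config w q x y e c ly le lc) (config w q' x' y' e' c' ly' le' lc') := by
  subst rx ry re rc hx hy he hc
  refine ⟨![tape w.length (w.map .letter) x, by', be, bc], ![mx, my, me, mc], ⟨h, rfl⟩, ?_, ?_⟩
  · funext t
    match t with
    | 0 | 1 | 2 | 3 => rfl
  · funext t
    match t with
    | 0 => exact (Function.update_eq_self _ _).symm
    | 1 => exact uy.symm
    | 2 => exact ue.symm
    | 3 => exact uc.symm

theorem rule_of_step {w : List Letter} {q : State} {x y e c : ℕ} {ly le lc : List Cell}
    {d : machine.Config} (h : machine.Step (config w q x y e c ly le lc) d) :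
    ∃ mx ty te tc, Rule q (tape w.length (w.map .letter) x) (tape w.length ly y)
      (tape w.length le e) (tape w.length lc c) d.state mx ty te tc := by
  obtain ⟨b, d, ⟨h, -⟩, -, -⟩ := h
  exact ⟨_, _, _, _, h⟩

/-- The bookkeeping: binary digits and signs, the states in which the addition for an edge begins, and
the state in which the comparison begins. -/
def marking : machine.Marking where
  energyTape := (2 : Fin 4)
  energyTape_ne := show (2 : Fin 4) ≠ 0 by decide
  digit := Cell.digit
  digit_injective _ _ := Cell.digit.inj
  digit_ne_blank _ := by simp [machine]
  sign := Cell.sign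
  sign_injective _ _ := Cell.sign.inj
  add
    | .add _ _ => true
    | _ => false
  compare
    | .compare => true
    | _ => false

/-- The value of a list of binary digits. -/
def value (v : List Bool) : ℕ := Nat.ofDigits 2 (v.map Bool.toNat)

/-- The integer with the given sign and binary digits. -/
def energy (s : Bool) (v : List Bool) : ℤ := (if s then -1 else 1) * value v

/-- The contents of the energy tape. -/
def digits (s : Bool) (v : List Bool) : List Cell := sign s :: v.map digit

theorem holds_config {w : List Letter} {q : State} {x y e c : ℕ} {ly lc : List Cell} {s : Bool}
    {v : List Bool} (h : v.length + 1 ≤ w.length) :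
    marking.Holds w.length (config w q x y e c ly (digits s v) lc) (energy s v) := by
  refine ⟨s, v, _, (map_tape (digits s v) ?_).trans rfl, ?_⟩
  · simpa [digits] using h
  · simp [energy, value, Nat.coe_ofDigits]

/-- Computations of the automaton. -/
abbrev Run : machine.Config → List machine.Config → machine.Config → Prop :=
  Path machine.Step (fun c => marking.add c.state) (fun c => marking.compare c.state)

/-! Additions -/

theorem value_cons (b : Bool) (v : List Bool) : value (b :: v) = b.toNat + 2 * value v := by
  simp [value, Nat.ofDigits_cons]

theorem value_replicate (n : ℕ) : value (List.replicate n false) = 0 := by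
  induction n with
  | zero => rfl
  | succ n ih => rw [List.replicate_succ, value_cons, ih]; rfl

/-- Addition of `1`. -/
def incr : List Bool → List Bool
  | [] => [true]
  | false :: v => true :: v
  | true :: v => false :: incr v

/-- Subtraction of `1`. -/
def decr : List Bool → Option (List Bool)
  | [] => none
  | false :: v => (decr v).map (true :: ·)
  | true :: v => some (false :: v)

theorem value_incr (v : List Bool) : value (incr v) = value v + 1 := by
  induction v with
  | nil => rfl
  | cons b v ih =>
    cases b
    · simp [incr, value_cons]; omega
    · simp only [incr, value_cons, ih, Bool.toNat_false, Bool.toNat_true]; omega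

/-- A digit is added only if the carry runs through ones alone. This gives the space bound: below `2
^ n`, the incremented number still fits into `n` digits. -/
theorem length_incr (v : List Bool) :
    (incr v).length = v.length ∨ ((incr v).length = v.length + 1 ∧ value v + 1 = 2 ^ v.length) := by
  induction v with
  | nil => exact .inr ⟨rfl, rfl⟩
  | cons b v ih =>
    cases b
    · exact .inl rfl
    · simp only [incr, value_cons, List.length_cons, Bool.toNat_true, pow_succ]
      omega

theorem length_incr_le {v : List Bool} {n : ℕ} (h : v.length ≤ n) (hv : value v + 1 < 2 ^ n) :
    (incr v).length ≤ n := by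
  obtain h1 | ⟨h1, h2⟩ := length_incr v
  · omega
  · rcases h.lt_or_eq with h3 | rfl <;> omega

theorem decr_some {v v' : List Bool} (h : decr v = some v') :
    value v = value v' + 1 ∧ v'.length = v.length := by
  induction v generalizing v' with
  | nil => simp [decr] at h
  | cons b v ih =>
    cases b
    · obtain ⟨u, hu, rfl⟩ := Option.map_eq_some_iff.1 h
      obtain ⟨h1, h2⟩ := ih hu
      simp [value_cons, h1, h2]; omega
    · obtain rfl : false :: v = v' := by simpa [decr] using h
      simp [value_cons]; omega

/-- The borrow runs off the end only from zero, possibly written with many digits. -/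
theorem decr_none {v : List Bool} (h : decr v = none) : v = List.replicate v.length false := by
  induction v with
  | nil => rfl
  | cons b v ih =>
    cases b
    · rw [List.length_cons, List.replicate_succ, ← ih (by simpa [decr] using h)]
    · simp [decr] at h

end Ising.SquareLBA

namespace Ising.SquareLBA

open Cell State Move

section add

variable {L : ℕ} {s : Bool}

theorem digits_append (u v : List Bool) : digits s (u ++ v) = digits s u ++ v.map digit := by
  simp [digits]

theorem length_digits (u : List Bool) : (digits s u).length = u.length + 1 := by
  simp [digits]

theorem tape_digits (u : List Bool) (a : Bool) (v : List Bool) (h : u.length + 1 < L) :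
    tape L (digits s (u ++ a :: v)) (u.length + 2) = digit a := by
  have := tape_append (digits s u) (digit a) (v.map digit) (L := L) (by rwa [length_digits])
  rw [length_digits] at this
  rw [digits_append]
  exact this

theorem update_digits (u : List Bool) (a b : Bool) (v : List Bool) (h : u.length + 1 < L) :
    Function.update (tape L (digits s (u ++ a :: v))) (u.length + 2) (digit b) =
      tape L (digits s (u ++ b :: v)) := by
  have := update_tape (digits s u) (digit a) (digit b) (v.map digit) (L := L)
    (by rwa [length_digits])
  rw [length_digits] at this
  rw [digits_append, digits_append]
  exact this

theorem tape_digits_end (u : List Bool) (h : u.length + 1 < L) :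
    tape L (digits s u) (u.length + 2) = blank :=
  tape_blank (by rw [length_digits]; omega) h

theorem update_digits_end (u : List Bool) (b : Bool) (h : u.length + 1 < L) :
    Function.update (tape L (digits s u)) (u.length + 2) (digit b) =
      tape L (digits s (u ++ [b])) := by
  have := update_tape_end (digits s u) (digit b) (L := L) (by rwa [length_digits])
  rw [length_digits] at this
  rw [digits_append]
  exact this

theorem tape_sign (v : List Bool) (h : 0 < L) : tape L (digits s v) 1 = sign s :=
  tape_append [] (sign s) (v.map digit) h

theorem update_sign (v : List Bool) (s' : Bool) (h : 0 < L) :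
    Function.update (tape L (digits s v)) 1 (sign s') = tape L (digits s' v) :=
  update_tape [] (sign s) (sign s') (v.map digit) h

variable {w : List Letter} {x y c : ℕ} {ly lc : List Cell}

/-- A step in which only the head on the energy tape acts. -/
theorem step_energy {q q' : State} {e e' : ℕ} {le le' : List Cell} {se be : Cell} {me : Move}
    (h : ∀ sx sy sc, Rule q sx sy se sc q' stay (sy, stay) (be, me) (sc, stay))
    (re : tape w.length le e = se) (he : me.apply e = e')
    (ue : Function.update (tape w.length le) e be = tape w.length le') :
    machine.Step (config w q x y e c ly le lc) (config w q' x y e' c ly le' lc) :=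
  step_config (h _ _ _) rfl rfl re rfl rfl rfl he rfl (Function.update_eq_self _ _) ue
    (Function.update_eq_self _ _)

/-- `u` consists of the digits up to the head, the last of them scanned, and `v` of the digits to
its right; hence the induction from the right end of `u`. -/
theorem run_rewind (r : Ret) (u : List Bool) : ∀ v : List Bool, u.length + v.length + 1 ≤ w.length →
    Run (config w (.rewind r) x y (u.length + 1) c ly (digits s (u ++ v)) lc) []
      (config w r.state x y 1 c ly (digits s (u ++ v)) lc) := by
  induction u using List.reverseRecOn with
  | nil =>
    intro v h
    refine .single rfl rfl (step_energy (fun _ _ _ => .rewind_end r s _ _ _) ?_ rfl ?_)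
    · exact tape_sign v (by omega)
    · exact update_sign v s (by omega)
  | append_singleton u a ih =>
    intro v h
    simp only [List.length_append, List.length_singleton, List.append_assoc, List.singleton_append]
      at h ⊢
    have h1 : u.length + 1 < w.length := by omega
    refine .trans (.single rfl rfl (step_energy (e' := u.length + 1)
      (fun _ _ _ => .rewind r a _ _ _) (tape_digits u a v h1) rfl (update_digits u a a v h1)))
      (ih (a :: v) (by simp; omega))

theorem run_inc (r : Ret) (v : List Bool) : ∀ u : List Bool,
    u.length + (incr v).length + 1 ≤ w.length →
    Run (config w (.inc r) x y (u.length + 2) c ly (digits s (u ++ v)) lc) []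
      (config w r.state x y 1 c ly (digits s (u ++ incr v)) lc) := by
  induction v with
  | nil =>
    intro u h
    simp only [incr, List.length_singleton] at h
    rw [List.append_nil]
    exact .trans (.single rfl rfl (step_energy (e' := u.length + 1) (fun _ _ _ => .inc_blank r _ _ _)
      (tape_digits_end u (by omega)) rfl (update_digits_end u true (by omega))))
      (run_rewind r u [true] (by simp; omega))
  | cons b v ih =>
    intro u h
    cases b with
    | false =>
      simp only [incr, List.length_cons] at h
      exact .trans (.single rfl rfl (step_energy (e' := u.length + 1)
        (fun _ _ _ => .inc_false r _ _ _)
        (tape_digits u false v (by omega)) rfl (update_digits u false true v (by omega))))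
        (run_rewind r u (true :: v) (by simp; omega))
    | true =>
      simp only [incr, List.length_cons] at h
      have := ih (u ++ [false]) (by simp; omega)
      simp only [List.length_append, List.length_singleton, List.append_assoc,
        List.singleton_append] at this
      exact .trans (.single rfl rfl (step_energy (e' := u.length + 1 + 2)
        (fun _ _ _ => .inc_true r _ _ _)
        (tape_digits u true v (by omega)) rfl (update_digits u true false v (by omega)))) this

theorem run_dec (r : Ret) (v : List Bool) : ∀ u v' : List Bool, decr v = some v' →
    u.length + v.length + 1 ≤ w.length →
    Run (config w (.dec r) x y (u.length + 2) c ly (digits s (u ++ v)) lc) []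
      (config w r.state x y 1 c ly (digits s (u ++ v')) lc) := by
  induction v with
  | nil => simp [decr]
  | cons b v ih =>
    intro u v' hv h
    cases b with
    | true =>
      obtain rfl : false :: v = v' := by simpa [decr] using hv
      simp only [List.length_cons] at h
      exact .trans (.single rfl rfl (step_energy (e' := u.length + 1)
        (fun _ _ _ => .dec_true r _ _ _)
        (tape_digits u true v (by omega)) rfl (update_digits u true false v (by omega))))
        (run_rewind r u (false :: v) (by simp; omega))
    | false =>
      obtain ⟨v', hv', rfl⟩ := Option.map_eq_some_iff.1 hv
      simp only [List.length_cons] at h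
      have := ih (u ++ [true]) v' hv' (by simp; omega)
      simp only [List.length_append, List.length_singleton, List.append_assoc,
        List.singleton_append] at this
      exact .trans (.single rfl rfl (step_energy (e' := u.length + 1 + 2)
        (fun _ _ _ => .dec_false r _ _ _)
        (tape_digits u false v (by omega)) rfl (update_digits u false true v (by omega)))) this

theorem run_undo (r : Ret) (i : ℕ) : ∀ v : List Bool, i + v.length + 1 ≤ w.length →
    Run (config w (.undo r) x y (i + 1) c ly (digits s (List.replicate i true ++ v)) lc) []
      (config w (.inc r) x y 2 c ly (digits (!s) (List.replicate i false ++ v)) lc) := by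
  induction i with
  | zero =>
    intro v h
    refine .single rfl rfl (step_energy (fun _ _ _ => .undo_end r s _ _ _) ?_ rfl ?_)
    · exact tape_sign v (by omega)
    · exact update_sign v (!s) (by omega)
  | succ i ih =>
    intro v h
    have h1 := tape_digits (s := s) (L := w.length) (List.replicate i true) true v (by simp; omega)
    have h2 := update_digits (s := s) (L := w.length) (List.replicate i true) true false v
      (by simp; omega)
    have h3 := ih (false :: v) (by simp; omega)
    simp only [List.length_replicate] at h1 h2
    have h4 : ∀ b : Bool, List.replicate (i + 1) b ++ v = List.replicate i b ++ b :: v := by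
      intro b
      rw [List.replicate_succ', List.append_assoc, List.singleton_append]
    rw [h4, h4]
    exact .trans (.single rfl rfl (step_energy (e' := i + 1) (fun _ _ _ => .undo r _ _ _)
      h1 rfl h2)) h3

/-- Decrementing zero: the borrow turns every digit into a one before the failure shows. The way
back restores the zeros and flips the sign, and an increment of the absolute value then completes
the addition. -/
theorem run_dec_zero (r : Ret) (k : ℕ) : ∀ i : ℕ, i + k + 1 ≤ w.length →
    Run (config w (.dec r) x y (i + 2) c ly
        (digits s (List.replicate i true ++ List.replicate k false)) lc) []
      (config w (.inc r) x y 2 c ly (digits (!s) (List.replicate (i + k) false)) lc) := by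
  induction k with
  | zero =>
    intro i h
    have h2 := run_undo (s := s) (x := x) (y := y) (c := c) (ly := ly) (lc := lc) r i [] h
    simp only [List.replicate_zero, List.append_nil] at h2 ⊢
    refine .trans (.single rfl rfl ?_) h2
    -- If the digits fill the tape, the head finds the right endmarker in place of a blank.
    rcases (show i + 1 ≤ w.length from h).lt_or_eq with h | h
    · have h1 := tape_digits_end (s := s) (L := w.length) (List.replicate i true) (by simpa using h)
      rw [List.length_replicate] at h1
      exact step_energy (fun _ _ _ => .dec_blank r _ _ _) h1 rfl
        (by rw [← h1, Function.update_eq_self])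
    · have h1 := tape_right (L := w.length) (digits s (List.replicate i true)) (p := i + 2)
        (by omega)
      exact step_energy (fun _ _ _ => .dec_right r _ _ _) h1 rfl
        (by rw [← h1, Function.update_eq_self])
  | succ k ih =>
    intro i h
    have h1 := tape_digits (s := s) (L := w.length) (List.replicate i true) false
      (List.replicate k false) (by simp; omega)
    have h2 := update_digits (s := s) (L := w.length) (List.replicate i true) false true
      (List.replicate k false) (by simp; omega)
    have h3 := ih (i + 1) (by omega)
    simp only [List.length_replicate] at h1 h2
    rw [List.replicate_succ', List.append_assoc, List.singleton_append,
      show i + 1 + k = i + (k + 1) by omega] at h3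
    rw [List.replicate_succ (n := k)]
    exact .trans (.single rfl rfl (step_energy (e' := i + 1 + 2) (fun _ _ _ => .dec_false r _ _ _)
      h1 rfl h2)) h3

/-- Addition of `1` or `-1` on the energy tape. -/
theorem exists_run_add (r : Ret) (neg s : Bool) (v : List Bool) (hv : v.length + 1 ≤ w.length)
    (hlt : |energy s v| + 1 < 2 ^ (w.length - 1)) :
    ∃ s' v', energy s' v' = energy s v + (if neg then -1 else 1) ∧ v'.length + 1 ≤ w.length ∧
      Run (config w (.add r neg) x y 1 c ly (digits s v) lc)
        [config w (.add r neg) x y 1 c ly (digits s v) lc]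
        (config w r.state x y 1 c ly (digits s' v') lc) := by
  -- One of the `w.length` cells holds the sign, which leaves `w.length - 1` digits.
  have hlt' : value v + 1 < 2 ^ (w.length - 1) := by
    have h1 : |energy s v| = value v := by cases s <;> simp [energy]
    rw [h1] at hlt
    exact_mod_cast hlt
  have h0 : 0 < w.length := by omega
  have hinc : ∀ {u}, u.length + 1 ≤ w.length → value u + 1 < 2 ^ (w.length - 1) →
      (incr u).length + 1 ≤ w.length := by
    intro u h1 h2
    have := length_incr_le (n := w.length - 1) (by omega) h2
    omega
  -- With equal signs the absolute value grows. Otherwise it shrinks, unless it is zero; then the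
  -- sign changes and the absolute value becomes 1.
  by_cases hs : s = neg
  · subst hs
    refine ⟨s, incr v, ?_, hinc hv hlt', ?_⟩
    · cases s <;> simp [energy, value_incr]
      ring
    · have := run_inc (w := w) (s := s) (x := x) (y := y) (c := c) (ly := ly) (lc := lc) r v []
        (by simpa using hinc hv hlt')
      exact .trans (.single_mark rfl rfl (step_energy (fun _ _ _ => .add_inc r s _ _ _)
        (tape_sign v h0) rfl (update_sign v s h0))) this
  · obtain rfl : neg = !s := by cases s <;> cases neg <;> simp_all
    have hstep : machine.Step (config w (.add r !s) x y 1 c ly (digits s v) lc)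
        (config w (.dec r) x y 2 c ly (digits s v) lc) :=
      step_energy (fun _ _ _ => .add_dec r (!s) s _ _ _ (by simp))
        (tape_sign v h0) rfl (update_sign v s h0)
    cases hd : decr v with
    | some v' =>
      obtain ⟨h1, h2⟩ := decr_some hd
      refine ⟨s, v', ?_, by omega, ?_⟩
      · cases s <;> simp [energy, h1]
      · exact .trans (.single_mark rfl rfl hstep) (run_dec r v [] v' hd (by simpa using hv))
    | none =>
      have hz := decr_none hd
      have hlen : (incr v).length + 1 ≤ w.length := hinc hv hlt'
      refine ⟨!s, incr v, ?_, hlen, ?_⟩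
      · have h1 : value v = 0 := by rw [hz, value_replicate]
        cases s <;> simp [energy, value_incr, h1]
      · have h1 := run_dec_zero (s := s) (w := w) (x := x) (y := y) (c := c) (ly := ly) (lc := lc)
          r v.length 0 (by omega)
        rw [List.replicate_zero, List.nil_append, Nat.zero_add v.length, ← hz] at h1
        have h2 := run_inc (w := w) (s := !s) (x := x) (y := y) (c := c) (ly := ly) (lc := lc) r v []
          (by simpa using hlen)
        exact .trans (.single_mark rfl rfl hstep) (h1.trans h2)

end add

end Ising.SquareLBA

namespace Ising.SquareLBA

open Cell State Move

/-- The input tape. -/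
abbrev inputTape (w : List Letter) : ℕ → Cell := tape w.length (w.map .letter)

/-- The contents of the counter tape. -/
abbrev marks (m : ℕ) : List Cell := List.replicate m mark

theorem le_length_of_inputTape {w : List Letter} {p : ℕ} {a : Letter}
    (h : inputTape w p = letter a) : 1 ≤ p ∧ p ≤ w.length := by
  unfold inputTape tape at h
  split_ifs at h with h1 h2
  omega

section marks

variable {L m : ℕ}

theorem tape_marks {j : ℕ} (h1 : 1 ≤ j) (hj : j ≤ m) (hm : m ≤ L) : tape L (marks m) j = mark := by
  obtain ⟨j, rfl⟩ : ∃ i, j = i + 1 := ⟨j - 1, by omega⟩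
  exact tape_of_getElem? (by rw [List.getElem?_replicate, if_pos (by omega)]) (by omega)

theorem tape_marks_end (hm : m + 1 ≤ L) : tape L (marks m) (m + 1) = blank :=
  tape_blank (by simp) hm

theorem update_marks (hm : m + 1 ≤ L) :
    Function.update (tape L (marks m)) (m + 1) mark = tape L (marks (m + 1)) := by
  have := update_tape_end (L := L) (marks m) mark (by simpa using hm)
  rw [List.length_replicate] at this
  rw [this, ← List.replicate_succ']

theorem update_tape_self {l : List Cell} {p : ℕ} {a : Cell} (h : tape L l p = a) :
    Function.update (tape L l) p a = tape L l := by
  rw [← h, Function.update_eq_self]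

end marks

/-! Counting the spins -/

section count

variable {w : List Letter}

/-- The configurations in which the spins are counted. -/
abbrev zag (w : List Letter) (q : State) (x m j : ℕ) : machine.Config :=
  config w q x 1 1 j [] (digits false []) (marks m)

theorem step_pre0 {a : Bool} (h : inputTape w 1 = sp a) :
    machine.Step (machine.init w) (zag w pre1 2 1 2) := by
  have h1 := (le_length_of_inputTape h).2
  rw [init_eq]
  refine step_config (.pre0 a _) h rfl (tape_blank (by simp) h1) (tape_blank (by simp) h1)
    rfl rfl rfl rfl (Function.update_eq_self _ _) ?_ ?_
  · exact update_tape_end [] _ h1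
  · exact update_tape_end [] _ h1

theorem step_pre1 {a : Bool} (h : inputTape w 2 = sp a) :
    machine.Step (zag w pre1 2 1 2) (zag w pre2 3 2 3) := by
  have h1 := (le_length_of_inputTape h).2
  exact step_config (.pre1 a _ _) h rfl rfl (tape_marks_end h1)
    rfl rfl rfl rfl (Function.update_eq_self _ _) (Function.update_eq_self _ _) (update_marks h1)

theorem step_pre2 {a : Bool} (h : inputTape w 3 = sp a) :
    machine.Step (zag w pre2 3 2 3) (zag w pre3 4 2 3) :=
  step_config (.pre2 a _ _ _) h rfl rfl rfl rfl rfl rfl rfl (Function.update_eq_self _ _)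
    (Function.update_eq_self _ _) (Function.update_eq_self _ _)

theorem step_pre3 {a : Bool} (h : inputTape w 4 = sp a) :
    machine.Step (zag w pre3 4 2 3) (zag w zagRight 5 2 3) :=
  step_config (.pre3 a _ _ _) h rfl rfl rfl rfl rfl rfl rfl (Function.update_eq_self _ _)
    (Function.update_eq_self _ _) (Function.update_eq_self _ _)

theorem step_right_mark {a : Bool} {x m j : ℕ} (h : inputTape w x = sp a) (h1 : 1 ≤ j) (hj : j ≤ m)
    (hm : m ≤ w.length) : machine.Step (zag w zagRight x m j) (zag w zagRight (x + 1) m (j + 1)) :=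
  step_config (.right_mark a _ _) h rfl rfl (tape_marks h1 hj hm) rfl rfl rfl rfl
    (Function.update_eq_self _ _) (Function.update_eq_self _ _)
    (update_tape_self (tape_marks h1 hj hm))

theorem step_right_blank {a : Bool} {x m : ℕ} (h : inputTape w x = sp a) (hm : m + 1 ≤ w.length) :
    machine.Step (zag w zagRight x m (m + 1)) (zag w zagLeft x (m + 1) m) :=
  step_config (.right_blank a _ _) h rfl rfl (tape_marks_end hm) rfl rfl rfl rfl
    (Function.update_eq_self _ _) (Function.update_eq_self _ _) (update_marks hm)

theorem step_left_mark {a : Bool} {x m j : ℕ} (h : inputTape w x = sp a) (hj : j + 1 ≤ m)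
    (hm : m ≤ w.length) : machine.Step (zag w zagLeft x m (j + 1)) (zag w zagLeft (x + 1) m j) :=
  step_config (.left_mark a _ _) h rfl rfl (tape_marks (by omega) hj hm) rfl rfl rfl rfl
    (Function.update_eq_self _ _) (Function.update_eq_self _ _)
    (update_tape_self (tape_marks (by omega) hj hm))

theorem step_left_end {x m : ℕ} : machine.Step (zag w zagLeft x m 0) (zag w zagRight x m 1) :=
  step_config (.left_end _ _ _) rfl rfl rfl rfl rfl rfl rfl rfl
    (Function.update_eq_self _ _) (Function.update_eq_self _ _) (Function.update_eq_self _ _)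

theorem step_square {x m : ℕ} (h : inputTape w (x + 1) = letter .bullet) (hm : m + 1 ≤ w.length) :
    machine.Step (zag w zagRight (x + 1) m (m + 1)) (zag w copy x m m) :=
  step_config (.square _ _) h rfl rfl (tape_marks_end hm) rfl rfl rfl rfl
    (Function.update_eq_self _ _) (Function.update_eq_self _ _)
    (update_tape_self (tape_marks_end hm))

theorem run_right {m : ℕ} (hm : m ≤ w.length) (i : ℕ) : ∀ x j, j + i = m + 1 → 1 ≤ j →
    (∀ p, x ≤ p → p < x + i → ∃ a, inputTape w p = sp a) →
    Run (zag w zagRight x m j) [] (zag w zagRight (x + i) m (m + 1)) := by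
  induction i with
  | zero =>
    rintro x j rfl _ _
    exact .refl _
  | succ i ih =>
    intro x j h1 h2 h3
    obtain ⟨a, ha⟩ := h3 x le_rfl (by omega)
    have := ih (x + 1) (j + 1) (by omega) (by omega) fun p hp hp' => h3 p (by omega) (by omega)
    rw [show x + 1 + i = x + (i + 1) by omega] at this
    exact .trans (.single rfl rfl (step_right_mark ha h2 (by omega) hm)) this

theorem run_left {m : ℕ} (hm : m ≤ w.length) (j : ℕ) : ∀ x, j ≤ m →
    (∀ p, x ≤ p → p < x + j → ∃ a, inputTape w p = sp a) →
    Run (zag w zagLeft x m j) [] (zag w zagRight (x + j) m 1) := by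
  induction j with
  | zero =>
    intro x _ _
    exact .single rfl rfl step_left_end
  | succ j ih =>
    intro x h2 h3
    obtain ⟨a, ha⟩ := h3 x le_rfl (by omega)
    have := ih (x + 1) (by omega) fun p hp hp' => h3 p (by omega) (by omega)
    rw [show x + 1 + j = x + (j + 1) by omega] at this
    exact .trans (.single rfl rfl (step_left_mark ha h2 hm)) this

/-- From one square to the next: a mark is added without reading, then `m` spins are read on the way
left over the old marks and `m + 1` on the way right over all of them. The first square is the
hard-wired `4`, read with two marks. -/
theorem run_count {m : ℕ} (hm : 2 ≤ m) (h : ∀ p, 1 ≤ p → p ≤ m ^ 2 → ∃ a, inputTape w p = sp a) :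
    Run (machine.init w) [] (zag w zagRight (m ^ 2 + 1) m (m + 1)) := by
  induction m, hm using Nat.le_induction with
  | base =>
    obtain ⟨a, ha⟩ := h 1 le_rfl (by norm_num)
    obtain ⟨b, hb⟩ := h 2 (by norm_num) (by norm_num)
    obtain ⟨c, hc⟩ := h 3 (by norm_num) (by norm_num)
    obtain ⟨d, hd⟩ := h 4 (by norm_num) (by norm_num)
    have h1 : Run (machine.init w) [] (zag w pre1 2 1 2) := .single rfl rfl (step_pre0 ha)
    have h2 : Run (zag w pre1 2 1 2) [] (zag w pre2 3 2 3) := .single rfl rfl (step_pre1 hb)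
    have h3 : Run (zag w pre2 3 2 3) [] (zag w pre3 4 2 3) := .single rfl rfl (step_pre2 hc)
    have h4 : Run (zag w pre3 4 2 3) [] (zag w zagRight 5 2 3) := .single rfl rfl (step_pre3 hd)
    exact h1.trans (h2.trans (h3.trans h4))
  | succ m hm ih =>
    have h0 : (m + 1) ^ 2 = m ^ 2 + 2 * m + 1 := by ring
    rw [h0] at h
    have h1 := ih fun p hp hp' => h p hp (by omega)
    obtain ⟨a, ha⟩ := h (m ^ 2 + 1) (by omega) (by omega)
    have hL : m + 1 ≤ w.length :=
      (by nlinarith : m + 1 ≤ m ^ 2 + 1).trans (le_length_of_inputTape ha).2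
    have h2 : Run (zag w zagRight (m ^ 2 + 1) m (m + 1)) [] (zag w zagLeft (m ^ 2 + 1) (m + 1) m) :=
      .single rfl rfl (step_right_blank ha hL)
    have h3 := run_left hL m (m ^ 2 + 1) (by omega) fun p hp hp' => h p (by omega) (by omega)
    have h4 := run_right hL (m + 1) (m ^ 2 + 1 + m) 1 (by omega) le_rfl
      fun p hp hp' => h p (by omega) (by omega)
    rw [show (m + 1) ^ 2 + 1 = m ^ 2 + 1 + m + (m + 1) by rw [h0]; ring]
    exact h1.trans (h2.trans (h3.trans h4))

end count

/-! The input -/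

/-- The configurations of spins, written on a tape. -/
abbrev spins (s : List Bool) : List Cell := s.map sp

section input

variable {w : List Letter} {s : List Bool} {rest : List Letter}

theorem inputTape_spin (hw : w = s.map .spin ++ .bullet :: rest) {i : ℕ} (h1 : 1 ≤ i)
    (h2 : i ≤ s.length) : inputTape w i = sp (spinAt s i) := by
  obtain ⟨i, rfl⟩ : ∃ j, i = j + 1 := ⟨i - 1, by omega⟩
  refine tape_of_getElem? ?_ (by simp [hw]; omega)
  have h3 : i < s.length := h2
  rw [List.getElem?_map, hw, List.getElem?_append_left (by simpa using h3), List.getElem?_map]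
  simp [spinAt, List.getD_eq_getElem?_getD, List.getElem?_eq_getElem h3]

theorem inputTape_bullet (hw : w = s.map .spin ++ .bullet :: rest) :
    inputTape w (s.length + 1) = letter .bullet := by
  refine tape_of_getElem? ?_ (by simp [hw])
  rw [List.getElem?_map, hw, List.getElem?_append_right (by simp)]
  simp

/-- On the reversed copy the position decreases as the vertex increases: the two heads move in
opposite directions and keep a constant distance between their vertices. -/
theorem tape_spins {L : ℕ} {i : ℕ} (h1 : 1 ≤ i) (h2 : i ≤ s.length) (hL : s.length ≤ L) :
    tape L (spins s.reverse) (s.length + 1 - i) = sp (spinAt s i) := by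
  rw [show s.length + 1 - i = s.length - i + 1 by omega]
  refine tape_of_getElem? ?_ (by omega)
  rw [List.getElem?_map, List.getElem?_reverse (by omega),
    show s.length - 1 - (s.length - i) = i - 1 by omega, spinAt, List.getD_eq_getElem?_getD,
    List.getElem?_eq_getElem (by omega)]
  simp

/-- After the count the input head is at the last spin, so copying leftwards reverses the spins and
needs no rewinding. It ends with both heads on the first spin. -/
theorem run_copy (hw : w = s.map .spin ++ .bullet :: rest) {c : ℕ} {le lc : List Cell} (i : ℕ) :
    i ≤ s.length →
    Run (config w copy i (s.length - i + 1) 1 c (spins (s.drop i).reverse) le lc) []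
      (config w shift 1 s.length 1 c (spins s.reverse) le lc) := by
  have hL : s.length + 1 ≤ w.length := by simp [hw]
  induction i with
  | zero =>
    intro _
    have h1 : tape w.length (spins s.reverse) (s.length + 1) = blank := tape_blank (by simp) hL
    exact .single rfl rfl (step_config (.copy_end _ _) rfl h1 rfl rfl rfl rfl rfl rfl
      (update_tape_self h1) (Function.update_eq_self _ _) (Function.update_eq_self _ _))
  | succ i ih =>
    intro hi
    have h1 : tape w.length (spins (s.drop (i + 1)).reverse) (s.length - (i + 1) + 1) = blank :=
      tape_blank (by simp) (by omega)
    have h2 := update_tape_end (L := w.length) (spins (s.drop (i + 1)).reverse)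
      (sp (spinAt s (i + 1))) (by simp; omega)
    have h3 : spins (s.drop (i + 1)).reverse ++ [sp (spinAt s (i + 1))] =
        spins (s.drop i).reverse := by
      have h4 : spinAt s (i + 1) = s[i] := by
        simp [spinAt, List.getD_eq_getElem?_getD, List.getElem?_eq_getElem (show i < s.length from hi)]
      rw [List.drop_eq_getElem_cons (show i < s.length from hi), List.reverse_cons, h4]
      simp [spins]
    rw [h3] at h2
    simp only [List.length_map, List.length_reverse, List.length_drop] at h2
    have h5 := ih (by omega)
    rw [show s.length - i + 1 = s.length - (i + 1) + 1 + 1 by omega] at h5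
    exact .trans (.single rfl rfl (step_config (.copy _ _ _)
      (inputTape_spin hw (by omega) hi) h1 rfl rfl rfl rfl rfl rfl h2
      (Function.update_eq_self _ _) (Function.update_eq_self _ _))) h5

/-- The marks serve as a measure: one cell to the left per mark takes the second head from vertex
`1` to vertex `m + 1`. -/
theorem run_shift {x y m : ℕ} {le : List Cell} (hm : m ≤ w.length) (hs : s.length ≤ w.length)
    (j : ℕ) : j ≤ m → y + j ≤ s.length →
    Run (config w shift x (y + j) 1 j (spins s.reverse) le (marks m)) []
      (config w top x y 1 1 (spins s.reverse) le (marks m)) := by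
  induction j with
  | zero =>
    intro _ _
    exact .single rfl rfl (step_config (.shift_end _ _ _) rfl rfl rfl rfl rfl rfl rfl rfl
      (Function.update_eq_self _ _) (Function.update_eq_self _ _) (Function.update_eq_self _ _))
  | succ j ih =>
    intro h1 h2
    have h3 := tape_spins (s := s) (L := w.length) (i := s.length - (y + j)) (by omega) (by omega) hs
    rw [show s.length + 1 - (s.length - (y + j)) = y + (j + 1) by omega] at h3
    have h4 := tape_marks (L := w.length) (m := m) (j := j + 1) (by omega) h1 hm
    exact .trans (.single rfl rfl (step_config (.shift _ _ _) rfl h3 rfl h4 rfl rfl rfl rfl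
      (update_tape_self h3) (Function.update_eq_self _ _) (update_tape_self h4)))
      (ih (by omega) (by omega))

theorem run_reset {x y m : ℕ} {ly le : List Cell} (hm : m ≤ w.length)
    (j : ℕ) : j ≤ m →
    Run (config w reset x y 1 j ly le (marks m)) [] (config w top x y 1 1 ly le (marks m)) := by
  induction j with
  | zero =>
    intro _
    exact .single rfl rfl (step_config (.reset_end _ _ _) rfl rfl rfl rfl rfl rfl rfl rfl
      (Function.update_eq_self _ _) (Function.update_eq_self _ _) (Function.update_eq_self _ _))
  | succ j ih =>
    intro h1
    have h4 := tape_marks (L := w.length) (m := m) (j := j + 1) (by omega) h1 hm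
    exact .trans (.single rfl rfl (step_config (.reset _ _ _) rfl rfl rfl h4 rfl rfl rfl rfl
      (Function.update_eq_self _ _) (Function.update_eq_self _ _) (update_tape_self h4)))
      (ih (by omega))

/-- The preparations. -/
theorem run_prepare (hw : w = s.map .spin ++ .bullet :: rest) {m : ℕ} (hm : 2 ≤ m)
    (hs : s.length = m ^ 2) :
    Run (machine.init w) []
      (config w top 1 (m ^ 2 - m) 1 1 (spins s.reverse) (digits false []) (marks m)) := by
  have hL : s.length + 1 ≤ w.length := by simp [hw]
  have hmm : m ≤ m ^ 2 := by nlinarith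
  have h1 := run_count (w := w) hm fun p hp hp' => ⟨_, inputTape_spin hw hp (hs ▸ hp')⟩
  have h2 : Run (zag w zagRight (m ^ 2 + 1) m (m + 1)) [] (zag w copy (m ^ 2) m m) :=
    .single rfl rfl (step_square (hs ▸ inputTape_bullet hw) (by omega))
  have h3 := run_copy hw (c := m) (le := digits false []) (lc := marks m) s.length le_rfl
  rw [Nat.sub_self, List.drop_length, hs] at h3
  have h4 := run_shift (w := w) (s := s) (x := 1) (y := m ^ 2 - m) (m := m) (le := digits false [])
    (by omega) (by omega) m le_rfl (by omega)
  rw [Nat.sub_add_cancel hmm] at h4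
  exact h1.trans (h2.trans (h3.trans h4))

end input

end Ising.SquareLBA

namespace Ising.SquareLBA

open Cell State Move

/-! The order of the edges -/

/-- The edges in the order in which they are visited, for the first vertices. -/
def visit (m : ℕ) : ℕ → List (ℕ × ℕ)
  | 0 => []
  | i + 1 => visit m i ++ (if i + 1 + m ≤ m ^ 2 then [(i + 1, i + 1 + m)] else []) ++
      (if m ∣ i + 1 then [] else [(i + 1, i + 2)])

theorem mem_visit {m i : ℕ} {d : ℕ × ℕ} : d ∈ visit m i ↔ ∃ j < i,
    (j + 1 + m ≤ m ^ 2 ∧ d = (j + 1, j + 1 + m)) ∨ (¬ m ∣ j + 1 ∧ d = (j + 1, j + 2)) := by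
  induction i with
  | zero => simp [visit]
  | succ i ih =>
    have h1 : d ∈ visit m (i + 1) ↔ d ∈ visit m i ∨
        ((i + 1 + m ≤ m ^ 2 ∧ d = (i + 1, i + 1 + m)) ∨ (¬ m ∣ i + 1 ∧ d = (i + 1, i + 2))) := by
      rw [visit]
      by_cases h1 : i + 1 + m ≤ m ^ 2 <;> by_cases h2 : m ∣ i + 1 <;> simp [h1, h2]
    rw [h1, ih]
    constructor
    · rintro (⟨j, hj, h⟩ | h)
      · exact ⟨j, by omega, h⟩
      · exact ⟨i, by omega, h⟩
    · rintro ⟨j, hj, h⟩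
      rcases Nat.lt_succ_iff_lt_or_eq.1 hj with hj | rfl
      · exact .inl ⟨j, hj, h⟩
      · exact .inr h

/-- Edges of different vertices differ in their first end, and the two edges of one vertex in their
second end because `m ≥ 2`. -/
theorem nodup_visit {m : ℕ} (hm : 2 ≤ m) (i : ℕ) : (visit m i).Nodup := by
  induction i with
  | zero => exact List.nodup_nil
  | succ i ih =>
    have h1 : ∀ k, (i + 1, k) ∉ visit m i := by
      intro k h
      obtain ⟨j, hj, ⟨-, h⟩ | ⟨-, h⟩⟩ := mem_visit.1 h <;>
        · simp only [Prod.mk.injEq] at h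
          omega
    rw [visit]
    split_ifs with h2 h3 h3
    · simpa [List.nodup_append, ih] using fun a b h h1' h2' => h1 _ (h1' ▸ h2' ▸ h)
    · rw [List.append_assoc, List.nodup_append]
      refine ⟨ih, by simp; omega, ?_⟩
      rintro ⟨a, b⟩ h d hd rfl
      simp only [List.cons_append, List.nil_append, List.mem_cons, Prod.mk.injEq, List.not_mem_nil,
        or_false] at hd
      rcases hd with ⟨rfl, -⟩ | ⟨rfl, -⟩ <;> exact h1 _ h
    · simpa using ih
    · simpa [List.nodup_append, ih] using fun a b h h1' h2' => h1 _ (h1' ▸ h2' ▸ h)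

theorem length_visit_le (m i : ℕ) : (visit m i).length ≤ 2 * i := by
  induction i with
  | zero => rfl
  | succ i ih =>
    rw [visit]
    split_ifs <;> simp <;> omega

theorem mem_visit_iff_mem_edges {m : ℕ} (hm : 2 ≤ m) (d : ℕ × ℕ) :
    d ∈ visit m (m ^ 2) ↔ d ∈ model2d.edges (m ^ 2) := by
  have h0 : m ≤ m ^ 2 := by nlinarith
  have h1 : m ∣ m ^ 2 := Dvd.intro_left _ (sq m).symm
  rw [mem_visit]
  simp only [model2d, sqrt_sq, horizontal, vertical, Finset.mem_union, Finset.mem_image,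
    Finset.mem_filter, Finset.mem_Icc]
  constructor
  · rintro ⟨j, hj, ⟨h, rfl⟩ | ⟨h, rfl⟩⟩
    · exact .inr ⟨j + 1, by omega, rfl⟩
    · have : j + 1 ≠ m ^ 2 := fun h' => h (h' ▸ h1)
      exact .inl ⟨j + 1, ⟨by omega, h⟩, rfl⟩
  · rintro (⟨i, ⟨hi, h⟩, rfl⟩ | ⟨i, hi, rfl⟩)
    · obtain ⟨j, rfl⟩ : ∃ j, i = j + 1 := ⟨i - 1, by omega⟩
      exact ⟨j, by omega, .inr ⟨h, rfl⟩⟩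
    · obtain ⟨j, rfl⟩ : ∃ j, i = j + 1 := ⟨i - 1, by omega⟩
      exact ⟨j, by omega, .inl ⟨by omega, rfl⟩⟩

/-- The energy along a list of edges. -/
def energyAlong (s : List Bool) (es : List (ℕ × ℕ)) : ℤ :=
  (es.map fun d => coupling (spinAt s d.1) (spinAt s d.2)).sum

theorem energyAlong_append (s : List Bool) (es : List (ℕ × ℕ)) (d : ℕ × ℕ) :
    energyAlong s (es ++ [d]) = energyAlong s es + coupling (spinAt s d.1) (spinAt s d.2) := by
  simp [energyAlong]

theorem abs_energyAlong_le (s : List Bool) (es : List (ℕ × ℕ)) :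
    |energyAlong s es| ≤ es.length := by
  induction es with
  | nil => simp [energyAlong]
  | cons d es ih =>
    have h1 : |coupling (spinAt s d.1) (spinAt s d.2)| = 1 := by
      unfold coupling
      split_ifs <;> simp
    calc |energyAlong s (d :: es)|
        ≤ |coupling (spinAt s d.1) (spinAt s d.2)| + |energyAlong s es| := by
          simpa [energyAlong] using abs_add_le _ _
      _ ≤ _ := by rw [h1, List.length_cons]; push_cast; linarith

theorem energyAlong_visit {m : ℕ} (hm : 2 ≤ m) {s : List Bool} (hs : s.length = m ^ 2) :
    energyAlong s (visit m (m ^ 2)) = model2d.hamiltonian s := by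
  rw [Model.hamiltonian, energyOn, energyAlong, hs, ← List.sum_toFinset _ (nodup_visit hm _)]
  congr 1
  ext d
  rw [List.mem_toFinset, mem_visit_iff_mem_edges hm]

/-! The main loop -/

section main

variable {w : List Letter} {s : List Bool} {rest : List Letter} {m : ℕ}

/-- The list of marked configurations in a computation in which the energies along the edges of a
list have been added. -/
def IsTrace (w : List Letter) (s : List Bool) (es : List (ℕ × ℕ)) (tr : List machine.Config) :
    Prop :=
  tr.length = es.length ∧
    ∀ t x, tr[t]? = some x → marking.Holds w.length x (energyAlong s (es.take t))

theorem IsTrace.append {es : List (ℕ × ℕ)} {tr : List machine.Config} (h : IsTrace w s es tr)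
    {c : machine.Config} (hc : marking.Holds w.length c (energyAlong s es)) (d : ℕ × ℕ) :
    IsTrace w s (es ++ [d]) (tr ++ [c]) := by
  obtain ⟨h1, h2⟩ := h
  refine ⟨by simp [h1], fun t x hx => ?_⟩
  rcases lt_trichotomy t tr.length with ht | ht | ht
  · rw [List.getElem?_append_left ht] at hx
    rw [List.take_append_of_le_length (by omega)]
    exact h2 t x hx
  · subst ht
    rw [List.getElem?_concat_length, Option.some.injEq] at hx
    subst hx
    rwa [h1, List.take_left']
    rfl
  · rw [List.getElem?_eq_none (by simp; omega)] at hx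
    simp at hx

/-- A configuration with the given state and head positions is reached, after the energies along the
edges of a list have been added. -/
def Reached (w : List Letter) (s : List Bool) (m : ℕ) (es : List (ℕ × ℕ)) (q : State) (x y c : ℕ) :
    Prop :=
  ∃ tr neg v, Run (machine.init w) tr
      (config w q x y 1 c (spins s.reverse) (digits neg v) (marks m)) ∧
    IsTrace w s es tr ∧ v.length + 1 ≤ w.length ∧ energy neg v = energyAlong s es

theorem Reached.run {es : List (ℕ × ℕ)} {q q' : State} {x y c x' y' c' : ℕ}
    (h : Reached w s m es q x y c)
    (hrun : ∀ le, Run (config w q x y 1 c (spins s.reverse) le (marks m)) []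
      (config w q' x' y' 1 c' (spins s.reverse) le (marks m))) :
    Reached w s m es q' x' y' c' := by
  obtain ⟨tr, neg, v, h1, h2, h3, h4⟩ := h
  have := h1.trans (hrun (digits neg v))
  rw [List.append_nil] at this
  exact ⟨tr, neg, v, this, h2, h3, h4⟩

/-- Equal spins contribute `-1`, so the test for equality is the sign to be added. The marked
configuration is the one before the addition, which holds the energy along `es`. -/
theorem Reached.add {es : List (ℕ × ℕ)} {r : Ret} {d : ℕ × ℕ} {x y c : ℕ}
    (h : Reached w s m es (.add r (spinAt s d.1 == spinAt s d.2)) x y c)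
    (hlt : es.length + 1 < 2 ^ (w.length - 1)) :
    Reached w s m (es ++ [d]) r.state x y c := by
  obtain ⟨tr, neg, v, h1, h2, h3, h4⟩ := h
  have h5 : |energy neg v| + 1 < 2 ^ (w.length - 1) := by
    rw [h4]
    refine lt_of_le_of_lt (add_le_add_left (abs_energyAlong_le s es) 1) ?_
    exact_mod_cast hlt
  obtain ⟨neg', v', h6, h7, h8⟩ := exists_run_add r _ neg v h3 h5
  refine ⟨_, neg', v', h1.trans h8, h2.append ?_ d, h7, ?_⟩
  · rw [← h4]
    exact holds_config h3
  · rw [h6, h4, energyAlong_append]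
    simp [coupling]

theorem add_mod_cases (hm : 2 ≤ m) (i : ℕ) :
    (m ∣ i + 1 ∧ i % m + 1 = m ∧ (i + 1) % m = 0) ∨
    (¬ m ∣ i + 1 ∧ i % m + 1 < m ∧ (i + 1) % m = i % m + 1) := by
  have h1 : i % m < m := Nat.mod_lt _ (by omega)
  have h2 : (i + 1) % m = (i % m + 1) % m := by rw [Nat.mod_add_mod]
  rw [Nat.dvd_iff_mod_eq_zero, h2]
  rcases (show i % m + 1 ≤ m from h1).lt_or_eq with h3 | h3
  · rw [Nat.mod_eq_of_lt h3]
    omega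
  · rw [h3, Nat.mod_self]
    omega

/-- The space bound: the lattice has at most `2 * m ^ 2` edges, the tape has at least `m ^ 2` cells
for digits, and `m ≥ 2` gives `m ^ 2 ≥ 4`. -/
theorem two_mul_add_one_lt {n : ℕ} (hn : 4 ≤ n) : 2 * n + 1 < 2 ^ n := by
  induction n, hn using Nat.le_induction with
  | base => norm_num
  | succ n _ ih => rw [pow_succ]; omega

variable (hw : w = s.map .spin ++ .bullet :: rest) (hm : 2 ≤ m) (hs : s.length = m ^ 2)
include hw hm hs

theorem marks_le : m + 1 ≤ w.length := by
  have : m ≤ m ^ 2 := by nlinarith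
  simp only [hw, List.length_append, List.length_map, List.length_cons, hs]
  omega

theorem length_lt {es : List (ℕ × ℕ)} (h : es.length ≤ 2 * m ^ 2) :
    es.length + 1 < 2 ^ (w.length - 1) := by
  have h1 : 4 ≤ m ^ 2 := by nlinarith
  have h2 : 2 ^ m ^ 2 ≤ 2 ^ (w.length - 1) :=
    Nat.pow_le_pow_right (by norm_num) (by simp [hw, hs])
  have := two_mul_add_one_lt h1
  omega

/-- At vertex `i + 1` the second head is on cell `m ^ 2 - m - i`, which holds spin `i + 1 + m`, and
the counter is on the column. On leaving, the spin of the vertex is remembered in the state `next`.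
-/
theorem Reached.vertical {i : ℕ} {es : List (ℕ × ℕ)} (hi : i < m ^ 2) (hes : es.length ≤ 2 * i)
    (h : Reached w s m es top (i + 1) (m ^ 2 - m - i) (i % m + 1)) :
    Reached w s m (es ++ (if i + 1 + m ≤ m ^ 2 then [(i + 1, i + 1 + m)] else []))
      (next (spinAt s (i + 1))) (i + 2) (m ^ 2 - m - (i + 1)) (i % m + 2) := by
  have hL := marks_le hw hm hs
  have hx : inputTape w (i + 1) = sp (spinAt s (i + 1)) := inputTape_spin hw (by omega) (by omega)
  have hc : tape w.length (marks m) (i % m + 1) = mark :=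
    tape_marks (by omega) (Nat.mod_lt _ (by omega)) (by omega)
  split_ifs with h1
  · have hy := tape_spins (s := s) (L := w.length) (i := i + 1 + m) (by omega) (by omega)
      (by simp [hw])
    rw [hs, show m ^ 2 + 1 - (i + 1 + m) = m ^ 2 - m - i by omega] at hy
    have h2 : Reached w s m es (.add .vertical (spinAt s (i + 1) == spinAt s (i + 1 + m)))
        (i + 1) (m ^ 2 - m - i) (i % m + 1) :=
      h.run fun le => .single rfl rfl (step_config (.vertical _ _ _ _) hx hy rfl rfl rfl rfl rfl rfl
        (update_tape_self hy) (Function.update_eq_self _ _) (Function.update_eq_self _ _))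
    have h3 := h2.add (d := (i + 1, i + 1 + m)) (length_lt hw hm hs (by omega))
    exact h3.run fun le => .single rfl rfl (step_config (.mid _ _ _) hx hy rfl hc rfl
      (by simp only [Move.apply]; omega) rfl rfl
      (update_tape_self hy) (Function.update_eq_self _ _) (update_tape_self hc))
  -- In the last row the truncated difference is `0`: the head rests on the left endmarker, which
  -- signals that there is no vertex below.
  · have h0 : m ^ 2 - m - i = 0 := by omega
    rw [List.append_nil]
    refine h.run fun le => .single rfl rfl (step_config (.no_vertical _ _) hx ?_ rfl hc rfl
      ?_ rfl rfl ?_ (Function.update_eq_self _ _) (update_tape_self hc))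
    · rw [h0]; rfl
    · simp only [Move.apply]; omega
    · rw [h0]; exact Function.update_eq_self _ _

/-- The counter has moved on with the vertex. A mark means that the row continues; a blank means
that it has ended, and then a bullet shows that the lattice has ended too. -/
theorem Reached.horizontal {i : ℕ} {es : List (ℕ × ℕ)} (hi : i < m ^ 2)
    (hes : es.length ≤ 2 * i + 1)
    (h : Reached w s m es (next (spinAt s (i + 1))) (i + 2) (m ^ 2 - m - (i + 1)) (i % m + 2)) :
    (i + 1 < m ^ 2 ∧ Reached w s m (es ++ (if m ∣ i + 1 then [] else [(i + 1, i + 2)]))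
      top (i + 2) (m ^ 2 - m - (i + 1)) ((i + 1) % m + 1)) ∨
    (i + 1 = m ^ 2 ∧ Reached w s m (es ++ (if m ∣ i + 1 then [] else [(i + 1, i + 2)]))
      compare (m ^ 2 + 1) (m ^ 2 - m - (i + 1)) (m + 1)) := by
  have hL := marks_le hw hm hs
  obtain ⟨h1, h2, h3⟩ | ⟨h1, h2, h3⟩ := add_mod_cases hm i
  · rw [if_pos h1, List.append_nil, h3]
    have hc : tape w.length (marks m) (m + 1) = blank := tape_marks_end hL
    rw [show i % m + 2 = m + 1 by omega] at h
    rcases (show i + 1 ≤ m ^ 2 from hi).lt_or_eq with h4 | h4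
    · have hx : inputTape w (i + 2) = sp (spinAt s (i + 2)) :=
        inputTape_spin hw (by omega) (by omega)
      refine .inl ⟨h4, h.run fun le => .trans (.single rfl rfl ?_) (run_reset (by omega) m le_rfl)⟩
      exact step_config (.row_end _ _ _ _) hx rfl rfl hc rfl rfl rfl rfl
        (Function.update_eq_self _ _) (Function.update_eq_self _ _) (update_tape_self hc)
    · have hx : inputTape w (i + 2) = letter .bullet := by
        have := inputTape_bullet hw
        rwa [hs, ← h4] at this
      refine .inr ⟨h4, h.run fun le => .single rfl rfl ?_⟩
      exact step_config (.last _ _ _) hx rfl rfl hc (by simp only [Move.apply]; omega) rfl rfl rfl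
        (Function.update_eq_self _ _) (Function.update_eq_self _ _) (update_tape_self hc)
  · have h4 : i + 1 ≠ m ^ 2 := fun h4 => h1 (h4 ▸ Dvd.intro_left _ (sq m).symm)
    rw [if_neg h1, h3]
    have hx : inputTape w (i + 2) = sp (spinAt s (i + 2)) :=
      inputTape_spin hw (by omega) (by omega)
    have hc : tape w.length (marks m) (i % m + 2) = mark := tape_marks (by omega) h2 (by omega)
    have h5 : Reached w s m es (.add .horizontal (spinAt s (i + 1) == spinAt s (i + 2)))
        (i + 2) (m ^ 2 - m - (i + 1)) (i % m + 2) :=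
      h.run fun le => .single rfl rfl (step_config (.horizontal _ _ _ _) hx rfl rfl hc rfl rfl rfl rfl
        (Function.update_eq_self _ _) (Function.update_eq_self _ _) (update_tape_self hc))
    exact .inl ⟨by omega, h5.add (d := (i + 1, i + 2)) (length_lt hw hm hs (by omega))⟩

theorem reached_top {i : ℕ} (hi : i < m ^ 2) :
    Reached w s m (visit m i) top (i + 1) (m ^ 2 - m - i) (i % m + 1) := by
  induction i with
  | zero =>
    refine ⟨[], false, [], ?_, ⟨rfl, by simp⟩, ?_, rfl⟩
    · simpa using run_prepare hw hm hs
    · simp [hw]; omega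
  | succ i ih =>
    have h1 := (ih (by omega)).vertical hw hm hs (by omega) (length_visit_le m i)
    have h2 := h1.horizontal hw hm hs (by omega) (by
      have := length_visit_le m i
      split_ifs <;> simp <;> omega)
    obtain ⟨-, h⟩ | ⟨h, -⟩ := h2
    · exact h
    · omega

theorem reached_compare :
    Reached w s m (visit m (m ^ 2)) compare (m ^ 2 + 1) 0 (m + 1) := by
  have h0 : 0 < m ^ 2 := by positivity
  obtain ⟨i, hi⟩ : ∃ i, m ^ 2 = i + 1 := ⟨m ^ 2 - 1, by omega⟩
  have h1 := (reached_top hw hm hs (i := i) (by omega)).vertical hw hm hs (by omega)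
    (length_visit_le m i)
  have h2 := h1.horizontal hw hm hs (by omega) (by
    have := length_visit_le m i
    split_ifs <;> simp <;> omega)
  obtain ⟨h, -⟩ | ⟨-, h⟩ := h2
  · omega
  · rw [show m ^ 2 - m - (i + 1) = 0 by omega] at h
    have h3 : visit m (m ^ 2) = visit m (i + 1) := by rw [← hi]
    rw [h3]
    exact h

end main

end Ising.SquareLBA

namespace Ising.SquareLBA

open Cell State Move

/-! Acceptance -/

section accept

variable {w : List Letter} {x y e c : ℕ} {ly le lc : List Cell}

theorem acceptsFrom_accept : machine.AcceptsFrom (config w accept x y e c ly le lc) := by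
  refine ⟨_, .refl, rfl, fun d h => ?_⟩
  obtain ⟨_, _, _, _, h⟩ := rule_of_step h
  generalize d.state = q at h
  cases h

theorem not_acceptsFrom {q : State} (hq : q ≠ accept)
    (h : ∀ sx sy se sc, tape w.length (w.map .letter) x = sx → tape w.length ly y = sy →
      tape w.length le e = se → tape w.length lc c = sc →
      ∀ q' mx ty te tc, ¬ Rule q sx sy se sc q' mx ty te tc) :
    ¬ machine.AcceptsFrom (config w q x y e c ly le lc) := by
  rintro ⟨d, h1, h2, -⟩
  obtain rfl | ⟨d, h1, -⟩ := h1.cases_head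
  · exact hq h2
  · obtain ⟨_, _, _, _, h1⟩ := rule_of_step h1
    exact h _ _ _ _ rfl rfl rfl rfl _ _ _ _ _ h1

theorem acceptsFrom_step {a b : machine.Config} (h : machine.Step a b) :
    machine.AcceptsFrom a ↔ machine.AcceptsFrom b :=
  LBA.acceptsFrom_congr machine_deterministic (.single h)

theorem acceptsFrom_run {a b : machine.Config} {tr : List machine.Config} (h : Run a tr b) :
    machine.AcceptsFrom a ↔ machine.AcceptsFrom b :=
  LBA.acceptsFrom_congr machine_deterministic h.reflTransGen

theorem inputTape_of_append_cons {u t : List Letter} {a : Letter} (hw : w = u ++ a :: t) :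
    inputTape w (u.length + 1) = letter a := by
  refine tape_of_getElem? ?_ (by simp [hw])
  rw [List.getElem?_map, hw]
  simp

theorem inputTape_length : inputTape w (w.length + 1) = rightEnd := tape_right _ (by omega)

/-- The last test. -/
theorem acceptsFrom_zero {s : Bool} (r : List Bool) : ∀ u : List Bool,
    u.length + r.length + 1 ≤ w.length →
    (machine.AcceptsFrom (config w zero x y (u.length + 2) c ly (digits s (u ++ r)) lc) ↔
      value r = 0) := by
  induction r with
  | nil =>
    intro u hu
    refine iff_of_true ?_ rfl
    rw [List.append_nil]
    have h1 : (digits s u).length < u.length + 2 := by simp [digits]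
    rcases le_or_gt (u.length + 2) w.length with h2 | h2
    · have h3 := tape_blank h1 h2
      exact (acceptsFrom_step (step_config (.zero_blank _ _ _) rfl rfl h3 rfl rfl rfl rfl rfl
        (Function.update_eq_self _ _) (update_tape_self h3) (Function.update_eq_self _ _))).2
        acceptsFrom_accept
    · have h3 := tape_right (digits s u) h2
      exact (acceptsFrom_step (step_config (.zero_right _ _ _) rfl rfl h3 rfl rfl rfl rfl rfl
        (Function.update_eq_self _ _) (update_tape_self h3) (Function.update_eq_self _ _))).2
        acceptsFrom_accept
  | cons b r ih =>
    intro u hu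
    rw [List.length_cons] at hu
    have h1 : tape w.length (digits s (u ++ b :: r)) (u.length + 2) = digit b :=
      tape_of_getElem? (by simp [digits]) (by omega)
    cases b with
    | false =>
      rw [acceptsFrom_step (step_config (.zero _ _ _) rfl rfl h1 rfl rfl rfl rfl rfl
        (Function.update_eq_self _ _) (update_tape_self h1) (Function.update_eq_self _ _))]
      have h2 := ih (u ++ [false]) (by rw [List.length_append, List.length_singleton]; omega)
      rw [List.append_assoc, List.length_append, List.length_singleton] at h2
      refine h2.trans ?_
      simp [value_cons]
    | true =>
      refine iff_of_false (not_acceptsFrom (by simp) ?_) (by simp [value_cons])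
      rw [h1]
      rintro _ _ _ _ _ _ rfl _ _ _ _ _ _ h
      cases h

theorem energy_eq_zero {s : Bool} {v : List Bool} : energy s v = 0 ↔ value v = 0 := by
  cases s <;> simp [energy]

theorem acceptsFrom_read_end {o : Option Bool} {neg : Bool} {v : List Bool}
    (hv : v.length + 1 ≤ w.length) :
    machine.AcceptsFrom (config w (read o) (w.length + 1) y 1 c ly (digits neg v) lc) ↔
      energy neg v = 0 := by
  have h1 : tape w.length (digits neg v) 1 = sign neg := tape_of_getElem? rfl (by omega)
  rw [acceptsFrom_step (step_config (.read_end _ _ _ _) inputTape_length rfl h1 rfl rfl rfl rfl rfl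
      (Function.update_eq_self _ _) (update_tape_self h1) (Function.update_eq_self _ _)),
    energy_eq_zero]
  exact acceptsFrom_zero v [] (by simpa [add_comm] using hv)

/-- Reading `+` subtracts `1` and reading `-` adds `1`. The state keeps the sign that was read,
which excludes mixed signs. -/
theorem acceptsFrom_read_sign {o : Option Bool} {neg b : Bool} {v : List Bool} {u t : List Letter}
    (hw : w = u ++ signLetter b :: t) (ho : o ≠ some !b) (hv : v.length + 1 ≤ w.length)
    (hlt : |energy neg v| + 1 < 2 ^ (w.length - 1)) :
    ∃ neg' v', energy neg' v' = energy neg v + (if b then 1 else -1) ∧ v'.length + 1 ≤ w.length ∧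
      (machine.AcceptsFrom (config w (read o) (u.length + 1) y 1 c ly (digits neg v) lc) ↔
        machine.AcceptsFrom
          (config w (read (some b)) (u.length + 1 + 1) y 1 c ly (digits neg' v') lc)) := by
  obtain ⟨neg', v', h1, h2, h3⟩ := exists_run_add (w := w) (x := u.length + 1 + 1) (y := y) (c := c)
    (ly := ly) (lc := lc) (.read b) (!b) neg v hv hlt
  refine ⟨neg', v', ?_, h2, ?_⟩
  · rw [h1]
    cases b <;> rfl
  · rw [acceptsFrom_step (step_config (.read o b _ _ _ _ ho rfl) (inputTape_of_append_cons hw) rfl rfl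
      rfl rfl rfl rfl rfl (Function.update_eq_self _ _) (Function.update_eq_self _ _)
      (Function.update_eq_self _ _))]
    exact acceptsFrom_run h3

/-- The list is the unary encoding of the integer, with the given sign. -/
def IsUnary (b : Bool) (z : ℤ) (t : List Letter) : Prop :=
  ∃ k : ℕ, t = List.replicate k (signLetter b) ∧ z = (if b then -1 else 1) * (k : ℤ)

theorem isUnary_nil {b : Bool} {z : ℤ} : IsUnary b z [] ↔ z = 0 := by
  constructor
  · rintro ⟨k, h, rfl⟩
    obtain rfl : k = 0 := by simpa using h
    simp
  · rintro rfl
    exact ⟨0, rfl, by simp⟩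

/-- The recursion that the automaton follows: a letter is removed and the integer is corrected
accordingly. -/
theorem isUnary_cons {b : Bool} {z : ℤ} {a : Letter} {t : List Letter} :
    IsUnary b z (a :: t) ↔ a = signLetter b ∧ IsUnary b (z + if b then 1 else -1) t := by
  constructor
  · rintro ⟨_ | k, h, rfl⟩
    · simp at h
    · rw [List.replicate_succ, List.cons.injEq] at h
      refine ⟨h.1, k, h.2, ?_⟩
      cases b <;> simp
  · rintro ⟨rfl, k, rfl, h⟩
    refine ⟨k + 1, rfl, ?_⟩
    cases b <;> simp at h ⊢ <;> omega

theorem unary_eq_iff {z : ℤ} {t : List Letter} : unary z = t ↔ ∃ b, IsUnary b z t := by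
  unfold unary unaryWith
  constructor
  · rintro rfl
    split_ifs with h
    · exact ⟨false, z.toNat, rfl, by simp; omega⟩
    · exact ⟨true, (-z).toNat, rfl, by simp; omega⟩
  · rintro ⟨_ | _, k, rfl, rfl⟩
    · simp [signLetter]
    -- Zero with the negative sign also has the empty encoding, which `unary` obtains from the
    -- nonnegative case.
    · rcases k with _ | k
      · simp
      · rw [if_neg (by simp; omega)]
        simp [signLetter]

theorem not_acceptsFrom_read {o : Option Bool} {neg : Bool} {v : List Bool} {u t : List Letter}
    {a : Letter} (hw : w = u ++ a :: t) (h : ∀ b, o ≠ some (!b) → a ≠ signLetter b) :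
    ¬ machine.AcceptsFrom (config w (read o) (u.length + 1) y 1 c ly (digits neg v) lc) := by
  refine not_acceptsFrom (by simp) ?_
  rintro sx _ _ _ hx _ _ _ _ _ _ _ _ hr
  obtain rfl : letter a = sx := (inputTape_of_append_cons hw).symm.trans hx
  cases hr with
  | read _ neg _ _ _ _ h1 h2 => exact h _ h1 h2

/-- The bound allows for the worst case, in which the sign is wrong and every letter takes the
energy further away from zero. -/
theorem acceptsFrom_read_some {b : Bool} (t : List Letter) : ∀ (u : List Letter) (neg : Bool)
    (v : List Bool), w = u ++ t → v.length + 1 ≤ w.length →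
    |energy neg v| + t.length < 2 ^ (w.length - 1) →
    (machine.AcceptsFrom (config w (read (some b)) (u.length + 1) y 1 c ly (digits neg v) lc) ↔
      IsUnary b (energy neg v) t) := by
  induction t with
  | nil =>
    intro u neg v hw hv _
    rw [List.append_nil] at hw
    rw [isUnary_nil, ← acceptsFrom_read_end hv, hw]
  | cons a t ih =>
    intro u neg v hw hv hlt
    rw [List.length_cons, Nat.cast_succ] at hlt
    rw [isUnary_cons]
    by_cases ha : a = signLetter b
    · subst ha
      obtain ⟨neg', v', h1, h2, h3⟩ := acceptsFrom_read_sign (y := y) (c := c) (ly := ly) (lc := lc)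
        (neg := neg) (o := some b) hw (by simp) hv (by omega)
      have h4 : |energy neg' v'| ≤ |energy neg v| + 1 := by
        rw [h1]
        refine (abs_add_le _ _).trans (le_of_eq ?_)
        cases b <;> simp
      have h5 := ih (u ++ [signLetter b]) neg' v' (by simpa using hw) h2 (by omega)
      rw [List.length_append, List.length_singleton] at h5
      rw [h3, h5, h1, eq_self, true_and]
    · refine iff_of_false (not_acceptsFrom_read hw fun b' h1 h2 => ha ?_) fun h => ha h.1
      rw [h2, signLetter_inj]
      cases b <;> cases b' <;> simp_all

theorem acceptsFrom_read_none {t u : List Letter} {neg : Bool} {v : List Bool} (hw : w = u ++ t)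
    (hv : v.length + 1 ≤ w.length) (hlt : |energy neg v| + t.length < 2 ^ (w.length - 1)) :
    machine.AcceptsFrom (config w (read none) (u.length + 1) y 1 c ly (digits neg v) lc) ↔
      unary (energy neg v) = t := by
  rw [unary_eq_iff]
  rcases t with _ | ⟨a, t⟩
  · rw [List.append_nil] at hw
    simp only [isUnary_nil, exists_const]
    rw [← acceptsFrom_read_end hv, hw]
  · rw [List.length_cons, Nat.cast_succ] at hlt
    simp only [isUnary_cons]
    by_cases ha : ∃ b, a = signLetter b
    · obtain ⟨b, rfl⟩ := ha
      obtain ⟨neg', v', h1, h2, h3⟩ := acceptsFrom_read_sign (y := y) (c := c) (ly := ly) (lc := lc)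
        (neg := neg) (o := none) hw (by simp) hv (by omega)
      have h4 : |energy neg' v'| ≤ |energy neg v| + 1 := by
        rw [h1]
        refine (abs_add_le _ _).trans (le_of_eq ?_)
        cases b <;> simp
      have h5 := acceptsFrom_read_some (w := w) (y := y) (c := c) (ly := ly) (lc := lc) (b := b) t
        (u ++ [signLetter b]) neg' v' (by simpa using hw) h2 (by omega)
      rw [List.length_append, List.length_singleton] at h5
      rw [h3, h5, h1]
      constructor
      · exact fun h => ⟨b, rfl, h⟩
      · rintro ⟨b', h, h'⟩
        rw [signLetter_inj] at h
        exact h ▸ h'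
    · exact iff_of_false (not_acceptsFrom_read hw fun b' _ h2 => ha ⟨b', h2⟩)
        fun ⟨b, h, _⟩ => ha ⟨b, h⟩

theorem acceptsFrom_compare {s : List Bool} {rest : List Letter} {neg : Bool} {v : List Bool}
    (hw : w = s.map .spin ++ .bullet :: rest) (hv : v.length + 1 ≤ w.length)
    (hlt : |energy neg v| + rest.length < 2 ^ (w.length - 1)) :
    machine.AcceptsFrom (config w compare (s.length + 1) y 1 c ly (digits neg v) lc) ↔
      unary (energy neg v) = rest := by
  rw [acceptsFrom_step (step_config (.compare _ _ _) (inputTape_bullet hw) rfl rfl rfl rfl rfl rfl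
    rfl (Function.update_eq_self _ _) (Function.update_eq_self _ _) (Function.update_eq_self _ _))]
  have := acceptsFrom_read_none (w := w) (y := y) (c := c) (ly := ly) (lc := lc) (t := rest)
    (u := s.map .spin ++ [.bullet]) (by simpa using hw) hv hlt
  rw [List.length_append, List.length_map, List.length_singleton] at this
  exact this

end accept

/-! The inputs on which the automaton finishes its preparations -/

section sound

variable {w : List Letter}

/-- The input begins with a square number of spins and a bullet. -/
def IsSquare (w : List Letter) : Prop :=
  ∃ (s : List Bool) (t : List Letter) (m : ℕ), 2 ≤ m ∧ s.length = m ^ 2 ∧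
    w = s.map .spin ++ .bullet :: t

theorem inputTape_spin_or {s : List Bool} {t : List Letter} (hw : w = s.map .spin ++ t) :
    (∃ a t', w = (s ++ [a]).map .spin ++ t' ∧ t = .spin a :: t' ∧
      inputTape w (s.length + 1) = sp a) ∨
    ((∀ a, inputTape w (s.length + 1) ≠ sp a) ∧
      (inputTape w (s.length + 1) = letter .bullet → ∃ t', t = .bullet :: t')) := by
  rcases t with _ | ⟨a, t⟩
  · have h1 : inputTape w (s.length + 1) = rightEnd := tape_right _ (by simp [hw])
    rw [h1]
    simp
  · have h1 := inputTape_of_append_cons hw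
    rw [List.length_map] at h1
    rw [h1]
    cases a with
    | spin a => exact .inl ⟨a, t, by simp [hw], rfl, rfl⟩
    | _ => simp

/-- The equations tie the number of spins read to marks and counter: with `n + 1` marks it is `n ^ 2
+ n + j - 1` on the way right and `n ^ 2 + n - j` on the way left. The bullet is accepted only at
the blank `j = n + 2`, where the number is `(n + 1) ^ 2`. -/
theorem isSquare_of_zag (N : ℕ) : ∀ (s : List Bool) (t : List Letter) (n j : ℕ), t.length = N →
    w = s.map .spin ++ t →
    (1 ≤ n → 1 ≤ j → j ≤ n + 2 → s.length + 1 = n ^ 2 + n + j →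
      machine.AcceptsFrom (zag w zagRight (s.length + 1) (n + 1) j) → IsSquare w) ∧
    (2 ≤ n → j ≤ n → s.length + j = n ^ 2 + n →
      machine.AcceptsFrom (zag w zagLeft (s.length + 1) (n + 1) j) → IsSquare w) := by
  induction N using Nat.strong_induction_on with
  | _ N ih =>
    intro s t n j hN hw
    have hlen : w.length = s.length + N := by simp [hw, hN]
    have hor := inputTape_spin_or hw
    have hspin : ∀ a t', t = Letter.spin a :: t' → t'.length < N := by
      rintro a t' rfl
      rw [← hN]
      exact Nat.lt_succ_self _
    -- At the turns no letter is read, so the induction hypothesis is not available there. The cases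
    -- are chained instead: left before the end, right (which may turn into left), then left at the
    -- endmarker.
    have hleft : ∀ n j, 2 ≤ n → j + 1 ≤ n → s.length + (j + 1) = n ^ 2 + n →
        machine.AcceptsFrom (zag w zagLeft (s.length + 1) (n + 1) (j + 1)) → IsSquare w := by
      intro n j h1 h2 h3 h
      have h4 : n + 1 ≤ w.length := by nlinarith
      obtain ⟨a, t', hw', rfl, hx⟩ | ⟨hx, -⟩ := hor
      · rw [acceptsFrom_step (step_left_mark hx (by omega) h4)] at h
        refine (ih _ (hspin _ _ rfl) (s ++ [a]) t' n j rfl hw').2 h1 (by omega) ?_ ?_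
        · rw [List.length_append, List.length_singleton]; omega
        · rwa [List.length_append, List.length_singleton]
      · have hc : tape w.length (marks (n + 1)) (j + 1) = mark :=
          tape_marks (by omega) (by omega) h4
        refine absurd h (not_acceptsFrom (by simp) fun sx _ _ sc hx' _ _ hc' _ _ _ _ _ h => ?_)
        obtain rfl := hc.symm.trans hc'
        cases h with
        | left_mark a => exact hx a hx'
    have hright : ∀ n j, 1 ≤ n → 1 ≤ j → j ≤ n + 2 → s.length + 1 = n ^ 2 + n + j →
        machine.AcceptsFrom (zag w zagRight (s.length + 1) (n + 1) j) → IsSquare w := by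
      intro n j h1 h2 h3 h4 h
      obtain ⟨a, t', hw', rfl, hx⟩ | ⟨hx, hx1⟩ := hor
      · rcases h3.lt_or_eq with h5 | rfl
        · have h6 : n + 1 ≤ w.length := by nlinarith
          rw [acceptsFrom_step (step_right_mark hx h2 (by omega) h6)] at h
          refine (ih _ (hspin _ _ rfl) (s ++ [a]) t' n (j + 1) rfl hw').1 h1 (by omega) (by omega)
            ?_ ?_
          · rw [List.length_append, List.length_singleton]; omega
          · rwa [List.length_append, List.length_singleton]
        · have h6 : n + 2 ≤ w.length := by nlinarith
          rw [acceptsFrom_step (step_right_blank hx h6)] at h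
          exact hleft (n + 1) n (by omega) (by omega) (by nlinarith) h
      · by_cases h5 : j = n + 2 ∧ ∃ t', t = .bullet :: t'
        · obtain ⟨rfl, t', rfl⟩ := h5
          exact ⟨s, t', n + 1, by omega, by nlinarith, hw⟩
        · refine absurd h (not_acceptsFrom (by simp) fun sx _ _ sc hx' _ _ hc' _ _ _ _ _ h => ?_)
          cases h with
          | right_mark a => exact hx a hx'
          | right_blank a => exact hx a hx'
          -- Only the blank behind the marks permits this rule, so `j = n + 2`.
          | square =>
            refine h5 ⟨?_, hx1 hx'⟩
            by_contra h6
            have hc : tape w.length (marks (n + 1)) j = mark :=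
              tape_marks h2 (by omega) (by nlinarith)
            rw [hc'] at hc
            cases hc
    refine ⟨hright n j, fun h1 h2 h3 h => ?_⟩
    rcases j with _ | j
    · rw [acceptsFrom_step step_left_end] at h
      exact hright n 1 (by omega) le_rfl (by omega) (by omega) h
    · exact hleft n j h1 h2 h3 h

theorem isSquare_of_acceptsFrom (h : machine.AcceptsFrom (machine.init w)) : IsSquare w := by
  obtain ⟨a, t, hw, rfl, hx⟩ | ⟨hx, -⟩ := inputTape_spin_or (w := w) (s := []) (t := w) rfl
  swap
  · rw [init_eq] at h
    refine absurd h (not_acceptsFrom (by simp) fun sx _ _ sc hx' _ _ _ _ _ _ _ _ h => ?_)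
    cases h with
    | pre0 a => exact hx a hx'
  rw [acceptsFrom_step (step_pre0 hx)] at h
  obtain ⟨b, t, hw, rfl, hx⟩ | ⟨hx, -⟩ := inputTape_spin_or hw
  swap
  · refine absurd h (not_acceptsFrom (by simp) fun sx _ _ sc hx' _ _ _ _ _ _ _ _ h => ?_)
    cases h with
    | pre1 a => exact hx a hx'
  rw [acceptsFrom_step (step_pre1 hx)] at h
  obtain ⟨c, t, hw, rfl, hx⟩ | ⟨hx, -⟩ := inputTape_spin_or hw
  swap
  · refine absurd h (not_acceptsFrom (by simp) fun sx _ _ sc hx' _ _ _ _ _ _ _ _ h => ?_)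
    cases h with
    | pre2 a => exact hx a hx'
  rw [acceptsFrom_step (step_pre2 hx)] at h
  obtain ⟨d, t, hw, rfl, hx⟩ | ⟨hx, -⟩ := inputTape_spin_or hw
  swap
  · refine absurd h (not_acceptsFrom (by simp) fun sx _ _ sc hx' _ _ _ _ _ _ _ _ h => ?_)
    cases h with
    | pre3 a => exact hx a hx'
  rw [acceptsFrom_step (step_pre3 hx)] at h
  -- Four spins and two marks, with the head on the blank behind them: `n = 1` and `j = n + 2`.
  exact (isSquare_of_zag _ _ t 1 3 rfl hw).1 le_rfl (by norm_num) (by norm_num) rfl h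

end sound

/-! The automaton decides the language -/

theorem acceptsFrom_of_reached {w : List Letter} {s : List Bool} {rest : List Letter} {m : ℕ}
    (hw : w = s.map .spin ++ .bullet :: rest) (hm : 2 ≤ m) (hs : s.length = m ^ 2)
    {neg : Bool} {v : List Bool} (hv : v.length + 1 ≤ w.length)
    (he : energy neg v = energyAlong s (visit m (m ^ 2))) {ly lc : List Cell} {y c : ℕ} :
    machine.AcceptsFrom (config w compare (m ^ 2 + 1) y 1 c ly (digits neg v) lc) ↔
      unary (model2d.hamiltonian s) = rest := by
  have h1 : w.length = m ^ 2 + 1 + rest.length := by simp [hw, hs]; omega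
  have h2 : 4 ≤ m ^ 2 := by nlinarith
  have h3 : |energy neg v| ≤ 2 * m ^ 2 := by
    rw [he]
    refine (abs_energyAlong_le _ _).trans ?_
    exact_mod_cast length_visit_le m (m ^ 2)
  -- The comparison may add as many units as there are letters behind the bullet; those letters also
  -- lengthen the tape.
  have h4 : |energy neg v| + rest.length < 2 ^ (w.length - 1) := by
    have h5 := two_mul_add_one_lt (n := w.length - 1) (by omega)
    have h6 : 2 * ((w.length - 1 : ℕ) : ℤ) + 1 < 2 ^ (w.length - 1) := by exact_mod_cast h5
    rw [show w.length - 1 = m ^ 2 + rest.length by omega] at h6 ⊢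
    push_cast at h6
    linarith
  rw [← energyAlong_visit hm hs, ← he, ← acceptsFrom_compare hw hv h4, hs]

theorem machine_language : machine.language = model2d.language := by
  ext w
  have h : ∀ (s : List Bool) (rest : List Letter) (m : ℕ), 2 ≤ m → s.length = m ^ 2 →
      w = s.map .spin ++ .bullet :: rest →
      (machine.AcceptsFrom (machine.init w) ↔ unary (model2d.hamiltonian s) = rest) := by
    intro s rest m hm hs hw
    obtain ⟨tr, neg, v, h1, -, h3, h4⟩ := reached_compare hw hm hs
    rw [acceptsFrom_run h1, acceptsFrom_of_reached hw hm hs h3 h4]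
  constructor
  · intro hw
    obtain ⟨s, t, m, hm, hs, rfl⟩ := isSquare_of_acceptsFrom hw
    refine ⟨s, ⟨m, hm, hs⟩, ?_⟩
    rw [(h s t m hm hs rfl).1 hw]
    rfl
  · rintro ⟨s, ⟨m, hm, hs⟩, rfl⟩
    exact (h s _ m hm hs rfl).2 rfl

/-- By determinism the explicit path is the only computation up to the comparison, and a halting
computation must run along it. Additions during the comparison also begin in `add` states, but they
come after the first `compare` configuration and so are not in the trace. -/
theorem marking_operates {m : ℕ} (hm : 2 ≤ m) :
    marking.Operates model2d (m ^ 2) (visit m (m ^ 2)) := by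
  intro s hs neg k e w c₀ D
  obtain ⟨tr, neg', v, h1, ⟨h2, h2'⟩, h3, h4⟩ := reached_compare (w := w) (rest := e) rfl hm hs
  obtain ⟨pre, h5, h6⟩ := h1.exists_reachesFirst rfl
  refine ⟨⟨pre, _, h5⟩, fun r c hr hc => ⟨_, h1.mem_of_isRun machine_deterministic hr hc.2, rfl⟩,
    fun pre' c hpre' => ?_⟩
  obtain ⟨rfl, rfl⟩ := ReachesFirst.unique machine_deterministic h5 hpre'
  refine ⟨?_, ?_, ?_⟩
  · rw [h6]
    exact ⟨h2, h2'⟩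
  · rw [← energyAlong_visit hm hs, ← h4]
    exact holds_config h3
  · exact acceptsFrom_of_reached rfl hm hs h3 h4

end Ising.SquareLBA

namespace Ising

theorem model2d_isConstructiveContextSensitive : model2d.IsConstructiveContextSensitive := by
  refine ⟨SquareLBA.machine, SquareLBA.machine_language, SquareLBA.marking, ?_⟩
  rintro _ ⟨m, hm, rfl⟩
  exact ⟨_, SquareLBA.nodup_visit hm _, SquareLBA.mem_visit_iff_mem_edges hm,
    SquareLBA.marking_operates hm⟩

end Ising

theorem mainTheorem5 :
    Ising.IsContextSensitive Ising.model2d.edgeLanguage ∧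
    Ising.model2d.IsConstructiveContextSensitive ∧
    Ising.model2d.IsLinear ∧
    ¬ Ising.model2d.IsLimited ∧
    ¬ Ising.model2d.IsConstructiveContextFree ∧
    ¬ Ising.model2d.language.IsContextFree :=
  ⟨Ising.model2d_edgeLanguage_isContextSensitive,
    Ising.model2d_isConstructiveContextSensitive,
    Ising.model2d_isLinear, Ising.not_model2d_isLimited,
    fun h => Ising.not_model2d_language_isContextFree h.isContextFree,
    Ising.not_model2d_language_isContextFree⟩
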